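/- Let $G=(V,E)$ be a finite graph without multiple edges, drawn in the plane so that distinct vertices are distinct points, edges are straight line segments, and an edge contains no vertices besides its two endpoints (edges may cross). Let $E_A\subset E$ be a set of "additional" edges such that $(V,E_A)$ contains no cycle ($E_A=\emptyset$ is allowed), and let $x=(x_{uv})_{uv\in E}$ be arbitrary complex edge weights. *Loops.* A closed path of $n\ge 3$ steps is a sequence $(v_0,\dots,v_{n-1})$ of vertices, indices read modulo $n$, with $v_iv_{i+1}\in E$ and $v_{i+2}\ne v_i$ for all $i$. Order the vertices lexicographically by their coordinates. A loop is a closed path that is lexicographically smallest among all rotations of itself and of its reverse. For a loop $\ell=(v_0,\dots,v_{n-1})$, let $m(\ell)$ be $n$ divided by the smallest period of the cyclic sequence; let $\alpha(\ell)=\sum_{i=0}^{n-1}\angle(v_{i+1}-v_i,\,v_{i+2}-v_{i+1})$, where $\angle(a,b)\in(-\pi,\pi)$ is the turning angle from $a$ to $b$; let $\operatorname{sgn}(\ell)=-e^{i\alpha(\ell)/2}$; let $$w(\ell;x)=\frac{\operatorname{sgn}(\ell)}{m(\ell)}\prod_{i=0}^{n-1}x_{v_iv_{i+1}};$$ and let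 the length $r(\ell)$ be the number of $i\in\{0,\dots,n-1\}$ with $v_iv_{i+1}\in E\setminus E_A$. *Configurations.* For $r\ge 1$ let $\mathcal C_r$ be the set of all finite ordered sequences $(\ell_1,\dots,\ell_s)$ of loops (repetitions allowed) with $r(\ell_1)+\dots+r(\ell_s)=r$, and let $\mathcal C_r^*\subset\mathcal C_r$ be the set of edge-disjoint ones: no loop traverses an edge more than once, and no two loops $\ell_i,\ell_j$ with $i\ne j$ traverse a common edge. *Generating function.* Let $$Z(x)=\sum_{F}(-1)^{C_F}\prod_{uv\in F}x_{uv},$$ the sum being over all $F\subset E$ (including $\emptyset$) such that every vertex has even degree in $(V,F)$, where $C_F$ is the number of unordered pairs of distinct edges in $F$ that intersect in a point which is not a vertex. Then for every $r\ge 1$ the set $\mathcal C_r$ is finite, and $$\sum_{s=1}^\infty\ \sum_{(\ell_1,\dots,\ell_s)\in\mathcal C_r\setminus\mathcal C_r^*}\frac1{s!}\prod_{i=1}^s w(\ell_i;x)=0 .$$ Moreover the series over $r$ below converges (absolutely), and $$Z(x)=1+\sum_{r=1}^\infty\ \sum_{s=1}^\infty\ \sum_{(\ell_1,\dots,\ell_s)\in\mathcal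 C_r}\frac1{s!}\prod_{i=1}^s w(\ell_i;x).$$ -/

import Mathlib

namespace SignedLoops

open scoped Nat

noncomputable section

variable {V : Type*}

/-- A graph on `V` (no multiple edges) drawn in the plane `ℂ` with straight edges: distinct vertices
sit at distinct points, and an edge contains no vertex other than its two endpoints.
Edges are allowed to intersect each other. -/
structure IsStraightDrawing (G : SimpleGraph V) (p : V → ℂ) : Prop where
  injective : Function.Injective p
  eq_or_eq_of_mem_segment : ∀ u v w : V, G.Adj u v → p w ∈ segment ℝ (p u) (p v) → w = u ∨ w = v

/-- The segment in the plane representing an unordered pair of vertices. -/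
def edgeSegment (p : V → ℂ) : Sym2 V → Set ℂ :=
  Sym2.lift ⟨fun u v => segment ℝ (p u) (p v), fun u v => segment_symm ℝ (p u) (p v)⟩

/-- Two edges cross if they are distinct and intersect in a point which is not a vertex. -/
def Crosses (p : V → ℂ) (e f : Sym2 V) : Prop :=
  e ≠ f ∧ ∃ z ∈ edgeSegment p e ∩ edgeSegment p f, z ∉ Set.range p

open Classical in
/-- `C_F`, the number of unordered pairs of edges in `F` that cross each other. -/
def crossingNumber (p : V → ℂ) (F : Finset (Sym2 V)) : ℕ :=
  ((F.powersetCard 2).filter fun P => ∃ e f, P = {e, f} ∧ Crosses p e f).card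

open Classical in
/-- Every vertex has even degree in `(V, F)`. -/
def IsEvenEdgeSet (F : Finset (Sym2 V)) : Prop :=
  ∀ v : V, Even (F.filter fun e => v ∈ e).card

open Classical in
/-- The generating function `Z(x)` of even subgraphs. -/
def evenGenFun [Fintype V] (G : SimpleGraph V) (p : V → ℂ) (x : Sym2 V → ℂ) : ℂ :=
  ∑ F ∈ (Finset.univ : Finset (Finset (Sym2 V))).filter
      (fun F => (∀ e ∈ F, e ∈ G.edgeSet) ∧ IsEvenEdgeSet F),
    (-1) ^ crossingNumber p F * ∏ e ∈ F, x e

/-- A non-backtracking path, as the list of its vertices. -/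
def IsNBPath (G : SimpleGraph V) (l : List V) : Prop :=
  (∀ i, ∀ h : i + 1 < l.length, G.Adj l[i] l[i + 1]) ∧
    ∀ i, ∀ h : i + 2 < l.length, l[i + 2] ≠ l[i]

/-- A closed path: all rotations are paths. The condition on the length discards the degenerate
sequences with at most two terms, which have no rotation long enough to detect that
(cyclically) they use a non-edge or backtrack. -/
def IsClosedPath (G : SimpleGraph V) (l : List V) : Prop :=
  3 ≤ l.length ∧ ∀ k, IsNBPath G (l.rotate k)

/-- The coordinates of a vertex, in the lexicographically ordered plane. -/
def coord (p : V → ℂ) (v : V) : ℝ ×ₗ ℝ := toLex ((p v).re, (p v).im)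

/-- Lexicographic comparison of vertex sequences, where vertices are compared lexicographically by
their coordinates. -/
def LexLE (p : V → ℂ) (l l' : List V) : Prop :=
  l.map (coord p) ≤ l'.map (coord p)

/-- A loop: a closed path which is the smallest among all rotations of itself and of its reverse. -/
def IsLoop (G : SimpleGraph V) (p : V → ℂ) (l : List V) : Prop :=
  IsClosedPath G l ∧ ∀ k, LexLE p l (l.rotate k) ∧ LexLE p l (l.reverse.rotate k)

/-- The edges `v₀v₁, v₁v₂, …, vₙ₋₁v₀` traversed by a cyclic sequence, with repetitions. -/
def loopEdges (l : List V) : List (Sym2 V) :=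
  List.zipWith (fun u v => s(u, v)) l (l.rotate 1)

/-- The multiplicity: number of steps divided by the smallest period. -/
def multiplicity (l : List V) : ℕ :=
  l.length / Function.minimalPeriod (fun l' : List V => l'.rotate 1) l

/-- The turning angle from the vector `v - u` to the vector `w - v`. -/
def turningAngle (p : V → ℂ) (u v w : V) : ℝ :=
  Complex.arg ((p w - p v) / (p v - p u))

/-- The winding angle: the sum of all turning angles at consecutive (cyclic) triples. -/
def windingAngle (p : V → ℂ) (l : List V) : ℝ :=
  (List.zipWith3 (turningAngle p) l (l.rotate 1) (l.rotate 2)).sum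

def loopSign (p : V → ℂ) (l : List V) : ℂ :=
  -Complex.exp (Complex.I / 2 * (windingAngle p l : ℂ))

/-- The signed weight `w(ℓ; x)`. -/
def loopWeight (p : V → ℂ) (x : Sym2 V → ℂ) (l : List V) : ℂ :=
  loopSign p l / (multiplicity l : ℂ) * ((loopEdges l).map x).prod

open Classical in
/-- The length `r(ℓ)`: the number of steps along edges that are not additional. -/
def loopLength (EA : Set (Sym2 V)) (l : List V) : ℕ :=
  (loopEdges l).countP fun e => e ∉ EA

/-- All ordered loop configurations of total length `r`. -/
def configs (G : SimpleGraph V) (p : V → ℂ) (EA : Set (Sym2 V)) (r : ℕ) : Set (List (List V)) :=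
  {c | (∀ l ∈ c, IsLoop G p l) ∧ (c.map (loopLength EA)).sum = r}

/-- Every loop is edge-disjoint, and no two loops of the configuration share an edge (in particular
the loops are distinct). -/
def IsEdgeDisjointConfig (c : List (List V)) : Prop :=
  (∀ l ∈ c, (loopEdges l).Nodup) ∧
    c.Pairwise fun l l' => (loopEdges l).Disjoint (loopEdges l')

/-- The edge-disjoint loop configurations of total length `r`. -/
def edgeDisjointConfigs (G : SimpleGraph V) (p : V → ℂ) (EA : Set (Sym2 V)) (r : ℕ) :
    Set (List (List V)) :=
  {c ∈ configs G p EA r | IsEdgeDisjointConfig c}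

/-- `∑_{s ≥ 1} ∑_{(ℓ₁,…,ℓₛ) ∈ S} (1/s!) ∏ᵢ w(ℓᵢ; x)`, for a finite set `S` of configurations. -/
def configSum (p : V → ℂ) (x : Sym2 V → ℂ) (S : Set (List (List V))) : ℂ :=
  ∑' s : ℕ, ∑ᶠ c ∈ {c ∈ S | c.length = s + 1},
    1 / ((s + 1)! : ℂ) * (c.map (loopWeight p x)).prod

end

end SignedLoops

/-! The theorem is a combinatorial form of the Kac–Ward formula: with one variable per edge, Z =
exp(L), where L is the sum of the weights of all loops. Comparing coefficients in this formal
identity gives everything else.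

The core is algebraic. List the half-edges (darts) of the graph on a line so that those of one
vertex are consecutive; each edge becomes a chord and each even subgraph F gets the sign
(-1)^(interlaced chord pairs). A sum over subgraphs with two defects satisfies O = Z·1 + T·O
(`chordObservable_eq`), where T is a transition matrix on half-edges whose entries are edge weights
times order signs. Grading by the number of edges and taking traces, where each F with m edges
avoids |D| - 2m half-edges, yields the Newton identities -2m Z_m = ∑ Z_(m-i) tr T^i
(`chordGenFunDeg_newton`). This is Z² = det(1 - T) in trace form.

Geometry enters twice, with darts ordered by abscissa of the origin and then clockwise. Chord
interlacings and geometric crossings have the same parity on even subgraphs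
(`even_chordCrossings_add_crossingNumber`). The half-turning-angle phases of the Kac–Ward matrix
agree with the order signs up to conjugation by a diagonal matrix (`exp_half_turningAngle`). A
similarity of the plane makes all abscissas distinct beforehand.

The trace of the n-th power of the Kac–Ward matrix runs over closed paths of n steps. Rotations and
reversal group them into classes with one loop each and twice the period many members, so the trace
is -2n times the n-step loop sum (`trace_kacWardMatrix_pow_eq_loopSum`). The Newton identities then
say Z' = L'Z, hence Z = exp(L) degree by degree (`expLoopSum_eq_evenGenFunDeg`).

Taking the weights to be the variables of a polynomial ring separates the contributions by edge
multiset (`sum_configFiber`). Z is squarefree, so configurations that repeat an edge cancel within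
each multiset. The length r depends only on the multiset, so the cancellation survives grouping by
r. Acyclicity of the additional edges bounds the number of steps in terms of r, which makes each
group finite. -/

namespace SignedLoops

set_option linter.unusedSectionVars false

set_option linter.style.haveILetI false

noncomputable section

/-! ### Chord diagrams: signed even subgraphs and the linear equation for the two-defect observable.
-/

section HalfEdges

open scoped Classical

open Finset Function

variable {D W R : Type*} [LinearOrder D] [LinearOrder W] [CommRing R]

/-- The number of half-edges in `B` preceding `a`. -/
def below (B : Finset D) (a : D) : ℕ := #{b ∈ B | b < a}

/-- Every vertex carries an even number of half-edges of `B`. -/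
def EvenAt (o : D → W) (B : Finset D) : Prop := ∀ w, Even #{b ∈ B | o b = w}

/-- A set of half-edges which is a union of edges. -/
def BarClosed (bar : D → D) (F : Finset D) : Prop := ∀ h ∈ F, bar h ∈ F

/-- The number of pairs of interlaced edges in the chord diagram of `F`. -/
def chordCrossings (bar : D → D) (F : Finset D) : ℕ :=
  ∑ f ∈ F, ∑ g ∈ F, if f < g ∧ g < bar f ∧ bar f < bar g then 1 else 0

/-- The product of the edge weights in `F`. -/
def edgeWeight (bar : D → D) (x : D → R) (F : Finset D) : R := ∏ h ∈ F with h < bar h, x h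

/-- The sign of `b - a`. -/
def orderSign (R : Type*) [CommRing R] (a b : D) : R := if a < b then 1 else if b < a then -1 else 0

/-- The Kac–Ward transition matrix in the real gauge. -/
def chordTransition (o : D → W) (bar : D → D) (x : D → R) : Matrix D D R := fun e e' =>
  if o (bar e) = o e' then x e * orderSign R e (bar e) * orderSign R (bar e) e' else 0

theorem neg_one_pow_eq_of_even_add {n m : ℕ} (h : Even (n + m)) : (-1 : R) ^ n = (-1) ^ m :=
  neg_one_pow_congr (Nat.even_add.1 h)

/-- The ranks in `S` are 0, 1, ..., so this is the alternating sum 1 - 1 + 1 - .... -/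
theorem sum_neg_one_pow_below (S : Finset D) :
    ∑ s ∈ S, (-1 : R) ^ below S s = if Odd #S then 1 else 0 := by
  induction S using Finset.induction_on_max with
  | empty => simp
  | insert a s ha ih =>
    have hns : a ∉ s := fun h => lt_irrefl _ (ha a h)
    rw [sum_insert hns, card_insert_of_notMem hns]
    have h1 : below (insert a s) a = #s := by
      unfold below
      rw [filter_insert, if_neg (lt_irrefl a), filter_true_of_mem ha]
    have h2 : ∑ t ∈ s, (-1 : R) ^ below (insert a s) t = ∑ t ∈ s, (-1 : R) ^ below s t := by
      refine sum_congr rfl fun t ht => ?_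
      unfold below
      rw [filter_insert, if_neg (ha t ht).not_gt]
    rw [h1, h2, ih]
    rcases Nat.even_or_odd #s with h | h
    · simp [h.neg_one_pow, h]
    · simp [h.neg_one_pow, h]

/-- `S` is cut at `a`. The lower part carries the sign -1; the upper part carries +1, with ranks
shifted by the number of elements up to `a`. -/
theorem sum_orderSign_mul (S : Finset D) (a : D) :
    ∑ s ∈ S, orderSign R a s * (-1 : R) ^ below S s =
      -(if Odd #{s ∈ S | s < a} then 1 else 0) +
        (-1) ^ #{s ∈ S | s ≤ a} * (if Odd #{s ∈ S | a < s} then 1 else 0) := by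
  have h1 : ∑ s ∈ S with s < a, orderSign R a s * (-1 : R) ^ below S s =
      -(if Odd #{s ∈ S | s < a} then 1 else 0) := by
    rw [← sum_neg_one_pow_below, ← sum_neg_distrib]
    refine sum_congr rfl fun s hs => ?_
    have hs := (mem_filter.1 hs).2
    have : below {s ∈ S | s < a} s = below S s := by
      unfold below
      rw [filter_filter]
      congr 1
      refine filter_congr fun b _ => ⟨fun h => h.2, fun h => ⟨h.trans hs, h⟩⟩
    rw [this, orderSign, if_neg hs.not_gt, if_pos hs, neg_one_mul]
  have h2 : ∑ s ∈ S with a < s, orderSign R a s * (-1 : R) ^ below S s =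
      (-1) ^ #{s ∈ S | s ≤ a} * (if Odd #{s ∈ S | a < s} then 1 else 0) := by
    rw [← sum_neg_one_pow_below, mul_sum]
    refine sum_congr rfl fun s hs => ?_
    have hs := (mem_filter.1 hs).2
    have : below S s = #{s ∈ S | s ≤ a} + below {s ∈ S | a < s} s := by
      unfold below
      rw [filter_filter, ← card_union_of_disjoint]
      · congr 1
        ext b
        simp only [mem_filter, mem_union]
        constructor
        · rintro ⟨hb, hbs⟩
          rcases le_or_gt b a with h | h
          · exact Or.inl ⟨hb, h⟩
          · exact Or.inr ⟨hb, h, hbs⟩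
        · rintro (⟨hb, h⟩ | ⟨hb, h, h'⟩)
          · exact ⟨hb, h.trans_lt hs⟩
          · exact ⟨hb, h'⟩
      · rw [disjoint_filter]
        intro b _ h h'
        exact absurd h'.1 h.not_gt
    rw [this, pow_add, orderSign, if_pos hs, one_mul]
  rw [← h1, ← h2, ← sum_filter_add_sum_filter_not S (fun s => s < a)]
  congr 1
  rw [← sum_filter_add_sum_filter_not ({s ∈ S | ¬ s < a}) (fun s => a < s)]
  rw [filter_filter, filter_filter]
  have h3 : ∑ s ∈ S with ¬ s < a ∧ ¬ a < s, orderSign R a s * (-1 : R) ^ below S s = 0 := by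
    refine sum_eq_zero fun s hs => ?_
    have hs := (mem_filter.1 hs).2
    rw [orderSign, if_neg hs.2, if_neg hs.1, zero_mul]
  rw [h3, add_zero]
  refine sum_congr (filter_congr fun s _ => ⟨fun h => h.2, fun h => ⟨h.not_gt, h⟩⟩) fun _ _ => rfl

/-- In an odd set, the signed alternating sum detects the position of `a`, and vanishes if `a`
belongs to the set. -/
theorem sum_orderSign_mul_of_odd (S : Finset D) (a : D) (hS : Odd #S) :
    ∑ s ∈ S, orderSign R a s * (-1 : R) ^ below S s = if a ∈ S then 0 else (-1) ^ below S a := by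
  rw [sum_orderSign_mul]
  have hc : #{s ∈ S | s ≤ a} + #{s ∈ S | a < s} = #S := by
    rw [← card_filter_add_card_filter_not (s := S) (fun s => s ≤ a)]
    congr 2
    exact filter_congr fun s _ => not_le.symm
  -- Since `S` is odd, the parts strictly below and strictly above `a` have equal parity when `a ∈
  -- S`, and the two contributions cancel. Otherwise exactly one part is odd and only its
  -- contribution survives.
  by_cases ha : a ∈ S
  · have h1 : #{s ∈ S | s ≤ a} = #{s ∈ S | s < a} + 1 := by
      have : {s ∈ S | s ≤ a} = insert a {s ∈ S | s < a} := by
        ext s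
        simp only [mem_filter, mem_insert, le_iff_lt_or_eq]
        constructor
        · rintro ⟨h, h' | h'⟩ <;> simp [*]
        · rintro (rfl | h)
          · simp [ha]
          · simp [h]
      rw [this, card_insert_of_notMem (by simp)]
    rw [if_pos ha]
    rw [h1] at hc ⊢
    rcases Nat.even_or_odd #{s ∈ S | s < a} with h | h
    · have : ¬ Odd #{s ∈ S | a < s} := by
        rw [← hc] at hS; rw [Nat.not_odd_iff_even]; grind
      have h' : ¬ Odd #{s ∈ S | s < a} := Nat.not_odd_iff_even.2 h
      rw [if_neg this, if_neg h']; simp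
    · have : Odd #{s ∈ S | a < s} := by
        rw [← hc] at hS; grind
      rw [if_pos this, if_pos h, (Odd.add_one h).neg_one_pow]; ring
  · have h1 : #{s ∈ S | s ≤ a} = #{s ∈ S | s < a} := by
      congr 1
      refine filter_congr fun s hs => ⟨fun h => h.lt_of_ne ?_, le_of_lt⟩
      rintro rfl; exact ha hs
    rw [if_neg ha, below]
    rw [h1] at hc ⊢
    rcases Nat.even_or_odd #{s ∈ S | s < a} with h | h
    · have : Odd #{s ∈ S | a < s} := by
        rw [← hc] at hS; grind
      have h' : ¬ Odd #{s ∈ S | s < a} := Nat.not_odd_iff_even.2 h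
      rw [if_pos this, if_neg h']; simp
    · have : ¬ Odd #{s ∈ S | a < s} := by
        rw [← hc] at hS; rw [Nat.not_odd_iff_even]; grind
      rw [if_neg this, if_pos h, h.neg_one_pow]; ring

/-- `B` has an odd number of half-edges exactly at the vertex `v`. -/
def OddExactlyAt (o : D → W) (v : W) (B : Finset D) : Prop :=
  ∀ w, Odd #{b ∈ B | o b = w} ↔ w = v

/-- Removing a half-edge flips the parity at its own vertex and nowhere else. -/
theorem evenAt_erase_iff {o : D → W} {B : Finset D} {e : D} (he : e ∈ B) :
    EvenAt o (B.erase e) ↔ OddExactlyAt o (o e) B := by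
  refine forall_congr' fun w => ?_
  rw [filter_erase]
  by_cases hw : o e = w
  · have hm : e ∈ {b ∈ B | o b = w} := by simp [he, hw]
    have := card_erase_add_one hm
    rw [← this]
    simp [hw, Nat.odd_add_one]
  · have hm : e ∉ {b ∈ B | o b = w} := by simp [hw]
    rw [erase_eq_of_notMem hm]
    simp [Ne.symm hw]

theorem evenAt_insert_iff {o : D → W} {B : Finset D} {e : D} (he : e ∉ B) :
    EvenAt o (insert e B) ↔ OddExactlyAt o (o e) B := by
  refine forall_congr' fun w => ?_
  rw [filter_insert]
  by_cases hw : o e = w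
  · rw [if_pos hw, card_insert_of_notMem (by simp [he])]
    simp [hw, Nat.even_add_one]
  · rw [if_neg hw]
    simp [Ne.symm hw]

theorem OddExactlyAt.even_below {o : D → W} {v : W} {B : Finset D} (hB : OddExactlyAt o v B) :
    Even #{b ∈ B | o b < v} := by
  rw [card_eq_sum_card_image o]
  refine even_sum _ fun w hw => ?_
  obtain ⟨b, hb, rfl⟩ := mem_image.1 hw
  have hb := (mem_filter.1 hb).2
  rw [filter_filter]
  have : {a ∈ B | o a < v ∧ o a = o b} = {a ∈ B | o a = o b} :=
    filter_congr fun a _ => ⟨fun h => h.2, fun h => ⟨h ▸ hb, h⟩⟩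
  rw [this, ← Nat.not_odd_iff_even, hB (o b)]
  exact hb.ne

/-- Half-edges of one vertex are consecutive, so those preceding `a` at other vertices form complete
clusters of even size. The sign of a global rank is thus a local quantity at the vertex of `a`. -/
theorem OddExactlyAt.neg_one_pow_below {o : D → W} (ho : Monotone o) {B : Finset D} {a : D}
    (hB : OddExactlyAt o (o a) B) :
    (-1 : R) ^ below B a = (-1) ^ below {b ∈ B | o b = o a} a := by
  have : below B a = #{b ∈ B | o b < o a} + below {b ∈ B | o b = o a} a := by
    unfold below
    rw [filter_filter, ← card_union_of_disjoint]
    · congr 1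
      ext b
      simp only [mem_filter, mem_union]
      constructor
      · rintro ⟨hb, hba⟩
        rcases (ho hba.le).lt_or_eq with h | h
        · exact Or.inl ⟨hb, h⟩
        · exact Or.inr ⟨hb, h, hba⟩
      · rintro (⟨hb, h⟩ | ⟨hb, h, h'⟩)
        · exact ⟨hb, ho.reflect_lt h⟩
        · exact ⟨hb, h'⟩
    · rw [disjoint_filter]
      intro b _ h h'
      exact h.ne h'.1
  rw [this, pow_add, hB.even_below.neg_one_pow, one_mul]

/-- The local relation at a vertex: the signed sum over the ways of removing a half-edge at the
vertex of `a` equals the contribution of adding `a`. -/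
theorem sum_orderSign_vertex {o : D → W} (ho : Monotone o) (B : Finset D) (a : D) :
    ∑ e ∈ B with o a = o e ∧ EvenAt o (B.erase e), orderSign R a e * (-1 : R) ^ below B e =
      if a ∉ B ∧ EvenAt o (insert a B) then (-1) ^ below B a else 0 := by
  by_cases hB : OddExactlyAt o (o a) B
  · have h1 : {e ∈ B | o a = o e ∧ EvenAt o (B.erase e)} = {e ∈ B | o e = o a} := by
      refine filter_congr fun e he => ⟨fun h => h.1.symm, fun h => ⟨h.symm, ?_⟩⟩
      rw [evenAt_erase_iff he, h]; exact hB
    rw [h1]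
    have h2 : ∑ e ∈ B with o e = o a, orderSign R a e * (-1 : R) ^ below B e =
        ∑ e ∈ B with o e = o a, orderSign R a e * (-1 : R) ^ below {b ∈ B | o b = o a} e := by
      refine sum_congr rfl fun e he => ?_
      have he := (mem_filter.1 he).2
      rw [OddExactlyAt.neg_one_pow_below ho (he ▸ hB), he]
    rw [h2, sum_orderSign_mul_of_odd _ _ ((hB _).2 rfl)]
    by_cases ha : a ∈ B
    · simp [ha]
    · rw [if_neg (by simp [ha]), if_pos ⟨ha, (evenAt_insert_iff ha).2 hB⟩,
        hB.neg_one_pow_below ho]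
  · rw [if_neg, sum_eq_zero]
    · intro e he
      obtain ⟨he, h, h'⟩ := mem_filter.1 he
      rw [evenAt_erase_iff he, ← h] at h'
      exact absurd h' hB
    · rintro ⟨h, h'⟩
      exact hB ((evenAt_insert_iff h).1 h')

variable {o : D → W} {bar : D → D}

/-- `bar` is a fixed-point-free involution on `F`. -/
theorem even_card_of_barClosed (hb : Involutive bar) (hf : ∀ h, bar h ≠ h) {F : Finset D}
    (hF : BarClosed bar F) : Even #F := by
  have : ∑ _h ∈ F, (1 : ZMod 2) = 0 :=
    sum_involution (fun h _ => bar h) (fun _ _ => by decide) (fun h _ _ => hf h)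
      (fun h hh => hF h hh) (fun h _ => hb h)
  rw [sum_const, nsmul_one] at this
  exact (ZMod.natCast_eq_zero_iff_even).1 this

/-- The two added terms distinguish whether the interlaced chord starts inside the new chord or ends
inside it. -/
theorem chordCrossings_insert_insert (hb : Involutive bar) {F : Finset D} {e : D}
    (he : e ∉ F) (hbe : bar e ∉ F) (hlt : e < bar e) :
    chordCrossings bar (insert e (insert (bar e) F)) = chordCrossings bar F +
      #{g ∈ F | e < g ∧ g < bar e ∧ bar e < bar g} +
      #{f ∈ F | f < e ∧ e < bar f ∧ bar f < bar e} := by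
  have h1 : e ∉ insert (bar e) F := by simp [he, hlt.ne]
  have hn : ∀ g, ¬ (bar e < g ∧ g < e ∧ e < bar g) :=
    fun g h => lt_irrefl _ ((hlt.trans h.1).trans h.2.1)
  have hn' : ∀ f, ¬ (f < bar e ∧ bar e < bar f ∧ bar f < e) :=
    fun f h => lt_irrefl _ ((hlt.trans h.2.1).trans h.2.2)
  unfold chordCrossings
  simp only [sum_insert h1, sum_insert hbe, hb e, hn, hn', lt_irrefl, and_false, false_and,
    if_false, sum_const_zero, zero_add, sum_add_distrib, card_filter]
  ring

/-- The half-edges of `F` between the two ends of the new chord number the difference of the two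
ranks. Chords with both ends there contribute an even amount; each remaining such half-edge belongs
to one interlaced chord. -/
theorem even_chordCrossings_insert (hb : Involutive bar) (hf : ∀ h, bar h ≠ h) {F : Finset D}
    (hF : BarClosed bar F) {e : D} (he : e ∉ F) (hbe : bar e ∉ F) :
    Even (chordCrossings bar (insert e (insert (bar e) F)) +
      (chordCrossings bar F + below F e + below F (bar e))) := by
  wlog hlt : e < bar e generalizing e
  · have := this hbe (by rwa [hb e]) (by rw [hb e]; exact lt_of_le_of_ne (not_lt.1 hlt) (hf e))
    rw [hb e, insert_comm] at this
    convert this using 1; ring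
  rw [chordCrossings_insert_insert hb he hbe hlt]
  have h1 : below F (bar e) = below F e + #{h ∈ F | e < h ∧ h < bar e} := by
    unfold below
    rw [← card_union_of_disjoint]
    · congr 1
      ext b
      simp only [mem_filter, mem_union]
      constructor
      · rintro ⟨hb, h⟩
        rcases lt_trichotomy b e with h' | h' | h'
        · exact Or.inl ⟨hb, h'⟩
        · exact absurd hb (h' ▸ he)
        · exact Or.inr ⟨hb, h', h⟩
      · rintro (⟨hb, h⟩ | ⟨hb, h, h'⟩)
        · exact ⟨hb, h.trans hlt⟩
        · exact ⟨hb, h'⟩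
    · rw [disjoint_filter]
      intro b _ h h'
      exact h.not_gt h'.1
  have h2 : #{h ∈ F | e < h ∧ h < bar e} = #{g ∈ F | e < g ∧ g < bar e ∧ bar e < bar g} +
      #{f ∈ F | f < e ∧ e < bar f ∧ bar f < bar e} +
      #{h ∈ F | (e < h ∧ h < bar e) ∧ e < bar h ∧ bar h < bar e} := by
    have h3 : #{f ∈ F | f < e ∧ e < bar f ∧ bar f < bar e} =
        #{h ∈ F | (e < h ∧ h < bar e) ∧ bar h < e} := by
      refine card_bij' (fun h _ => bar h) (fun h _ => bar h) ?_ ?_ (fun h _ => hb h)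
        (fun h _ => hb h)
      · intro h hh
        obtain ⟨hh, h1, h2, h3⟩ := mem_filter.1 hh
        simp [hF h hh, hb h, h1, h2, h3]
      · intro h hh
        obtain ⟨hh, ⟨h1, h2⟩, h3⟩ := mem_filter.1 hh
        simp [hF h hh, hb h, h1, h2, h3]
    rw [h3, ← card_union_of_disjoint, ← card_union_of_disjoint]
    · congr 1
      ext h
      simp only [mem_filter, mem_union]
      constructor
      · rintro ⟨hh, h1, h2⟩
        have hne1 : bar h ≠ e := by rintro rfl; exact he (hF h hh)
        have hne2 : bar h ≠ bar e := fun h' => he (hb.injective h' ▸ hh)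
        rcases lt_or_gt_of_ne hne1 with h3 | h3
        · exact Or.inl (Or.inr ⟨hh, ⟨h1, h2⟩, h3⟩)
        · rcases lt_or_gt_of_ne hne2 with h4 | h4
          · exact Or.inr ⟨hh, ⟨h1, h2⟩, h3, h4⟩
          · exact Or.inl (Or.inl ⟨hh, h1, h2, h4⟩)
      · rintro ((⟨hh, h1, h2, -⟩ | ⟨hh, ⟨h1, h2⟩, -⟩) | ⟨hh, ⟨h1, h2⟩, -⟩) <;> exact ⟨hh, h1, h2⟩
    · rw [disjoint_left]
      intro h h1 h2
      simp only [mem_filter, mem_union] at h1 h2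
      rcases h1 with h1 | h1
      · exact h1.2.2.2.not_gt h2.2.2.2
      · exact h1.2.2.not_gt h2.2.2.1
    · rw [disjoint_filter]
      intro h _ h1 h2
      exact h2.2.not_gt (hlt.trans h1.2.2)
  have h4 : Even #{h ∈ F | (e < h ∧ h < bar e) ∧ e < bar h ∧ bar h < bar e} := by
    refine even_card_of_barClosed hb hf fun h hh => ?_
    obtain ⟨hh, h1, h2⟩ := mem_filter.1 hh
    simp [hF h hh, hb h, h1, h2]
  rw [h1, h2]
  generalize #{h ∈ F | (e < h ∧ h < bar e) ∧ e < bar h ∧ bar h < bar e} = m at *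
  grind

theorem edgeWeight_insert (x : D → R) (hx : ∀ h, x (bar h) = x h) (hb : Involutive bar)
    (hf : ∀ h, bar h ≠ h) {F : Finset D} {e : D} (he : e ∉ F) (hbe : bar e ∉ F) :
    edgeWeight bar x (insert e (insert (bar e) F)) = x e * edgeWeight bar x F := by
  unfold edgeWeight
  rw [filter_insert, filter_insert, hb e]
  rcases lt_or_gt_of_ne (hf e) with h | h
  · rw [if_neg h.not_gt, if_pos h, prod_insert (by simp [hbe]), hx]
  · rw [if_pos h, if_neg h.not_gt, prod_insert (by simp [he])]

theorem BarClosed.insert_insert (hb : Involutive bar) {F : Finset D} (hF : BarClosed bar F) (e : D) :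
    BarClosed bar (insert e (insert (bar e) F)) := by
  intro h hh
  simp only [mem_insert] at hh ⊢
  rcases hh with rfl | rfl | hh
  · simp
  · simp [hb e]
  · simp [hF h hh]

theorem BarClosed.erase_erase (hb : Involutive bar) {F : Finset D} (hF : BarClosed bar F) (e : D) :
    BarClosed bar ((F.erase e).erase (bar e)) := by
  intro h hh
  simp only [mem_erase] at hh ⊢
  refine ⟨fun h' => hh.2.1 (hb.injective h'), fun h' => hh.1 ?_, hF h hh.2.2⟩
  rw [← h', hb h]

variable [Fintype D]

/-- The signed generating function of even subgraphs in terms of chord crossings. -/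
def chordGenFun (o : D → W) (bar : D → D) (x : D → R) : R :=
  ∑ F : Finset D with BarClosed bar F ∧ EvenAt o F,
    (-1) ^ chordCrossings bar F * edgeWeight bar x F

/-- The signed generating function of subgraphs with two defects, `Z` times the inverse of
`1 - T`. -/
def chordObservable (o : D → W) (bar : D → D) (x : D → R) : Matrix D D R := fun e k =>
  ∑ F : Finset D with (BarClosed bar F ∧ k ∉ F) ∧ e ∈ insert k F ∧ EvenAt o ((insert k F).erase e),
    (-1) ^ (chordCrossings bar F + below F k + below (insert k F) e) * edgeWeight bar x F

theorem below_insert_self (F : Finset D) (k : D) : below (insert k F) k = below F k := by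
  unfold below
  rw [filter_insert, if_neg (lt_irrefl k)]

theorem chordObservable_diag (x : D → R) (k : D) :
    chordObservable o bar x k k = ∑ F : Finset D with (BarClosed bar F ∧ EvenAt o F) ∧ k ∉ F,
      (-1) ^ chordCrossings bar F * edgeWeight bar x F := by
  unfold chordObservable
  refine sum_congr (filter_congr fun F _ => ?_) fun F _ => ?_
  · constructor
    · rintro ⟨⟨h1, h2⟩, -, h3⟩
      rw [erase_insert h2] at h3
      exact ⟨⟨h1, h3⟩, h2⟩
    · rintro ⟨⟨h1, h2⟩, h3⟩
      refine ⟨⟨h1, h3⟩, mem_insert_self _ _, ?_⟩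
      rwa [erase_insert h3]
  · rw [below_insert_self, add_assoc, pow_add, Even.neg_one_pow (n := below F k + below F k) ⟨_, rfl⟩,
      mul_one]

/-- For fixed `F` the sum over `e'` is the local relation `sum_orderSign_vertex` at `bar e` for
`insert k F`: removing a half-edge in all possible ways is traded for adding `bar e`. -/
theorem sum_chordTransition_mul (ho : Monotone o) (x : D → R) (e k : D) :
    ∑ e', chordTransition o bar x e e' * chordObservable o bar x e' k =
      ∑ F : Finset D with (BarClosed bar F ∧ k ∉ F) ∧
          bar e ∉ insert k F ∧ EvenAt o (insert (bar e) (insert k F)),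
        x e * orderSign R e (bar e) * ((-1) ^ (chordCrossings bar F + below F k) *
          (-1) ^ below (insert k F) (bar e) * edgeWeight bar x F) := by
  have h1 : ∀ e', chordTransition o bar x e e' * chordObservable o bar x e' k =
      ∑ F : Finset D with BarClosed bar F ∧ k ∉ F,
        if e' ∈ insert k F ∧ o (bar e) = o e' ∧ EvenAt o ((insert k F).erase e') then
          x e * orderSign R e (bar e) * ((-1) ^ (chordCrossings bar F + below F k) *
          (orderSign R (bar e) e' * (-1) ^ below (insert k F) e') * edgeWeight bar x F) else 0 := by
    intro e'
    unfold chordObservable chordTransition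
    rw [← filter_filter, sum_filter, mul_sum]
    refine sum_congr rfl fun F _ => ?_
    by_cases h : o (bar e) = o e'
    · by_cases h' : e' ∈ insert k F ∧ EvenAt o ((insert k F).erase e')
      · rw [if_pos h, if_pos h', if_pos ⟨h'.1, h, h'.2⟩, pow_add]; ring
      · have h2 : ¬ (e' ∈ insert k F ∧ o (bar e) = o e' ∧ EvenAt o ((insert k F).erase e')) :=
          fun h'' => h' ⟨h''.1, h''.2.2⟩
        rw [if_neg h', if_neg h2, mul_zero]
    · have h2 : ¬ (e' ∈ insert k F ∧ o (bar e) = o e' ∧ EvenAt o ((insert k F).erase e')) :=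
        fun h'' => h h''.2.1
      rw [if_neg h, if_neg h2, zero_mul]
  simp_rw [h1]
  rw [sum_comm]
  conv_rhs => rw [← filter_filter, sum_filter]
  refine sum_congr rfl fun F _ => ?_
  have h2 := sum_orderSign_vertex (R := R) ho (insert k F) (bar e)
  rw [← sum_filter, ← mul_sum, ← sum_mul, ← mul_sum]
  have h3 : ({e' | e' ∈ insert k F ∧ o (bar e) = o e' ∧ EvenAt o ((insert k F).erase e')} :
      Finset D) = {e' ∈ insert k F | o (bar e) = o e' ∧ EvenAt o ((insert k F).erase e')} := by
    ext; simp
  rw [h3, h2]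
  split_ifs
  · rfl
  · ring

theorem orderSign_eq_neg_one_pow {a b : D} (h : a ≠ b) :
    orderSign R a b = (-1) ^ (if b < a then 1 else 0) := by
  unfold orderSign
  rcases lt_or_gt_of_ne h with h | h
  · simp [h, h.not_gt]
  · simp [h, h.not_gt]

theorem below_insert {F : Finset D} {k : D} (hk : k ∉ F) (e : D) :
    below (insert k F) e = below F e + if k < e then 1 else 0 := by
  unfold below
  rw [filter_insert]
  split_ifs
  · rw [card_insert_of_notMem (by simp [hk])]
  · rfl

/-- Adding the edge `{e, bar e}` to `F` matches the terms of `T·O` with subgraphs through `e`. For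
`e ≠ k` these are exactly the terms of the observable. For `e = k` they occur with the opposite sign
and cancel the part of Z whose subgraphs use `e`, while the part avoiding `e` is the diagonal entry.
-/
theorem chordObservable_eq (ho : Monotone o) (hb : Involutive bar) (hf : ∀ h, bar h ≠ h)
    (x : D → R) (hx : ∀ h, x (bar h) = x h) (e k : D) :
    chordObservable o bar x e k = (if e = k then chordGenFun o bar x else 0) +
      ∑ e', chordTransition o bar x e e' * chordObservable o bar x e' k := by
  rw [sum_chordTransition_mul ho]
  by_cases hek : e = k
  · subst hek
    have hsplit : chordGenFun o bar x = chordObservable o bar x e e +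
        ∑ F : Finset D with (BarClosed bar F ∧ EvenAt o F) ∧ ¬ e ∉ F,
          (-1) ^ chordCrossings bar F * edgeWeight bar x F := by
      rw [chordObservable_diag, chordGenFun, ← filter_filter _ (fun F => e ∉ F),
        ← filter_filter _ (fun F => ¬ e ∉ F),
        sum_filter_add_sum_filter_not]
    rw [if_pos rfl, hsplit, add_assoc, left_eq_add, add_comm, add_eq_zero_iff_eq_neg,
      ← sum_neg_distrib]
    refine sum_bij' (fun F _ => insert e (insert (bar e) F))
      (fun F _ => (F.erase e).erase (bar e)) ?_ ?_ ?_ ?_ ?_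
    · intro F hF
      obtain ⟨-, ⟨h1, h2⟩, h3, h4⟩ := mem_filter.1 hF
      rw [insert_comm] at h4
      simp [h1.insert_insert hb e, h4]
    · intro F hF
      obtain ⟨-, ⟨h1, h2⟩, h3⟩ := mem_filter.1 hF
      rw [not_not] at h3
      have h4 : insert (bar e) (insert e ((F.erase e).erase (bar e))) = F := by
        rw [insert_comm, insert_erase (by simp [hf e, h1 e h3]), insert_erase h3]
      simp only [mem_filter, mem_univ, true_and]
      refine ⟨⟨h1.erase_erase hb e, by simp⟩, by simp [hf e], ?_⟩
      rwa [h4]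
    · intro F hF
      obtain ⟨-, ⟨h1, h2⟩, h3, h4⟩ := mem_filter.1 hF
      have h5 : bar e ∉ F := fun h => h3 (mem_insert_of_mem h)
      rw [erase_insert (by simp [h2, (hf e).symm]), erase_insert h5]
    · intro F hF
      obtain ⟨-, ⟨h1, h2⟩, h3⟩ := mem_filter.1 hF
      rw [not_not] at h3
      rw [insert_erase (by simp [hf e, h1 e h3]), insert_erase h3]
    · intro F hF
      obtain ⟨-, ⟨h1, h2⟩, h3, h4⟩ := mem_filter.1 hF
      have h5 : bar e ∉ F := fun h => h3 (mem_insert_of_mem h)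
      rw [edgeWeight_insert x hx hb hf h2 h5, below_insert h2, orderSign_eq_neg_one_pow (hf e).symm,
        neg_one_pow_eq_of_even_add (even_chordCrossings_insert hb hf h1 h2 h5)]
      rcases lt_or_gt_of_ne (hf e) with h | h
      · simp only [h, h.not_gt, if_true, if_false, pow_add]; ring
      · simp only [h, h.not_gt, if_true, if_false, pow_add]; ring
  · rw [if_neg hek, zero_add]
    symm
    refine sum_bij' (fun F _ => insert e (insert (bar e) F))
      (fun F _ => (F.erase e).erase (bar e)) ?_ ?_ ?_ ?_ ?_
    · intro F hF
      obtain ⟨-, ⟨h1, h2⟩, h3, h4⟩ := mem_filter.1 hF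
      have h5 : bar e ∉ F := fun h => h3 (mem_insert_of_mem h)
      have h6 : bar e ≠ k := fun h => h3 (h ▸ mem_insert_self _ _)
      have h7 : e ∉ F := fun h => h5 (h1 e h)
      simp only [mem_filter, mem_univ, true_and]
      refine ⟨⟨h1.insert_insert hb e, by simp [Ne.symm hek, h6.symm, h2]⟩, by simp, ?_⟩
      rwa [insert_comm, erase_insert (by simp [h7, hek, (hf e).symm]), insert_comm]
    · intro F hF
      obtain ⟨-, ⟨h1, h2⟩, h3, h4⟩ := mem_filter.1 hF
      have h5 : e ∈ F := (mem_insert.1 h3).resolve_left hek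
      have h6 : bar e ≠ k := by rintro rfl; exact h2 (h1 e h5)
      simp only [mem_filter, mem_univ, true_and]
      refine ⟨⟨h1.erase_erase hb e, by simp [h2]⟩, by simp [h6], ?_⟩
      rw [insert_comm, insert_erase (by simp [hf e, h1 e h5])]
      rwa [erase_insert_of_ne (Ne.symm hek)] at h4
    · intro F hF
      obtain ⟨-, ⟨h1, h2⟩, h3, h4⟩ := mem_filter.1 hF
      have h5 : bar e ∉ F := fun h => h3 (mem_insert_of_mem h)
      have h7 : e ∉ F := fun h => h5 (h1 e h)
      rw [erase_insert (by simp [h7, (hf e).symm]), erase_insert h5]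
    · intro F hF
      obtain ⟨-, ⟨h1, h2⟩, h3, h4⟩ := mem_filter.1 hF
      have h5 : e ∈ F := (mem_insert.1 h3).resolve_left hek
      rw [insert_erase (by simp [hf e, h1 e h5]), insert_erase h5]
    · intro F hF
      obtain ⟨-, ⟨h1, h2⟩, h3, h4⟩ := mem_filter.1 hF
      have h5 : bar e ∉ F := fun h => h3 (mem_insert_of_mem h)
      have h6 : bar e ≠ k := fun h => h3 (h ▸ mem_insert_self _ _)
      have h7 : e ∉ F := fun h => h5 (h1 e h)
      have h8 : e ∉ insert (bar e) F := by simp [h7, (hf e).symm]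
      have h9 : k ∉ insert e (insert (bar e) F) := by simp [Ne.symm hek, h6.symm, h2]
      rw [edgeWeight_insert x hx hb hf h7 h5, orderSign_eq_neg_one_pow (hf e).symm]
      -- After expanding the ranks, each comparison of `k` with `e` and with `bar e` occurs in both
      -- directions, contributing exactly one each (`h11`, `h12`); the rest is
      -- `even_chordCrossings_insert`.
      have key : Even ((if bar e < e then 1 else 0) + (chordCrossings bar F + below F k) +
          below (insert k F) (bar e) + (chordCrossings bar (insert e (insert (bar e) F)) +
          below (insert e (insert (bar e) F)) k +
          below (insert k (insert e (insert (bar e) F))) e)) := by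
        have h10 := even_chordCrossings_insert hb hf h1 h7 h5
        rw [below_insert h2, below_insert h8, below_insert h5, below_insert h9, below_insert h8,
          below_insert h5, if_neg (lt_irrefl e)]
        have h11 : (if k < e then 1 else 0) + (if e < k then 1 else 0) = 1 := by
          rcases lt_or_gt_of_ne hek with h | h <;> simp [h, h.not_gt]
        have h12 : (if k < bar e then 1 else 0) + (if bar e < k then 1 else 0) = 1 := by
          rcases lt_or_gt_of_ne h6 with h | h <;> simp [h, h.not_gt]
        generalize (if k < e then 1 else 0) = a1 at *
        generalize (if e < k then 1 else 0) = a2 at *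
        generalize (if k < bar e then 1 else 0) = a3 at *
        generalize (if bar e < k then 1 else 0) = a4 at *
        generalize (if bar e < e then 1 else 0) = a5 at *
        rw [Nat.even_iff] at h10 ⊢
        omega
      rw [← neg_one_pow_eq_of_even_add key]
      ring

end HalfEdges

/-! ### Grading by the number of edges, and the Newton identities. -/

section Degrees

open scoped Classical

open Finset Function

variable {D W R : Type*} [LinearOrder D] [LinearOrder W] [CommRing R] [Fintype D]
  {o : D → W} {bar : D → D}

/-- The number of edges in a union of edges. -/
def edgeCount (bar : D → D) (F : Finset D) : ℕ := #{h ∈ F | h < bar h}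

/-- The part of `chordGenFun` of degree `m`. -/
def chordGenFunDeg (o : D → W) (bar : D → D) (x : D → R) (m : ℕ) : R :=
  ∑ F : Finset D with (BarClosed bar F ∧ EvenAt o F) ∧ edgeCount bar F = m,
    (-1) ^ chordCrossings bar F * edgeWeight bar x F

theorem card_eq_two_mul_edgeCount (hb : Involutive bar) (hf : ∀ h, bar h ≠ h) {F : Finset D}
    (hF : BarClosed bar F) : #F = 2 * edgeCount bar F := by
  have h1 : #{h ∈ F | ¬ h < bar h} = #{h ∈ F | h < bar h} := by
    refine card_bij' (fun h _ => bar h) (fun h _ => bar h) ?_ ?_ (fun h _ => hb h)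
      (fun h _ => hb h)
    · intro h hh
      obtain ⟨hh, h1⟩ := mem_filter.1 hh
      simp [hF h hh, hb h, lt_of_le_of_ne (not_lt.1 h1) (hf h)]
    · intro h hh
      obtain ⟨hh, h1⟩ := mem_filter.1 hh
      simp [hF h hh, hb h, h1.le]
  rw [← card_filter_add_card_filter_not (s := F) (fun h => h < bar h), h1, edgeCount, two_mul]

open Polynomial in
theorem edgeWeight_X_mul_C (x : D → R) (F : Finset D) :
    edgeWeight bar (fun h => (X * C (x h) : R[X])) F =
      X ^ edgeCount bar F * C (edgeWeight bar x F) := by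
  simp only [edgeWeight, edgeCount, prod_mul_distrib, prod_const, map_prod]

open Polynomial in
theorem coeff_neg_one_pow_mul (a n m : ℕ) (r : R) :
    ((-1 : R[X]) ^ a * (X ^ n * C r)).coeff m = if n = m then (-1) ^ a * r else 0 := by
  have : (-1 : R[X]) ^ a * (X ^ n * C r) = C ((-1) ^ a * r) * X ^ n := by
    simp only [map_mul, map_pow, map_neg, map_one]; ring
  rw [this, coeff_C_mul_X_pow]
  simp only [eq_comm]

open Polynomial in
theorem coeff_chordGenFun (x : D → R) (m : ℕ) :
    (chordGenFun o bar (fun h => (X * C (x h) : R[X]))).coeff m = chordGenFunDeg o bar x m := by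
  simp only [chordGenFun, chordGenFunDeg, finsetSum_coeff, edgeWeight_X_mul_C,
    coeff_neg_one_pow_mul]
  rw [← sum_filter, filter_filter]

-- The transition matrix is linear in the weights, so each transition raises the degree by one; this
-- turns the linear equation into a recursion in the degree.
open Polynomial in
theorem chordTransition_X_mul_C (x : D → R) (e e' : D) :
    chordTransition o bar (fun h => (X * C (x h) : R[X])) e e' =
      X * C (chordTransition o bar x e e') := by
  have h : ∀ a b : D, orderSign R[X] a b = C (orderSign R a b) := by
    intro a b; unfold orderSign; split_ifs <;> simp
  unfold chordTransition
  split_ifs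
  · rw [h, h, map_mul, map_mul]; ring
  · simp

open Polynomial in
/-- The part of `chordObservable` of degree `m`. -/
def chordObservableDeg (o : D → W) (bar : D → D) (x : D → R) (m : ℕ) : Matrix D D R :=
  fun e k => (chordObservable o bar (fun h => (X * C (x h) : R[X])) e k).coeff m

theorem chordObservableDeg_zero (ho : Monotone o) (hb : Involutive bar) (hf : ∀ h, bar h ≠ h)
    (x : D → R) (hx : ∀ h, x (bar h) = x h) :
    chordObservableDeg o bar x 0 = chordGenFunDeg o bar x 0 • 1 := by
  ext e k
  rw [chordObservableDeg, chordObservable_eq ho hb hf _ (by simp [hx])]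
  simp only [chordTransition_X_mul_C, Polynomial.coeff_add, Polynomial.finsetSum_coeff, mul_assoc,
    Polynomial.coeff_X_mul_zero, sum_const_zero, add_zero, Matrix.smul_apply, Matrix.one_apply]
  split_ifs
  · rw [coeff_chordGenFun, smul_eq_mul, mul_one]
  · simp

theorem chordObservableDeg_succ (ho : Monotone o) (hb : Involutive bar) (hf : ∀ h, bar h ≠ h)
    (x : D → R) (hx : ∀ h, x (bar h) = x h) (m : ℕ) :
    chordObservableDeg o bar x (m + 1) = chordGenFunDeg o bar x (m + 1) • 1 +
      chordTransition o bar x * chordObservableDeg o bar x m := by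
  ext e k
  rw [chordObservableDeg, chordObservable_eq ho hb hf _ (by simp [hx])]
  simp only [chordTransition_X_mul_C, Polynomial.coeff_add, Polynomial.finsetSum_coeff, mul_assoc,
    Polynomial.coeff_X_mul, Matrix.add_apply, Matrix.smul_apply, Matrix.one_apply, Matrix.mul_apply,
    chordObservableDeg, Polynomial.coeff_C_mul]
  congr 1
  split_ifs
  · rw [coeff_chordGenFun, smul_eq_mul, mul_one]
  · simp

/-- This is O = Z (1 - T)⁻¹ as a geometric series, read off in degree `m`. -/
theorem chordObservableDeg_eq_sum (ho : Monotone o) (hb : Involutive bar) (hf : ∀ h, bar h ≠ h)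
    (x : D → R) (hx : ∀ h, x (bar h) = x h) (m : ℕ) :
    chordObservableDeg o bar x m = ∑ i ∈ range (m + 1),
      chordGenFunDeg o bar x (m - i) • chordTransition o bar x ^ i := by
  induction m with
  | zero => simp [chordObservableDeg_zero ho hb hf x hx]
  | succ m ih =>
    rw [chordObservableDeg_succ ho hb hf x hx, ih, sum_range_succ' _ (m + 1), add_comm, mul_sum]
    simp [pow_succ']

/-- The diagonal entry at `k` sums over the even subgraphs avoiding `k`, and a subgraph with `m`
edges is avoided by all but `2 * m` half-edges. -/
theorem trace_chordObservableDeg (hb : Involutive bar) (hf : ∀ h, bar h ≠ h)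
    (x : D → R) (m : ℕ) :
    (chordObservableDeg o bar x m).trace = (Fintype.card D - 2 * m) * chordGenFunDeg o bar x m := by
  have h1 : ∀ e, chordObservableDeg o bar x m e e =
      ∑ F : Finset D with (BarClosed bar F ∧ EvenAt o F) ∧ edgeCount bar F = m,
        if e ∉ F then (-1) ^ chordCrossings bar F * edgeWeight bar x F else 0 := by
    intro e
    rw [chordObservableDeg, chordObservable_diag]
    simp only [Polynomial.finsetSum_coeff, edgeWeight_X_mul_C, coeff_neg_one_pow_mul]
    rw [← sum_filter, filter_filter, ← sum_filter, filter_filter]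
    refine sum_congr (filter_congr fun F _ => ?_) fun _ _ => rfl
    tauto
  simp only [Matrix.trace, Matrix.diag_apply, h1]
  rw [sum_comm, chordGenFunDeg, mul_sum]
  refine sum_congr rfl fun F hF => ?_
  obtain ⟨-, ⟨h2, -⟩, h3⟩ := mem_filter.1 hF
  have h4 : #{e | e ∉ F} + #F = Fintype.card D := by
    rw [← card_compl_add_card F]
    congr 2
    ext; simp
  rw [card_eq_two_mul_edgeCount hb hf h2, h3] at h4
  rw [← sum_filter, sum_const, nsmul_eq_mul, ← h4]
  push_cast
  ring

/-- Newton-type identity between the generating function and the traces of the powers of the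
transition matrix. -/
theorem chordGenFunDeg_newton (ho : Monotone o) (hb : Involutive bar) (hf : ∀ h, bar h ≠ h)
    (x : D → R) (hx : ∀ h, x (bar h) = x h) (m : ℕ) :
    -(2 * m) * chordGenFunDeg o bar x m = ∑ i ∈ range m,
      chordGenFunDeg o bar x (m - (i + 1)) * (chordTransition o bar x ^ (i + 1)).trace := by
  have h := trace_chordObservableDeg (o := o) hb hf x m
  rw [chordObservableDeg_eq_sum ho hb hf x hx, Matrix.trace_sum, sum_range_succ'] at h
  simp only [Matrix.trace_smul, smul_eq_mul, pow_zero, Matrix.trace_one, Nat.sub_zero] at h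
  -- The zeroth power has trace `Fintype.card D`, which cancels against the same term on the other
  -- side.
  linear_combination -h

end Degrees

/-! ### Orientation criteria for the intersection of segments, and angles from the vertical. -/

section PlaneGeometry

open Complex

/-- Twice the signed area of the triangle `abc`: positive if `c` lies to the left of the
directed line `ab`. -/
def signedArea (a b c : ℂ) : ℝ := (b - a).re * (c - a).im - (b - a).im * (c - a).re

theorem mem_segment_iff_of_re_lt {a b z : ℂ} (h : a.re < b.re) :
    z ∈ segment ℝ a b ↔ (a.re ≤ z.re ∧ z.re ≤ b.re) ∧ signedArea a b z = 0 := by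
  rw [segment_eq_image']
  have hpos : 0 < b.re - a.re := sub_pos.2 h
  constructor
  · rintro ⟨t, ⟨h0, h1⟩, rfl⟩
    refine ⟨⟨?_, ?_⟩, ?_⟩
    · simp; nlinarith
    · simp; nlinarith
    · simp [signedArea]; ring
  · rintro ⟨⟨h0, h1⟩, h2⟩
    refine ⟨(z.re - a.re) / (b.re - a.re), ⟨div_nonneg (sub_nonneg.2 h0) hpos.le, ?_⟩, ?_⟩
    · rw [div_le_one hpos]; linarith
    · simp only [signedArea, sub_re, sub_im] at h2
      have ht : (z.re - a.re) / (b.re - a.re) * (b.re - a.re) = z.re - a.re :=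
        div_mul_cancel₀ _ hpos.ne'
      generalize (z.re - a.re) / (b.re - a.re) = t at ht
      apply Complex.ext
      · simp only [add_re, smul_re, sub_re, smul_eq_mul]; linarith
      · simp only [add_im, smul_im, sub_im, smul_eq_mul]
        apply mul_right_cancel₀ hpos.ne'
        linear_combination (b.im - a.im) * ht - h2

/-- Two vectors from `v` on the same ray: the shorter segment is contained in the longer one. -/
theorem mem_segment_or_mem_segment {v b d : ℂ} {r : ℝ} (hr : 0 < r) (h : d - v = r • (b - v)) :
    d ∈ segment ℝ v b ∨ b ∈ segment ℝ v d := by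
  rw [segment_eq_image', segment_eq_image']
  rcases le_total r 1 with h1 | h1
  · left
    exact ⟨r, ⟨hr.le, h1⟩, by simp [← h]⟩
  · right
    refine ⟨r⁻¹, ⟨by positivity, inv_le_one_of_one_le₀ h1⟩, ?_⟩
    simp only
    rw [h, smul_smul, inv_mul_cancel₀ hr.ne', one_smul, add_sub_cancel]

/-- The whole of `cd` lies in the vertical strip over `ab`, so the segments meet exactly when the
affine function `signedArea a b` changes sign along `cd`. -/
theorem exists_mem_segment_iff_of_nested {a b c d : ℂ} (hac : a.re < c.re) (hcd : c.re < d.re)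
    (hdb : d.re < b.re) (hc : signedArea a b c ≠ 0) (hd : signedArea a b d ≠ 0) :
    (∃ z, z ∈ segment ℝ a b ∩ segment ℝ c d) ↔ ¬ (0 < signedArea a b c ↔ 0 < signedArea a b d) := by
  have hlin : ∀ t : ℝ, signedArea a b (c + t • (d - c)) =
      (1 - t) * signedArea a b c + t * signedArea a b d := by
    intro t; simp [signedArea]; ring
  constructor
  · rintro ⟨z, hz, hz'⟩ hiff
    rw [mem_segment_iff_of_re_lt (hac.trans (hcd.trans hdb))] at hz
    rw [segment_eq_image'] at hz'
    obtain ⟨t, ⟨h0, h1⟩, rfl⟩ := hz'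
    have h2 := hz.2
    simp only at h2
    rw [hlin] at h2
    rcases lt_or_gt_of_ne hc with h | h
    · have h' : signedArea a b d < 0 := by
        rcases lt_or_gt_of_ne hd with h' | h'
        · exact h'
        · exact absurd (hiff.2 h') h.not_gt
      rcases h0.eq_or_lt with rfl | h0
      · linarith
      · nlinarith
    · have h' := hiff.1 h
      rcases h0.eq_or_lt with rfl | h0
      · linarith
      · nlinarith
  · intro hiff
    have hne : signedArea a b c - signedArea a b d ≠ 0 := by
      intro h
      rw [sub_eq_zero.1 h] at hiff
      exact hiff Iff.rfl
    have hopp : signedArea a b c * signedArea a b d < 0 := by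
      rcases lt_or_gt_of_ne hc with h | h <;> rcases lt_or_gt_of_ne hd with h' | h'
      · exact absurd (iff_of_false h.not_gt h'.not_gt) hiff
      · exact mul_neg_of_neg_of_pos h h'
      · exact mul_neg_of_pos_of_neg h h'
      · exact absurd (iff_of_true h h') hiff
    -- The zero of the affine function in `hlin`.
    set t := signedArea a b c / (signedArea a b c - signedArea a b d) with ht
    have ht0 : 0 ≤ t ∧ t ≤ 1 := by
      rw [ht]
      rcases lt_or_gt_of_ne hne with h | h
      · constructor
        · apply div_nonneg_of_nonpos _ h.le; nlinarith
        · rw [div_le_one_of_neg h]; nlinarith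
      · constructor
        · apply div_nonneg _ h.le; nlinarith
        · rw [div_le_one h]; nlinarith
    refine ⟨c + t • (d - c), ?_, ?_⟩
    · rw [mem_segment_iff_of_re_lt (hac.trans (hcd.trans hdb)), hlin]
      refine ⟨⟨?_, ?_⟩, ?_⟩
      · simp; nlinarith
      · simp; nlinarith
      · rw [ht]; field_simp; ring
    · rw [segment_eq_image']
      exact ⟨t, ht0, rfl⟩

/-- The common strip runs from `c` to `b`. The two heights are compared at its ends, once as `c`
against `ab` and once as `b` against `cd`. The roles of the segments are exchanged, so a change of
order means equal signs. -/
theorem exists_mem_segment_iff_of_interlaced {a b c d : ℂ} (hac : a.re < c.re) (hcb : c.re < b.re)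
    (hbd : b.re < d.re) (hc : signedArea a b c ≠ 0) (hb : signedArea c d b ≠ 0) :
    (∃ z, z ∈ segment ℝ a b ∩ segment ℝ c d) ↔ (0 < signedArea a b c ↔ 0 < signedArea c d b) := by
  have hab := hac.trans hcb
  have hcd := hcb.trans hbd
  set K := (b.re - a.re) * (d.im - c.im) - (b.im - a.im) * (d.re - c.re) with hK
  constructor
  · rintro ⟨z, hz, hz'⟩
    rw [mem_segment_iff_of_re_lt hab] at hz
    rw [mem_segment_iff_of_re_lt hcd] at hz'
    have h1 : signedArea a b c * (d.re - c.re) = -((z.re - c.re) * K) := by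
      have e1 := hz.2
      have e2 := hz'.2
      simp only [signedArea, sub_re, sub_im] at e1 e2 ⊢
      linear_combination (d.re - c.re) * e1 - (b.re - a.re) * e2
    have h2 : signedArea c d b * (b.re - a.re) = -((b.re - z.re) * K) := by
      have e1 := hz.2
      have e2 := hz'.2
      simp only [signedArea, sub_re, sub_im] at e1 e2 ⊢
      linear_combination (b.re - a.re) * e2 - (d.re - c.re) * e1
    have h3 : 0 ≤ z.re - c.re := sub_nonneg.2 hz'.1.1
    have h4 : 0 ≤ b.re - z.re := sub_nonneg.2 hz.1.2
    have h5 : 0 < b.re - a.re := sub_pos.2 hab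
    have h6 : 0 < d.re - c.re := sub_pos.2 hcd
    rcases le_total K 0 with h | h
    · refine iff_of_true (lt_of_le_of_ne ?_ hc.symm) (lt_of_le_of_ne ?_ hb.symm)
      · exact nonneg_of_mul_nonneg_left (by rw [h1]; nlinarith) h6
      · exact nonneg_of_mul_nonneg_left (by rw [h2]; nlinarith) h5
    · refine iff_of_false (not_lt.2 ?_) (not_lt.2 ?_)
      · exact nonpos_of_mul_nonpos_left (by rw [h1]; nlinarith) h6
      · exact nonpos_of_mul_nonpos_left (by rw [h2]; nlinarith) h5
  · intro hiff
    have h5 : 0 < b.re - a.re := sub_pos.2 hab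
    have h6 : 0 < d.re - c.re := sub_pos.2 hcd
    have h7 : 0 < b.re - c.re := sub_pos.2 hcb
    have hid : signedArea a b c * (d.re - c.re) + signedArea c d b * (b.re - a.re) =
        -((b.re - c.re) * K) := by
      simp only [signedArea, sub_re, sub_im, hK]; ring
    have hK0 : K ≠ 0 := by
      intro h
      rw [h] at hid
      rcases lt_or_gt_of_ne hc with h' | h'
      · have h'' : signedArea c d b < 0 :=
          lt_of_le_of_ne (not_lt.1 fun h'' => h'.not_gt (hiff.2 h'')) hb
        nlinarith
      · have h'' := hiff.1 h'
        nlinarith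
    have hs : 0 < -signedArea a b c / K ∧ 0 < -signedArea c d b / K := by
      rcases lt_or_gt_of_ne hc with h' | h'
      · have h'' : signedArea c d b < 0 :=
          lt_of_le_of_ne (not_lt.1 fun h'' => h'.not_gt (hiff.2 h'')) hb
        have : 0 < K := by
          by_contra hneg
          have : K ≤ 0 := not_lt.1 hneg
          nlinarith
        exact ⟨div_pos (by linarith) this, div_pos (by linarith) this⟩
      · have h'' := hiff.1 h'
        have : K < 0 := by
          by_contra hneg
          have : 0 ≤ K := not_lt.1 hneg
          nlinarith
        exact ⟨div_pos_of_neg_of_neg (by linarith) this, div_pos_of_neg_of_neg (by linarith) this⟩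
    -- Intersection parameter of the two lines along `cd`, measured from `c`; `t` is the one along
    -- `ab`, measured backwards from `b`. The identity `hid` makes the two abscissas agree.
    set s := -signedArea a b c / K with hs'
    have hsK : s * K = -signedArea a b c := by rw [hs']; field_simp
    set t := -signedArea c d b / K with ht'
    have htK : t * K = -signedArea c d b := by rw [ht']; field_simp
    have hre : (c + s • (d - c)).re = c.re + s * (d.re - c.re) := by simp
    have hre' : (c + s • (d - c)).re = b.re - t * (b.re - a.re) := by
      rw [hre]
      apply mul_right_cancel₀ hK0
      linear_combination (d.re - c.re) * hsK + (b.re - a.re) * htK - hid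
    have hz1 : c.re ≤ (c + s • (d - c)).re := by rw [hre]; nlinarith [hs.1]
    have hz2 : (c + s • (d - c)).re ≤ b.re := by rw [hre']; nlinarith [hs.2]
    refine ⟨c + s • (d - c), ?_, ?_⟩
    · rw [mem_segment_iff_of_re_lt hab]
      refine ⟨⟨hac.le.trans hz1, hz2⟩, ?_⟩
      have : signedArea a b (c + s • (d - c)) = signedArea a b c + s * K := by
        simp [signedArea, hK]; ring
      rw [this, hsK, add_neg_cancel]
    · rw [mem_segment_iff_of_re_lt hcd]
      refine ⟨⟨hz1, hz2.trans hbd.le⟩, ?_⟩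
      simp [signedArea]; ring

/-- The argument of a vector measured from the positive imaginary axis. -/
def tilt (d : ℂ) : ℝ := arg (-I * d)

theorem tilt_mem_of_re_pos {d : ℂ} (h : 0 < d.re) : tilt d ∈ Set.Ioo (-Real.pi) 0 := by
  refine ⟨neg_pi_lt_arg _, ?_⟩
  rw [tilt, arg_neg_iff]
  simpa using h

theorem tilt_mem_of_re_neg {d : ℂ} (h : d.re < 0) : tilt d ∈ Set.Ioo 0 Real.pi := by
  have him : 0 < (-I * d).im := by simpa using h
  refine ⟨lt_of_le_of_ne (arg_nonneg_iff.2 him.le) ?_, lt_of_le_of_ne (arg_le_pi _) ?_⟩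
  · intro h0
    exact him.ne' (arg_eq_zero_iff.1 h0.symm).2
  · intro h0
    exact him.ne' (arg_eq_pi_iff.1 h0).2

theorem tilt_neg_of_re_pos {d : ℂ} (h : 0 < d.re) : tilt (-d) = tilt d + Real.pi := by
  rw [tilt, mul_neg, arg_neg_eq_arg_add_pi_of_im_neg (by simpa using h), tilt]

theorem tilt_neg_of_re_neg {d : ℂ} (h : d.re < 0) : tilt (-d) = tilt d - Real.pi := by
  rw [tilt, mul_neg, arg_neg_eq_arg_sub_pi_of_im_pos (by simpa using h), tilt]

theorem norm_mul_exp_tilt (d : ℂ) : (‖d‖ : ℂ) * exp (tilt d * I) = -I * d := by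
  have := norm_mul_exp_arg_mul_I (-I * d)
  rwa [norm_mul, norm_neg, norm_I, one_mul] at this

theorem norm_mul_sin_tilt_sub (d d' : ℂ) :
    ‖d‖ * ‖d'‖ * Real.sin (tilt d - tilt d') = d'.re * d.im - d'.im * d.re := by
  have h1 := norm_mul_exp_tilt d
  have h2 := norm_mul_exp_tilt d'
  rw [exp_mul_I, ← ofReal_cos, ← ofReal_sin] at h1 h2
  have e1 := congrArg re h1
  have e2 := congrArg im h1
  have e3 := congrArg re h2
  have e4 := congrArg im h2
  simp [cos_ofReal_re, sin_ofReal_re] at e1 e2 e3 e4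
  rw [Real.sin_sub, ← e1]
  have e5 : d.re = -(‖d‖ * Real.sin (tilt d)) := by linarith
  have e6 : d'.re = -(‖d'‖ * Real.sin (tilt d')) := by linarith
  rw [e5, e6, ← e3]
  ring

/-- For vectors in the same open half plane, tilts compare like slopes. -/
theorem tilt_lt_tilt_iff {d d' : ℂ} (h : 0 < d.re * d'.re) :
    tilt d' < tilt d ↔ 0 < d'.re * d.im - d'.im * d.re := by
  have hd : d ≠ 0 := by rintro rfl; simp at h
  have hd' : d' ≠ 0 := by rintro rfl; simp at h
  have hn : 0 < ‖d‖ * ‖d'‖ := mul_pos (norm_pos_iff.2 hd) (norm_pos_iff.2 hd')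
  rw [← norm_mul_sin_tilt_sub, mul_pos_iff_of_pos_left hn]
  have hb : tilt d - tilt d' < Real.pi ∧ -Real.pi < tilt d - tilt d' := by
    rcases pos_and_pos_or_neg_and_neg_of_mul_pos h with ⟨h1, h2⟩ | ⟨h1, h2⟩
    · have := tilt_mem_of_re_pos h1
      have := tilt_mem_of_re_pos h2
      simp only [Set.mem_Ioo] at *
      constructor <;> linarith
    · have := tilt_mem_of_re_neg h1
      have := tilt_mem_of_re_neg h2
      simp only [Set.mem_Ioo] at *
      constructor <;> linarith
  constructor
  · intro h'
    exact Real.sin_pos_of_pos_of_lt_pi (sub_pos.2 h') hb.1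
  · intro h'
    by_contra hle
    have := Real.sin_nonpos_of_nonpos_of_neg_pi_le (sub_nonpos.2 (not_lt.1 hle)) hb.2.le
    exact absurd h' this.not_gt

end PlaneGeometry

/-! ### The linear order on darts, and half-angle phases as order signs. -/

section DartOrder

open scoped Classical

open Finset Function Complex

variable {V : Type*} {G : SimpleGraph V} {p : V → ℂ}

/-- The vector represented by a dart. -/
def dartVec (p : V → ℂ) (h : G.Dart) : ℂ := p h.snd - p h.fst

/-- Darts are ordered by the real part of their origin, and clockwise around it. -/
def dartKey (p : V → ℂ) (h : G.Dart) : ℝ ×ₗ ℝ := toLex ((p h.fst).re, -tilt (dartVec p h))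

theorem dartVec_symm (h : G.Dart) : dartVec p h.symm = -dartVec p h := by
  simp [dartVec]

theorem IsStraightDrawing.dartVec_ne_zero (hp : IsStraightDrawing G p) (h : G.Dart) :
    dartVec p h ≠ 0 :=
  sub_ne_zero.2 fun h' => h.adj.ne (hp.injective h').symm

/-- Of two edges leaving `v` along one ray, one would contain the far endpoint of the other. -/
theorem IsStraightDrawing.eq_of_sameRay (hp : IsStraightDrawing G p) {v b d : V} (hb : G.Adj v b)
    (hd : G.Adj v d) {r : ℝ} (hr : 0 < r) (h : p d - p v = r • (p b - p v)) : b = d := by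
  rcases mem_segment_or_mem_segment hr h with h' | h'
  · rcases hp.eq_or_eq_of_mem_segment v b d hb h' with h'' | h''
    · exact absurd h'' hd.ne'
    · exact h''.symm
  · rcases hp.eq_or_eq_of_mem_segment v d b hd h' with h'' | h''
    · exact absurd h'' hb.ne'
    · exact h''

theorem IsStraightDrawing.dartKey_injective (hp : IsStraightDrawing G p)
    (hre : Injective fun v => (p v).re) : Injective (dartKey p : G.Dart → ℝ ×ₗ ℝ) := by
  intro h h' heq
  have heq' := toLex.injective heq
  rw [Prod.mk.injEq, neg_inj] at heq'
  have h1 : h.fst = h'.fst := hre heq'.1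
  have h2 := heq'.2
  have hd := hp.dartVec_ne_zero h
  have hd' := hp.dartVec_ne_zero h'
  unfold tilt at h2
  rw [arg_eq_arg_iff (by simpa using hd) (by simpa using hd')] at h2
  have h3 : dartVec p h' = ((‖dartVec p h'‖ / ‖dartVec p h‖ : ℝ)) • dartVec p h := by
    simp only [norm_mul, norm_neg, norm_I, one_mul] at h2
    have hI : -I ≠ 0 := by simp
    apply mul_left_cancel₀ hI
    rw [← h2, real_smul]; push_cast; ring
  have h4 : h.snd = h'.snd := by
    refine hp.eq_of_sameRay (v := h.fst) h.adj (h1 ▸ h'.adj) (r := ‖dartVec p h'‖ / ‖dartVec p h‖)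
      (div_pos (norm_pos_iff.2 hd') (norm_pos_iff.2 hd)) ?_
    rw [dartVec, dartVec, ← h1] at h3 ⊢
    exact h3
  exact SimpleGraph.Dart.ext _ _ (Prod.ext h1 h4)

/-- The linear order on darts induced by `dartKey`. -/
abbrev dartLinearOrder (hp : IsStraightDrawing G p) (hre : Injective fun v => (p v).re) :
    LinearOrder G.Dart :=
  LinearOrder.lift' (dartKey p) (hp.dartKey_injective hre)

theorem dart_lt_iff (hp : IsStraightDrawing G p) (hre : Injective fun v => (p v).re)
    (h h' : G.Dart) : (dartLinearOrder hp hre).lt h h' ↔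
    (p h.fst).re < (p h'.fst).re ∨
      (h.fst = h'.fst ∧ tilt (dartVec p h') < tilt (dartVec p h)) := by
  change dartKey p h < dartKey p h' ↔ _
  rw [dartKey, dartKey, Prod.Lex.toLex_lt_toLex]
  simp only [neg_lt_neg_iff]
  exact or_congr Iff.rfl (and_congr_left fun _ => ⟨fun h => hre h, fun h => by rw [h]⟩)

theorem dart_lt_symm_iff (hp : IsStraightDrawing G p) (hre : Injective fun v => (p v).re)
    (h : G.Dart) :
    (dartLinearOrder hp hre).lt h h.symm ↔ 0 < (dartVec p h).re := by
  rw [dart_lt_iff]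
  constructor
  · rintro (h' | h')
    · simpa [dartVec] using h'
    · exact absurd h'.1 h.adj.ne
  · intro h'
    left
    simpa [dartVec] using h'

theorem dartVec_re_ne_zero (hre : Injective fun v => (p v).re) (h : G.Dart) : (dartVec p h).re ≠ 0 := by
  intro h'
  rw [dartVec, sub_re, sub_eq_zero] at h'
  exact h.adj.ne (hre h'.symm)

theorem dart_fst_monotone (hp : IsStraightDrawing G p) (hre : Injective fun v => (p v).re) :
    letI := dartLinearOrder hp hre
    Monotone fun h : G.Dart => (p h.fst).re := by
  letI := dartLinearOrder hp hre
  intro h h' hle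
  rcases hle.lt_or_eq with hlt | rfl
  · rcases (dart_lt_iff hp hre h h').1 hlt with h1 | h1
    · exact h1.le
    · simp [h1.1]
  · exact le_rfl

/-- A turning angle is a difference of tilts up to a multiple `k` of 2π. By `exp_half_sub` the
halved phase sees only the parity of `k`. -/
theorem arg_div_eq {d d' : ℂ} (hd : d ≠ 0) (hd' : d' ≠ 0) (k : ℤ)
    (hk : tilt d' - tilt d - k * (2 * Real.pi) ∈ Set.Ioc (-Real.pi) Real.pi) :
    arg (d' / d) = tilt d' - tilt d - k * (2 * Real.pi) := by
  have h1 : d' / d = ((‖d'‖ / ‖d‖ : ℝ) : ℂ) *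
      (cos ((tilt d' - tilt d - k * (2 * Real.pi) : ℝ) : ℂ) +
        sin ((tilt d' - tilt d - k * (2 * Real.pi) : ℝ) : ℂ) * I) := by
    rw [← exp_mul_I]
    have h2 : exp (((tilt d' - tilt d - k * (2 * Real.pi) : ℝ) : ℂ) * I) =
        exp (tilt d' * I) / exp (tilt d * I) := by
      rw [← exp_sub, exp_eq_exp_iff_exists_int]
      refine ⟨-k, ?_⟩
      push_cast; ring
    have hn : (‖d‖ : ℂ) ≠ 0 := by simpa using hd
    have h3 := norm_mul_exp_tilt d
    have h4 := norm_mul_exp_tilt d'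
    rw [h2]
    push_cast
    rw [div_mul_div_comm, h3, h4, mul_div_mul_left _ _ (by simp)]
  rw [h1, arg_mul_cos_add_sin_mul_I (div_pos (norm_pos_iff.2 hd') (norm_pos_iff.2 hd)) hk]

theorem exp_half_sub (a b : ℝ) (k : ℤ) :
    exp (I / 2 * ((a - b - k * (2 * Real.pi) : ℝ) : ℂ)) =
      (-1) ^ k * (exp (I / 2 * a) / exp (I / 2 * b)) := by
  rw [← exp_sub, ← exp_pi_mul_I, ← exp_int_mul, ← exp_add, exp_eq_exp_iff_exists_int]
  refine ⟨-k, ?_⟩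
  push_cast; ring

/-- The half-turn phases agree with order signs up to a change of gauge. -/
theorem exp_half_turningAngle (hp : IsStraightDrawing G p) (hre : Injective fun v => (p v).re)
    (e e' : G.Dart) (h1 : e.snd = e'.fst) (h2 : e'.snd ≠ e.fst) :
    letI := dartLinearOrder hp hre
    exp (I / 2 * turningAngle p e.fst e.snd e'.snd) =
      orderSign ℂ e e.symm * orderSign ℂ e.symm e' *
        (exp (I / 2 * tilt (dartVec p e')) / exp (I / 2 * tilt (dartVec p e))) := by
  letI := dartLinearOrder hp hre
  have hturn : turningAngle p e.fst e.snd e'.snd = arg (dartVec p e' / dartVec p e) := by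
    rw [turningAngle, dartVec, dartVec, ← h1]
  have hd := hp.dartVec_ne_zero e
  have hd' := hp.dartVec_ne_zero e'
  have hne : e.symm ≠ e' := by
    rintro rfl; exact h2 rfl
  have hneT : tilt (dartVec p e.symm) ≠ tilt (dartVec p e') := by
    intro h
    refine hne (hp.dartKey_injective hre ?_)
    rw [dartKey, dartKey, h]
    simp [h1]
  have hlt : e.symm < e' ↔ tilt (dartVec p e') < tilt (dartVec p e.symm) := by
    refine (dart_lt_iff hp hre _ _).trans ?_
    simp [h1]
  have hgt : e' < e.symm ↔ tilt (dartVec p e.symm) < tilt (dartVec p e') := by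
    refine (dart_lt_iff hp hre _ _).trans ?_
    simp [h1]
  rw [hturn]
  have hπ := Real.pi_pos
  have hb1 : -Real.pi < tilt (dartVec p e') := neg_pi_lt_arg _
  have hb2 : tilt (dartVec p e') ≤ Real.pi := arg_le_pi _
  -- Four cases: `e` points left or right, and `e'` comes before or after `e.symm` at their common
  -- origin. The branch is `k = 0` in two of them and `±1` in the other two, where the product of
  -- the order signs is -1.
  rcases lt_or_gt_of_ne (dartVec_re_ne_zero hre e) with hneg | hpos
  · have hs : orderSign ℂ e e.symm = -1 := by
      have hns : ¬ e < e.symm := fun h => hneg.not_gt ((dart_lt_symm_iff hp hre e).1 h)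
      have hs' : e.symm < e := lt_of_le_of_ne (not_lt.1 hns) e.symm_ne
      rw [orderSign, if_neg hns, if_pos hs']
    have ht := tilt_mem_of_re_neg hneg
    have hts := tilt_neg_of_re_neg hneg
    rw [dartVec_symm, hts] at hlt hgt hneT
    rcases lt_or_gt_of_ne hneT with h | h
    · rw [hs, orderSign, if_neg (fun h' => h.not_gt (hlt.1 h')), if_pos (hgt.2 h)]
      rw [arg_div_eq hd hd' 0 (by simp only [Set.mem_Ioc, Set.mem_Ioo] at *; push_cast; constructor <;> linarith),
        exp_half_sub]
      simp
    · rw [hs, orderSign, if_pos (hlt.2 h)]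
      rw [arg_div_eq hd hd' (-1) (by simp only [Set.mem_Ioc, Set.mem_Ioo] at *; push_cast; constructor <;> linarith),
        exp_half_sub]
      simp
  · have hs : orderSign ℂ e e.symm = 1 := by
      rw [orderSign, if_pos ((dart_lt_symm_iff hp hre e).2 hpos)]
    have ht := tilt_mem_of_re_pos hpos
    have hts := tilt_neg_of_re_pos hpos
    rw [dartVec_symm, hts] at hlt hgt hneT
    rcases lt_or_gt_of_ne hneT with h | h
    · rw [hs, orderSign, if_neg (fun h' => h.not_gt (hlt.1 h')), if_pos (hgt.2 h)]
      rw [arg_div_eq hd hd' 1 (by simp only [Set.mem_Ioc, Set.mem_Ioo] at *; push_cast; constructor <;> linarith),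
        exp_half_sub]
      simp
    · rw [hs, orderSign, if_pos (hlt.2 h)]
      rw [arg_div_eq hd hd' 0 (by simp only [Set.mem_Ioc, Set.mem_Ioo] at *; push_cast; constructor <;> linarith),
        exp_half_sub]
      simp

end DartOrder

/-! ### Crossing parity for a pair of edges. -/

section Crossings

open scoped Classical

open Finset Function Complex

variable {V : Type*} {G : SimpleGraph V} {p : V → ℂ}

theorem IsStraightDrawing.not_crosses_of_common (hp : IsStraightDrawing G p) {v b d : V}
    (hb : G.Adj v b) (hd : G.Adj v d) : ¬ Crosses p s(v, b) s(v, d) := by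
  rintro ⟨hne, z, ⟨hz, hz'⟩, hzp⟩
  change z ∈ segment ℝ (p v) (p b) at hz
  change z ∈ segment ℝ (p v) (p d) at hz'
  rw [segment_eq_image'] at hz hz'
  obtain ⟨s, ⟨hs0, hs1⟩, rfl⟩ := hz
  obtain ⟨t, ⟨ht0, ht1⟩, h⟩ := hz'
  simp only [add_right_inj] at h
  have hs : s ≠ 0 := by
    rintro rfl; exact hzp ⟨v, by simp⟩
  have ht : t ≠ 0 := by
    rintro rfl
    rw [zero_smul] at h
    simp only at hzp
    rw [← h] at hzp
    exact hzp ⟨v, by simp⟩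
  refine hne ?_
  rw [hp.eq_of_sameRay hb hd (r := t⁻¹ * s) (by positivity)]
  rw [mul_smul, ← h, smul_smul, inv_mul_cancel₀ ht, one_smul]

theorem IsStraightDrawing.crosses_iff_of_disjoint (hp : IsStraightDrawing G p) {a b c d : V}
    (hab : G.Adj a b) (hcd : G.Adj c d) (hac : a ≠ c) (had : a ≠ d) (hbc : b ≠ c) (hbd : b ≠ d) :
    Crosses p s(a, b) s(c, d) ↔
      ∃ z, z ∈ segment ℝ (p a) (p b) ∩ segment ℝ (p c) (p d) := by
  constructor
  · rintro ⟨-, z, hz, -⟩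
    exact ⟨z, hz⟩
  · rintro ⟨z, hz⟩
    refine ⟨by simp [hac, had], z, hz, ?_⟩
    rintro ⟨w, rfl⟩
    rcases hp.eq_or_eq_of_mem_segment a b w hab hz.1 with rfl | rfl <;>
    rcases hp.eq_or_eq_of_mem_segment c d _ hcd hz.2 with rfl | rfl <;> contradiction

theorem IsStraightDrawing.signedArea_ne_zero (hp : IsStraightDrawing G p) {a b v : V}
    (hab : G.Adj a b) (h1 : (p a).re < (p v).re) (h2 : (p v).re < (p b).re) :
    signedArea (p a) (p b) (p v) ≠ 0 := by
  intro h
  have := (mem_segment_iff_of_re_lt (h1.trans h2)).2 ⟨⟨h1.le, h2.le⟩, h⟩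
  rcases hp.eq_or_eq_of_mem_segment a b v hab this with rfl | rfl
  · exact lt_irrefl _ h1
  · exact lt_irrefl _ h2

/-- The vertex `v` lies above the edge of `g` (with origin on the left). -/
def Above (p : V → ℂ) (g : G.Dart) (v : V) : Prop :=
  ((p g.fst).re < (p v).re ∧ (p v).re < (p g.snd).re) ∧
    0 < signedArea (p g.fst) (p g.snd) (p v)

/-- Over the common abscissa range the heights of the edges are compared at both ends of the range;
disjoint edges cross exactly when the comparison flips. If the projections are nested, both
comparisons test the same edge and the chords are not interlaced. If they overlap properly, the edge
being tested changes, and the interlacing of the chords compensates. At a shared endpoint the tilt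
order replaces a comparison. -/
theorem even_segment_pair_crossings (hp : IsStraightDrawing G p)
    (hre : Injective fun v => (p v).re) {a b c d : V} (hab : G.Adj a b) (hcd : G.Adj c d)
    (hg : (p a).re < (p b).re) (hh : (p c).re < (p d).re)
    (hgh : (p a).re < (p c).re ∨ (a = c ∧ tilt (p d - p c) < tilt (p b - p a))) :
    Even ((if ((p c).re < (p b).re ∨ (c = b ∧ tilt (-(p b - p a)) < tilt (p d - p c))) ∧
          ((p b).re < (p d).re ∨ (b = d ∧ tilt (-(p d - p c)) < tilt (-(p b - p a))))
        then 1 else 0) +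
      (if Crosses p s(a, b) s(c, d) then 1 else 0) +
      ((if ((p a).re < (p c).re ∧ (p c).re < (p b).re) ∧ 0 < signedArea (p a) (p b) (p c)
          then 1 else 0) +
        (if ((p a).re < (p d).re ∧ (p d).re < (p b).re) ∧ 0 < signedArea (p a) (p b) (p d)
          then 1 else 0)) +
      ((if ((p c).re < (p a).re ∧ (p a).re < (p d).re) ∧ 0 < signedArea (p c) (p d) (p a)
          then 1 else 0) +
        (if ((p c).re < (p b).re ∧ (p b).re < (p d).re) ∧ 0 < signedArea (p c) (p d) (p b)
          then 1 else 0))) := by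
  rcases hgh with hac | ⟨rfl, htilt⟩
  · have hac' : a ≠ c := by rintro rfl; exact lt_irrefl _ hac
    have had' : a ≠ d := by rintro rfl; exact lt_asymm hac hh
    by_cases hbd : b = d
    · subst hbd
      have hC : ¬ Crosses p s(a, b) s(c, b) := by
        rw [Sym2.eq_swap, Sym2.eq_swap (a := c)]
        exact hp.not_crosses_of_common hab.symm hcd.symm
      have ht : tilt (-(p b - p c)) < tilt (-(p b - p a)) ↔ 0 < signedArea (p a) (p b) (p c) := by
        rw [tilt_lt_tilt_iff]
        · simp only [neg_sub, signedArea, sub_re, sub_im]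
          ring_nf
        · simp only [neg_re, sub_re]; nlinarith
      simp only [hC, hh, hac, hac.not_gt, ht, lt_irrefl, true_or, true_and, false_or, and_true,
        false_and, and_false, if_false, add_zero]
      split_ifs <;> decide
    by_cases hcb : c = b
    · subst hcb
      have hC : ¬ Crosses p s(a, c) s(c, d) := by
        rw [Sym2.eq_swap]
        exact hp.not_crosses_of_common hab.symm hcd
      have ht : ¬ tilt (-(p c - p a)) < tilt (p d - p c) := by
        have h1 := (tilt_mem_of_re_neg (d := -(p c - p a)) (by simpa using hac)).1
        have h2 := (tilt_mem_of_re_pos (d := p d - p c) (by simpa using hh)).2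
        exact (h2.trans h1).not_gt
      rw [neg_sub] at ht
      simp [hC, ht, hac.not_gt, hh.not_gt]
    rw [hp.crosses_iff_of_disjoint hab hcd hac' had' (Ne.symm hcb) hbd]
    rcases lt_or_gt_of_ne (fun h => hcb (hre h) : (p c).re ≠ (p b).re) with h1 | h1
    · have hA := hp.signedArea_ne_zero hab hac h1
      rcases lt_or_gt_of_ne (fun h => hbd (hre h) : (p b).re ≠ (p d).re) with h2 | h2
      · have hB := hp.signedArea_ne_zero hcd h1 h2
        rw [exists_mem_segment_iff_of_interlaced hac h1 h2 hA hB]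
        by_cases hA' : 0 < signedArea (p a) (p b) (p c) <;>
        by_cases hB' : 0 < signedArea (p c) (p d) (p b) <;>
        simp [hA', hB', h1, h2, hac, hac.not_gt, h2.not_gt] <;> decide
      · have hB := hp.signedArea_ne_zero hab (hac.trans hh) h2
        rw [exists_mem_segment_iff_of_nested hac hh h2 hA hB]
        by_cases hA' : 0 < signedArea (p a) (p b) (p c) <;>
        by_cases hB' : 0 < signedArea (p a) (p b) (p d) <;>
        simp [hA', hB', h1, h2, hac, hac.not_gt, h2.not_gt, hbd, hac.trans hh]
    · have hC : ¬ ∃ z, z ∈ segment ℝ (p a) (p b) ∩ segment ℝ (p c) (p d) := by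
        rintro ⟨z, hz, hz'⟩
        rw [mem_segment_iff_of_re_lt hg] at hz
        rw [mem_segment_iff_of_re_lt hh] at hz'
        linarith [hz.1.2, hz'.1.1]
      rw [if_neg hC]
      simp [h1.not_gt, hcb, hac.not_gt, (h1.trans hh).not_gt]
  · have hC : ¬ Crosses p s(a, b) s(a, d) := hp.not_crosses_of_common hab hcd
    have hbd : b ≠ d := by rintro rfl; exact lt_irrefl _ htilt
    rw [tilt_lt_tilt_iff (by simp only [sub_re]; nlinarith)] at htilt
    have h1 : 0 < signedArea (p a) (p d) (p b) := htilt
    have h2 : ¬ 0 < signedArea (p a) (p b) (p d) := by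
      have : signedArea (p a) (p b) (p d) = -signedArea (p a) (p d) (p b) := by
        simp only [signedArea]; ring
      rw [this]; linarith
    simp only [hC, h1, h2, hg, hh, hbd, lt_irrefl, true_or, true_and, and_true, or_false,
        false_and, and_false, if_false, add_zero, zero_add]
    split_ifs <;> decide

/-- For a pair of edges, chord crossings and geometric crossings differ by the number of endpoints
of one lying above the other. -/
theorem even_pair_crossings (hp : IsStraightDrawing G p) (hre : Injective fun v => (p v).re)
    {g h : G.Dart} (hg : (p g.fst).re < (p g.snd).re) (hh : (p h.fst).re < (p h.snd).re)
    (hgh : (dartLinearOrder hp hre).lt g h) :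
    letI := dartLinearOrder hp hre
    Even ((if h < g.symm ∧ g.symm < h.symm then 1 else 0) +
      (if Crosses p g.edge h.edge then 1 else 0) +
      ((if Above p g h.fst then 1 else 0) + (if Above p g h.snd then 1 else 0)) +
      ((if Above p h g.fst then 1 else 0) + (if Above p h g.snd then 1 else 0))) := by
  letI := dartLinearOrder hp hre
  have e1 : h < g.symm ↔ (p h.fst).re < (p g.snd).re ∨
      (h.fst = g.snd ∧ tilt (-(p g.snd - p g.fst)) < tilt (p h.snd - p h.fst)) := by
    have := dart_lt_iff hp hre h g.symm
    rwa [dartVec_symm] at this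
  have e2 : g.symm < h.symm ↔ (p g.snd).re < (p h.snd).re ∨
      (g.snd = h.snd ∧ tilt (-(p h.snd - p h.fst)) < tilt (-(p g.snd - p g.fst))) := by
    have := dart_lt_iff hp hre g.symm h.symm
    rwa [dartVec_symm, dartVec_symm] at this
  have := even_segment_pair_crossings hp hre g.adj h.adj hg hh ((dart_lt_iff hp hre g h).1 hgh)
  simp only [← e1, ← e2] at this
  convert this <;> rfl

end Crossings

/-! ### From chord diagrams to drawn graphs: even subgraphs and the Kac–Ward matrix. -/

section EvenSubgraphs

open scoped Classical

open Finset Function Complex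

variable {V : Type*} [Fintype V] {G : SimpleGraph V} {p : V → ℂ}

/-- The darts along the edges in `F`. -/
def halves (G : SimpleGraph V) (F : Finset (Sym2 V)) : Finset G.Dart := {h | h.edge ∈ F}

theorem mem_halves {F : Finset (Sym2 V)} {h : G.Dart} : h ∈ halves G F ↔ h.edge ∈ F := by
  simp [halves]

theorem symm_mem_halves {F : Finset (Sym2 V)} {h : G.Dart} :
    h.symm ∈ halves G F ↔ h ∈ halves G F := by
  simp [mem_halves]

theorem exists_dart_of_mem_edgeSet {e : Sym2 V} (he : e ∈ G.edgeSet) (v : V) (hv : v ∈ e) :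
    ∃ h : G.Dart, h.edge = e ∧ h.fst = v := by
  obtain ⟨w, rfl⟩ := hv
  exact ⟨⟨(v, w), he⟩, rfl, rfl⟩

theorem eq_of_edge_eq_of_fst_eq {h h' : G.Dart} (h1 : h.edge = h'.edge) (h2 : h.fst = h'.fst) :
    h = h' := by
  rcases (SimpleGraph.dart_edge_eq_iff h h').1 h1 with rfl | rfl
  · rfl
  · exact absurd h2.symm h'.adj.ne

theorem card_halves_fst {F : Finset (Sym2 V)} (hFG : ∀ e ∈ F, e ∈ G.edgeSet) (v : V) :
    #{h ∈ halves G F | h.fst = v} = #{e ∈ F | v ∈ e} := by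
  refine card_bij (fun h _ => h.edge) ?_ ?_ ?_
  · intro h hh
    obtain ⟨h1, rfl⟩ := mem_filter.1 hh
    exact mem_filter.2 ⟨mem_halves.1 h1, Sym2.mem_mk_left _ _⟩
  · intro h hh h' hh' heq
    exact eq_of_edge_eq_of_fst_eq heq ((mem_filter.1 hh).2.trans (mem_filter.1 hh').2.symm)
  · intro e he
    obtain ⟨h1, h2⟩ := mem_filter.1 he
    obtain ⟨h, rfl, h3⟩ := exists_dart_of_mem_edgeSet (hFG e h1) v h2
    exact ⟨h, mem_filter.2 ⟨mem_halves.2 h1, h3⟩, rfl⟩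

/-- The half-edges are grouped by origin, and each group has the size of an even degree. It is
applied with `P` the vertices above a fixed edge. -/
theorem even_card_halves_above {F : Finset (Sym2 V)} (hFG : ∀ e ∈ F, e ∈ G.edgeSet)
    (hF : IsEvenEdgeSet F) (P : V → Prop) : Even #{h ∈ halves G F | P h.fst} := by
  rw [card_eq_sum_card_image (fun h : G.Dart => h.fst)]
  refine even_sum _ fun v hv => ?_
  obtain ⟨b, hb, rfl⟩ := mem_image.1 hv
  have hb := (mem_filter.1 hb).2
  rw [filter_filter]
  have : {a ∈ halves G F | P a.fst ∧ a.fst = b.fst} = {a ∈ halves G F | a.fst = b.fst} :=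
    filter_congr fun a _ => ⟨fun h => h.2, fun h => ⟨h ▸ hb, h⟩⟩
  rw [this, card_halves_fst hFG]
  convert hF b.fst

/-- The left-to-right darts along the edges in `F`. -/
def rightHalves (G : SimpleGraph V) (p : V → ℂ) (F : Finset (Sym2 V)) : Finset G.Dart :=
  {h ∈ halves G F | (p h.fst).re < (p h.snd).re}

theorem mem_rightHalves {F : Finset (Sym2 V)} {h : G.Dart} :
    h ∈ rightHalves G p F ↔ h.edge ∈ F ∧ (p h.fst).re < (p h.snd).re := by
  simp [rightHalves, mem_halves]

theorem sum_rightHalves (hre : Injective fun v => (p v).re) (F : Finset (Sym2 V)) (f : V → ℕ) :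
    ∑ h ∈ rightHalves G p F, (f h.fst + f h.snd) = ∑ h ∈ halves G F, f h.fst := by
  rw [← sum_filter_add_sum_filter_not (halves G F) (fun h => (p h.fst).re < (p h.snd).re),
    sum_add_distrib, rightHalves]
  congr 1
  refine sum_bij' (fun h _ => h.symm) (fun h _ => h.symm) ?_ ?_ (fun h _ => h.symm_symm)
    (fun h _ => h.symm_symm) (fun h _ => rfl)
  · intro h hh
    obtain ⟨h1, h2⟩ := mem_filter.1 hh
    exact mem_filter.2 ⟨symm_mem_halves.2 h1, h2.not_gt⟩
  · intro h hh
    obtain ⟨h1, h2⟩ := mem_filter.1 hh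
    refine mem_filter.2 ⟨symm_mem_halves.2 h1, lt_of_le_of_ne (not_lt.1 h2) fun h' => ?_⟩
    exact h.adj.ne' (hre h')

theorem eq_of_edge_eq_of_mem_rightHalves {F : Finset (Sym2 V)} {h h' : G.Dart}
    (hh : h ∈ rightHalves G p F) (hh' : h' ∈ rightHalves G p F) (heq : h.edge = h'.edge) :
    h = h' := by
  rcases (SimpleGraph.dart_edge_eq_iff h h').1 heq with rfl | rfl
  · rfl
  · exact absurd (mem_rightHalves.1 hh).2 (mem_rightHalves.1 hh').2.not_gt

theorem exists_mem_rightHalves (hre : Injective fun v => (p v).re) {F : Finset (Sym2 V)}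
    (hFG : ∀ e ∈ F, e ∈ G.edgeSet) {e : Sym2 V} (he : e ∈ F) :
    ∃ h ∈ rightHalves G p F, h.edge = e := by
  have he' := hFG e he
  induction e with
  | _ u v =>
    have hadj : G.Adj u v := he'
    rcases lt_or_gt_of_ne (fun h => hadj.ne (hre h) : (p u).re ≠ (p v).re) with h | h
    · exact ⟨⟨(u, v), hadj⟩, mem_rightHalves.2 ⟨he, h⟩, rfl⟩
    · exact ⟨⟨(v, u), hadj.symm⟩, mem_rightHalves.2 ⟨(Sym2.eq_swap ▸ he : s(v, u) ∈ F), h⟩,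
        Sym2.eq_swap⟩

theorem Crosses.symm {e f : Sym2 V} (h : Crosses p e f) : Crosses p f e :=
  ⟨h.1.symm, h.2.imp fun _ hz => ⟨hz.1.symm, hz.2⟩⟩

theorem crossingNumber_eq (hp : IsStraightDrawing G p) (hre : Injective fun v => (p v).re)
    {F : Finset (Sym2 V)} (hFG : ∀ e ∈ F, e ∈ G.edgeSet) :
    letI := dartLinearOrder hp hre
    crossingNumber p F = ∑ q ∈ rightHalves G p F ×ˢ rightHalves G p F with q.1 < q.2,
      if Crosses p q.1.edge q.2.edge then 1 else 0 := by
  letI := dartLinearOrder hp hre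
  rw [← card_filter, filter_filter, crossingNumber]
  symm
  refine card_bij (fun q _ => {q.1.edge, q.2.edge}) ?_ ?_ ?_
  · rintro ⟨g, h⟩ hq
    simp only [mem_filter, mem_product] at hq
    obtain ⟨⟨hg, hh⟩, -, hc⟩ := hq
    simp only [mem_filter, mem_powersetCard]
    refine ⟨⟨?_, card_pair hc.1⟩, _, _, rfl, hc⟩
    simp [insert_subset_iff, (mem_rightHalves.1 hg).1, (mem_rightHalves.1 hh).1]
  · rintro ⟨g, h⟩ hq ⟨g', h'⟩ hq' heq
    simp only [mem_filter, mem_product] at hq hq'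
    obtain ⟨⟨hg, hh⟩, hlt, hc⟩ := hq
    obtain ⟨⟨hg', hh'⟩, hlt', hc'⟩ := hq'
    simp only at heq
    have h1 : g.edge ∈ ({g'.edge, h'.edge} : Finset (Sym2 V)) := heq ▸ mem_insert_self _ _
    have h2 : h.edge ∈ ({g'.edge, h'.edge} : Finset (Sym2 V)) := by rw [← heq]; simp
    simp only [mem_insert, mem_singleton] at h1 h2
    rcases h1 with h1 | h1
    · have e1 := eq_of_edge_eq_of_mem_rightHalves hg hg' h1
      rcases h2 with h2 | h2
      · exact absurd (h1.trans h2.symm) hc.1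
      · rw [e1, eq_of_edge_eq_of_mem_rightHalves hh hh' h2]
    · have e1 := eq_of_edge_eq_of_mem_rightHalves hg hh' h1
      rcases h2 with h2 | h2
      · have e2 := eq_of_edge_eq_of_mem_rightHalves hh hg' h2
        subst e1 e2
        exact absurd hlt' hlt.not_gt
      · exact absurd (h1.trans h2.symm) hc.1
  · intro P hP
    simp only [mem_filter, mem_powersetCard] at hP
    obtain ⟨⟨hPF, -⟩, e, f, rfl, hc⟩ := hP
    obtain ⟨g, hg, rfl⟩ := exists_mem_rightHalves hre hFG (hPF (mem_insert_self e _))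
    obtain ⟨h, hh, rfl⟩ := exists_mem_rightHalves hre hFG (hPF (mem_insert_of_mem (mem_singleton_self f)))
    have hne : g ≠ h := by rintro rfl; exact hc.1 rfl
    rcases lt_or_gt_of_ne hne with hlt | hlt
    · exact ⟨(g, h), by simp [hg, hh, hlt, hc], rfl⟩
    · exact ⟨(h, g), by simp [hg, hh, hlt, hc.symm], pair_comm _ _⟩

theorem chordCrossings_halves (hp : IsStraightDrawing G p) (hre : Injective fun v => (p v).re)
    (F : Finset (Sym2 V)) :
    letI := dartLinearOrder hp hre
    chordCrossings SimpleGraph.Dart.symm (halves G F) =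
      ∑ q ∈ rightHalves G p F ×ˢ rightHalves G p F with q.1 < q.2,
        if q.2 < q.1.symm ∧ q.1.symm < q.2.symm then 1 else 0 := by
  letI := dartLinearOrder hp hre
  have hright : ∀ h : G.Dart, h < h.symm ↔ (p h.fst).re < (p h.snd).re := by
    intro h
    rw [dart_lt_symm_iff hp hre h, dartVec, sub_re, sub_pos]
  unfold chordCrossings
  rw [← sum_product', ← card_filter, ← card_filter, filter_filter]
  congr 1
  ext ⟨g, h⟩
  simp only [mem_filter, mem_product, rightHalves]
  constructor
  · rintro ⟨⟨hg, hh⟩, h1, h2, h3⟩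
    exact ⟨⟨⟨hg, (hright g).1 (h1.trans h2)⟩, hh, (hright h).1 (h2.trans h3)⟩, h1, h2, h3⟩
  · rintro ⟨⟨⟨hg, -⟩, hh, -⟩, h1, h2, h3⟩
    exact ⟨⟨hg, hh⟩, h1, h2, h3⟩

theorem not_above_fst (g : G.Dart) : ¬ Above p g g.fst := fun h => lt_irrefl _ h.1.1

theorem not_above_snd (g : G.Dart) : ¬ Above p g g.snd := fun h => lt_irrefl _ h.1.2

/-- In an even subgraph, the number of geometric crossings and the number of chord crossings have
the same parity. -/
theorem even_chordCrossings_add_crossingNumber (hp : IsStraightDrawing G p)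
    (hre : Injective fun v => (p v).re) {F : Finset (Sym2 V)} (hFG : ∀ e ∈ F, e ∈ G.edgeSet)
    (hF : IsEvenEdgeSet F) :
    letI := dartLinearOrder hp hre
    Even (chordCrossings SimpleGraph.Dart.symm (halves G F) + crossingNumber p F) := by
  letI := dartLinearOrder hp hre
  rw [chordCrossings_halves hp hre, crossingNumber_eq hp hre hFG]
  set P := rightHalves G p F with hP
  let A : G.Dart → G.Dart → ℕ := fun g h =>
    (if Above p g h.fst then 1 else 0) + (if Above p g h.snd then 1 else 0)
  -- The pairwise correction terms assemble into a sum over all ordered pairs, as no endpoint of an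
  -- edge lies above that edge. For fixed `g` they count half-edges with origin above `g`, an even
  -- number.
  have h1 : Even (∑ q ∈ P ×ˢ P with q.1 < q.2, (A q.1 q.2 + A q.2 q.1)) := by
    have h2 : ∑ q ∈ P ×ˢ P with q.1 < q.2, A q.2 q.1 = ∑ q ∈ P ×ˢ P with ¬ q.1 < q.2, A q.1 q.2 := by
      have h3 : ∑ q ∈ P ×ˢ P with q.1 < q.2, A q.2 q.1 = ∑ q ∈ P ×ˢ P with q.2 < q.1, A q.1 q.2 := by
        refine sum_bij' (fun q _ => q.swap) (fun q _ => q.swap) ?_ ?_ (fun _ _ => rfl)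
          (fun _ _ => rfl) (fun _ _ => rfl)
        · rintro ⟨g, h⟩; simp; tauto
        · rintro ⟨g, h⟩; simp; tauto
      rw [h3]
      refine sum_subset ?_ ?_
      · intro q hq
        rw [mem_filter] at hq ⊢
        exact ⟨hq.1, hq.2.not_gt⟩
      · rintro ⟨g, h⟩ hq hq'
        rw [mem_filter] at hq hq'
        have : g = h := le_antisymm (not_lt.1 fun h' => hq' ⟨hq.1, h'⟩) (not_lt.1 hq.2)
        subst this
        simp [A, not_above_fst, not_above_snd]
    rw [sum_add_distrib, h2, sum_filter_add_sum_filter_not, sum_product]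
    refine even_sum _ fun g _ => ?_
    simp only [A]
    rw [sum_rightHalves hre F (fun v => if Above p g v then 1 else 0), ← card_filter]
    exact even_card_halves_above hFG hF _
  have h2 : Even (∑ q ∈ P ×ˢ P with q.1 < q.2,
      ((if q.2 < q.1.symm ∧ q.1.symm < q.2.symm then 1 else 0) +
        (if Crosses p q.1.edge q.2.edge then 1 else 0) + A q.1 q.2 + A q.2 q.1)) := by
    refine even_sum _ fun q hq => ?_
    simp only [mem_filter, mem_product] at hq
    exact even_pair_crossings hp hre (mem_rightHalves.1 hq.1.1).2 (mem_rightHalves.1 hq.1.2).2 hq.2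
  simp only [add_assoc] at h2
  rw [sum_add_distrib, sum_add_distrib, ← add_assoc] at h2
  exact (Nat.even_add.1 h2).2 h1

variable {R : Type*} [CommRing R] [Algebra ℂ R]

/-- The part of degree `m` of the generating function of even subgraphs. -/
def evenGenFunDeg (G : SimpleGraph V) (p : V → ℂ) (y : Sym2 V → R) (m : ℕ) : R :=
  ∑ F : Finset (Sym2 V) with ((∀ e ∈ F, e ∈ G.edgeSet) ∧ IsEvenEdgeSet F) ∧ #F = m,
    (-1) ^ crossingNumber p F * ∏ e ∈ F, y e

/-- The Kac–Ward transition matrix. -/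
def kacWardMatrix (G : SimpleGraph V) (p : V → ℂ) (y : Sym2 V → R) : Matrix G.Dart G.Dart R :=
  fun e e' => if e.snd = e'.fst ∧ e'.snd ≠ e.fst then
    algebraMap ℂ R (exp (I / 2 * turningAngle p e.fst e.snd e'.snd)) * y e.edge else 0

theorem barClosed_halves (F : Finset (Sym2 V)) :
    BarClosed SimpleGraph.Dart.symm (halves G F) := fun _ hh => symm_mem_halves.2 hh

theorem evenAt_halves_iff (hre : Injective fun v => (p v).re) {F : Finset (Sym2 V)}
    (hFG : ∀ e ∈ F, e ∈ G.edgeSet) :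
    EvenAt (fun h : G.Dart => (p h.fst).re) (halves G F) ↔ IsEvenEdgeSet F := by
  have h1 : ∀ v, #{h ∈ halves G F | (p h.fst).re = (p v).re} = #{e ∈ F | v ∈ e} := by
    intro v
    rw [← card_halves_fst hFG]
    congr 1
    exact filter_congr fun h _ => hre.eq_iff
  constructor
  · intro h v
    have := h (p v).re
    rw [h1] at this
    convert this
  · intro h w
    by_cases hw : ∃ v, (p v).re = w
    · obtain ⟨v, rfl⟩ := hw
      rw [h1]
      convert h v
    · rw [filter_false_of_mem fun b _ hb => hw ⟨_, hb⟩]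
      simp

theorem halves_image_edge {H : Finset G.Dart} (hH : BarClosed SimpleGraph.Dart.symm H) :
    halves G (H.image SimpleGraph.Dart.edge) = H := by
  ext h
  rw [mem_halves, mem_image]
  constructor
  · rintro ⟨h', hh', heq⟩
    rcases (SimpleGraph.dart_edge_eq_iff h' h).1 heq with rfl | rfl
    · exact hh'
    · have := hH _ hh'
      rwa [SimpleGraph.Dart.symm_symm] at this
  · intro hh
    exact ⟨h, hh, rfl⟩

theorem halves_injOn {F F' : Finset (Sym2 V)} (hFG : ∀ e ∈ F, e ∈ G.edgeSet)
    (hFG' : ∀ e ∈ F', e ∈ G.edgeSet) (h : halves G F = halves G F') : F = F' := by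
  have key : ∀ {F F' : Finset (Sym2 V)}, (∀ e ∈ F, e ∈ G.edgeSet) → halves G F = halves G F' →
      F ⊆ F' := by
    intro F F' hFG h e he
    obtain ⟨d, rfl, -⟩ := exists_dart_of_mem_edgeSet (hFG e he) e.out.1 (Sym2.out_fst_mem e)
    exact mem_halves.1 (h ▸ mem_halves.2 he)
  exact (key hFG h).antisymm (key hFG' h.symm)

theorem prod_filter_halves (hp : IsStraightDrawing G p) (hre : Injective fun v => (p v).re)
    {F : Finset (Sym2 V)} (hFG : ∀ e ∈ F, e ∈ G.edgeSet) (y : Sym2 V → R) :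
    letI := dartLinearOrder hp hre
    edgeWeight SimpleGraph.Dart.symm (fun h : G.Dart => y h.edge) (halves G F) = ∏ e ∈ F, y e := by
  letI := dartLinearOrder hp hre
  have h1 : {h ∈ halves G F | h < h.symm} = rightHalves G p F := by
    refine filter_congr fun h _ => ?_
    rw [dart_lt_symm_iff hp hre h, dartVec, sub_re, sub_pos]
  rw [edgeWeight, h1]
  refine prod_bij (fun h _ => h.edge) (fun h hh => (mem_rightHalves.1 hh).1)
    (fun h hh h' hh' => eq_of_edge_eq_of_mem_rightHalves hh hh') ?_ (fun _ _ => rfl)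
  intro e he
  obtain ⟨h, hh, rfl⟩ := exists_mem_rightHalves hre hFG he
  exact ⟨h, hh, rfl⟩

theorem edgeCount_halves (hp : IsStraightDrawing G p) (hre : Injective fun v => (p v).re)
    {F : Finset (Sym2 V)} (hFG : ∀ e ∈ F, e ∈ G.edgeSet) :
    letI := dartLinearOrder hp hre
    edgeCount SimpleGraph.Dart.symm (halves G F) = #F := by
  letI := dartLinearOrder hp hre
  have h1 : {h ∈ halves G F | h < h.symm} = rightHalves G p F := by
    refine filter_congr fun h _ => ?_
    rw [dart_lt_symm_iff hp hre h, dartVec, sub_re, sub_pos]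
  rw [edgeCount, h1]
  refine card_bij (fun h _ => h.edge) (fun h hh => (mem_rightHalves.1 hh).1)
    (fun h hh h' hh' => eq_of_edge_eq_of_mem_rightHalves hh hh') ?_
  intro e he
  obtain ⟨h, hh, rfl⟩ := exists_mem_rightHalves hre hFG he
  exact ⟨h, hh, rfl⟩

theorem chordGenFunDeg_eq (hp : IsStraightDrawing G p) (hre : Injective fun v => (p v).re)
    (y : Sym2 V → R) (m : ℕ) :
    letI := dartLinearOrder hp hre
    chordGenFunDeg (fun h : G.Dart => (p h.fst).re) SimpleGraph.Dart.symm (fun h => y h.edge) m =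
      evenGenFunDeg G p y m := by
  letI := dartLinearOrder hp hre
  symm
  refine sum_bij (fun F _ => halves G F) ?_ ?_ ?_ ?_
  · intro F hF
    obtain ⟨-, ⟨h1, h2⟩, h3⟩ := mem_filter.1 hF
    exact mem_filter.2 ⟨mem_univ _, ⟨barClosed_halves F, (evenAt_halves_iff hre h1).2 h2⟩,
      (edgeCount_halves hp hre h1).trans h3⟩
  · intro F hF F' hF' heq
    exact halves_injOn (mem_filter.1 hF).2.1.1 (mem_filter.1 hF').2.1.1 heq
  · intro H hH
    obtain ⟨-, ⟨h1, h2⟩, h3⟩ := mem_filter.1 hH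
    have h4 : ∀ e ∈ H.image SimpleGraph.Dart.edge, e ∈ G.edgeSet := by
      intro e he
      obtain ⟨h, -, rfl⟩ := mem_image.1 he
      exact h.edge_mem
    have h5 := halves_image_edge h1
    refine ⟨H.image SimpleGraph.Dart.edge, mem_filter.2 ⟨mem_univ _, ⟨h4, ?_⟩, ?_⟩, h5⟩
    · rw [← evenAt_halves_iff hre h4, h5]; exact h2
    · rw [← edgeCount_halves hp hre h4, h5]; exact h3
  · intro F hF
    obtain ⟨-, ⟨h1, h2⟩, h3⟩ := mem_filter.1 hF
    rw [prod_filter_halves hp hre h1,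
      neg_one_pow_eq_of_even_add (even_chordCrossings_add_crossingNumber hp hre h1 h2)]

/-- The change of gauge is by the half-tilt phases. Backtracking transitions vanish on both sides,
since `orderSign` of a dart with itself is zero. -/
theorem kacWardMatrix_apply (hp : IsStraightDrawing G p) (hre : Injective fun v => (p v).re)
    (y : Sym2 V → R) (e e' : G.Dart) :
    letI := dartLinearOrder hp hre
    kacWardMatrix G p y e e' =
      algebraMap ℂ R (exp (I / 2 * tilt (dartVec p e)))⁻¹ *
        chordTransition (fun h : G.Dart => (p h.fst).re) SimpleGraph.Dart.symm
          (fun h => y h.edge) e e' * algebraMap ℂ R (exp (I / 2 * tilt (dartVec p e'))) := by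
  letI := dartLinearOrder hp hre
  have hsign : ∀ a b : G.Dart, orderSign R a b = algebraMap ℂ R (orderSign ℂ a b) := by
    intro a b; unfold orderSign; split_ifs <;> simp
  unfold kacWardMatrix chordTransition
  have hiff : (p e.symm.fst).re = (p e'.fst).re ↔ e.snd = e'.fst := hre.eq_iff
  simp only [hiff]
  by_cases h1 : e.snd = e'.fst
  · by_cases h2 : e'.snd = e.fst
    · have : e.symm = e' := SimpleGraph.Dart.ext _ _ (Prod.ext h1 h2.symm)
      simp [h1, h2, this, orderSign]
    · rw [if_pos ⟨h1, h2⟩, if_pos h1, exp_half_turningAngle hp hre e e' h1 h2, hsign, hsign,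
        div_eq_mul_inv]
      simp only [map_mul]
      ring
  · simp [h1]

theorem trace_kacWardMatrix_pow (hp : IsStraightDrawing G p) (hre : Injective fun v => (p v).re)
    (y : Sym2 V → R) (n : ℕ) :
    letI := dartLinearOrder hp hre
    (kacWardMatrix G p y ^ n).trace =
      (chordTransition (fun h : G.Dart => (p h.fst).re) SimpleGraph.Dart.symm
        (fun h => y h.edge) ^ n).trace := by
  letI := dartLinearOrder hp hre
  set T := chordTransition (fun h : G.Dart => (p h.fst).re) SimpleGraph.Dart.symm
    (fun h => y h.edge) with hT
  let u : G.Dart → R := fun e => algebraMap ℂ R (exp (I / 2 * tilt (dartVec p e)))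
  let u' : G.Dart → R := fun e => algebraMap ℂ R (exp (I / 2 * tilt (dartVec p e)))⁻¹
  have hu : Matrix.diagonal u * Matrix.diagonal u' = 1 := by
    rw [Matrix.diagonal_mul_diagonal, ← Matrix.diagonal_one]
    congr 1
    ext e
    simp only [u, u']
    rw [← map_mul, mul_inv_cancel₀ (exp_ne_zero _), map_one]
  have hu' : Matrix.diagonal u' * Matrix.diagonal u = 1 := mul_eq_one_comm.1 hu
  have hkw : kacWardMatrix G p y = Matrix.diagonal u' * T * Matrix.diagonal u := by
    ext e e'
    rw [Matrix.mul_diagonal, Matrix.diagonal_mul, kacWardMatrix_apply hp hre]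
  have hpow : kacWardMatrix G p y ^ n = Matrix.diagonal u' * T ^ n * Matrix.diagonal u := by
    rw [hkw]
    induction n with
    | zero => simp [hu']
    | succ n ih =>
      rw [pow_succ, ih, pow_succ]
      simp only [Matrix.mul_assoc]
      rw [← Matrix.mul_assoc (Matrix.diagonal u) (Matrix.diagonal u'), hu, Matrix.one_mul]
  rw [hpow, Matrix.trace_mul_comm, ← Matrix.mul_assoc, hu, Matrix.one_mul]

theorem evenGenFunDeg_newton_of_injective (hp : IsStraightDrawing G p)
    (hre : Injective fun v => (p v).re) (y : Sym2 V → R) (m : ℕ) :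
    -(2 * m) * evenGenFunDeg G p y m = ∑ i ∈ range m,
      evenGenFunDeg G p y (m - (i + 1)) * (kacWardMatrix G p y ^ (i + 1)).trace := by
  letI := dartLinearOrder hp hre
  have := chordGenFunDeg_newton (dart_fst_monotone hp hre) SimpleGraph.Dart.symm_involutive
    SimpleGraph.Dart.symm_ne (fun h => y h.edge) (fun h => by rw [SimpleGraph.Dart.edge_symm]) m
  simp only [chordGenFunDeg_eq hp hre] at this
  rw [this]
  refine sum_congr rfl fun i _ => ?_
  congr 1
  convert (trace_kacWardMatrix_pow hp hre y (i + 1)).symm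

end EvenSubgraphs

/-! ### Removing the assumption of distinct abscissas by a similarity of the plane. -/

section Rotation

open scoped Classical

open Finset Function Complex

variable {V : Type*} {G : SimpleGraph V} {p : V → ℂ}

/-- With η = 1 + ti, two vertices acquire equal abscissas for at most one value of t, so finitely
many values are to be avoided. -/
theorem exists_injective_re_mul [Finite V] (hp : Injective p) :
    ∃ η : ℂ, η ≠ 0 ∧ Injective fun v => (η * p v).re := by
  have hfin : (Set.range fun q : V × V => (p q.1 - p q.2).re / (p q.1 - p q.2).im).Finite :=
    Set.finite_range _
  obtain ⟨t, ht⟩ := hfin.exists_notMem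
  refine ⟨1 + t * I, fun h => by simpa using congrArg re h, fun u v huv => ?_⟩
  by_contra hne
  have h1 : (p u - p v).re = t * (p u - p v).im := by
    simp only [mul_re, add_re, one_re, ofReal_re, I_re, add_im, one_im, mul_im, ofReal_im,
      I_im, sub_re, sub_im] at huv ⊢
    linarith
  have h2 : (p u - p v).im ≠ 0 := by
    intro h
    rw [h, mul_zero] at h1
    exact hne (hp (sub_eq_zero.1 (Complex.ext h1 h)))
  exact ht ⟨(u, v), by simp only; rw [h1]; field_simp⟩

theorem mul_mem_segment_iff {η : ℂ} (hη : η ≠ 0) {a b z : ℂ} :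
    η * z ∈ segment ℝ (η * a) (η * b) ↔ z ∈ segment ℝ a b := by
  rw [segment_eq_image', segment_eq_image']
  refine exists_congr fun t => and_congr_right fun _ => ?_
  simp only
  rw [← mul_sub, ← mul_smul_comm, ← mul_add, mul_right_inj' hη]

theorem IsStraightDrawing.mul_left (hp : IsStraightDrawing G p) {η : ℂ} (hη : η ≠ 0) :
    IsStraightDrawing G fun v => η * p v where
  injective := fun _ _ h => hp.injective (mul_left_cancel₀ hη h)
  eq_or_eq_of_mem_segment := fun u v w h h' =>
    hp.eq_or_eq_of_mem_segment u v w h ((mul_mem_segment_iff hη).1 h')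

theorem crosses_mul_left_iff {η : ℂ} (hη : η ≠ 0) (e f : Sym2 V) :
    Crosses (fun v => η * p v) e f ↔ Crosses p e f := by
  have hseg : ∀ (e : Sym2 V) z, η * z ∈ edgeSegment (fun v => η * p v) e ↔ z ∈ edgeSegment p e := by
    intro e z
    induction e with
    | _ u v => exact mul_mem_segment_iff hη
  have hran : ∀ z, η * z ∈ Set.range (fun v => η * p v) ↔ z ∈ Set.range p := fun z =>
    exists_congr fun v => mul_right_inj' hη
  refine and_congr_right fun _ => ⟨?_, ?_⟩
  · rintro ⟨z, ⟨h1, h2⟩, h3⟩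
    obtain ⟨z, rfl⟩ : ∃ z', η * z' = z := ⟨z / η, mul_div_cancel₀ z hη⟩
    exact ⟨z, ⟨(hseg e z).1 h1, (hseg f z).1 h2⟩, fun h => h3 ((hran z).2 h)⟩
  · rintro ⟨z, ⟨h1, h2⟩, h3⟩
    exact ⟨η * z, ⟨(hseg e z).2 h1, (hseg f z).2 h2⟩, fun h => h3 ((hran z).1 h)⟩

theorem crossingNumber_mul_left {η : ℂ} (hη : η ≠ 0) (F : Finset (Sym2 V)) :
    crossingNumber (fun v => η * p v) F = crossingNumber p F := by
  unfold crossingNumber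
  simp only [crosses_mul_left_iff hη]

theorem turningAngle_mul_left {η : ℂ} (hη : η ≠ 0) (u v w : V) :
    turningAngle (fun v => η * p v) u v w = turningAngle p u v w := by
  unfold turningAngle
  rw [← mul_sub, ← mul_sub, mul_div_mul_left _ _ hη]

variable [Fintype V] {R : Type*} [CommRing R] [Algebra ℂ R]

/-- Newton's identities between even subgraphs and the traces of the Kac–Ward matrix. -/
theorem evenGenFunDeg_newton (hp : IsStraightDrawing G p) (y : Sym2 V → R) (m : ℕ) :
    -(2 * m) * evenGenFunDeg G p y m = ∑ i ∈ range m,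
      evenGenFunDeg G p y (m - (i + 1)) * (kacWardMatrix G p y ^ (i + 1)).trace := by
  -- Crossings and turning angles are unchanged under multiplication by η, hence so are both sides
  -- of the identity.
  obtain ⟨η, hη, hinj⟩ := exists_injective_re_mul hp.injective
  have h := evenGenFunDeg_newton_of_injective (hp.mul_left hη) hinj y m
  have h1 : ∀ m, evenGenFunDeg G (fun v => η * p v) y m = evenGenFunDeg G p y m := by
    intro m
    unfold evenGenFunDeg
    simp only [crossingNumber_mul_left hη]
  have h2 : kacWardMatrix G (fun v => η * p v) y = kacWardMatrix G p y := by
    ext e e'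
    simp only [kacWardMatrix, turningAngle_mul_left hη]
  rwa [h2, h1, sum_congr rfl fun i _ => by rw [h1]] at h

end Rotation

/-! ### Traces of matrix powers as sums over cyclic sequences. -/

section MatrixTrace

open Finset

variable {D R : Type*} [Fintype D] [DecidableEq D] [CommRing R]

theorem matrix_pow_apply_eq_sum (M : Matrix D D R) (k : ℕ) (a b : D) :
    (M ^ k) a b = ∑ f : Fin (k + 1) → D, if f 0 = a ∧ f (Fin.last k) = b then
      ∏ i : Fin k, M (f i.castSucc) (f i.succ) else 0 := by
  induction k generalizing a with
  | zero =>
    rw [← (Equiv.funUnique (Fin 1) D).symm.sum_comp]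
    simp only [pow_zero, Matrix.one_apply, univ_eq_empty, prod_empty]
    simp [ite_and]
  | succ k ih =>
    rw [pow_succ', Matrix.mul_apply]
    simp only [ih]
    rw [← (Fin.consEquiv (fun _ : Fin (k + 2) => D)).sum_comp, Fintype.sum_prod_type]
    simp only [mul_sum]
    rw [sum_comm]
    conv_rhs => rw [sum_comm]
    refine sum_congr rfl fun f _ => ?_
    simp only [Fin.consEquiv_apply, Fin.cons_zero, Fin.prod_univ_succ, Fin.castSucc_zero,
      Fin.cons_succ, ← Fin.succ_last, ← Fin.succ_castSucc, ite_and, sum_ite_eq', sum_ite_eq,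
      mul_ite, mul_zero, mem_univ, if_true]

theorem trace_pow_eq_sum (M : Matrix D D R) (k : ℕ) :
    (M ^ (k + 1)).trace = ∑ f : Fin (k + 1) → D, ∏ i, M (f i) (f (i + 1)) := by
  simp only [Matrix.trace, Matrix.diag_apply, matrix_pow_apply_eq_sum]
  rw [sum_comm, ← (Fin.snocEquiv (fun _ : Fin (k + 2) => D)).sum_comp, Fintype.sum_prod_type,
    sum_comm]
  refine sum_congr rfl fun f _ => ?_
  have h0 : ∀ x : D, (Fin.snoc f x : Fin (k + 2) → D) 0 = f 0 := fun x => by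
    rw [← Fin.castSucc_zero, Fin.snoc_castSucc (α := fun _ => D)]
  simp only [Fin.snocEquiv_apply, Fin.snoc_last, h0, ite_and, sum_ite_eq, sum_ite_eq', mem_univ,
    if_true]
  rw [Fin.prod_univ_castSucc, Fin.prod_univ_castSucc]
  simp only [Fin.snoc_castSucc, Fin.succ_castSucc, Fin.succ_last, Fin.snoc_last,
    Fin.last_add_one, Fin.coeSucc_eq_succ]

end MatrixTrace

/-! ### Translating lists of vertices into functions on a cyclic group. -/

section CyclicSequences

open Function Complex

variable {V : Type*} {G : SimpleGraph V} {p : V → ℂ} {k : ℕ}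

/-- A closed path as a function on the cyclic group `Fin (k + 1)`. -/
def IsCyclicPath (G : SimpleGraph V) (v : Fin (k + 1) → V) : Prop :=
  ∀ i, G.Adj (v i) (v (i + 1)) ∧ v (i + 1 + 1) ≠ v i

theorem finOfNat_succ (m : ℕ) : Fin.ofNat (k + 1) (m + 1) = Fin.ofNat (k + 1) m + 1 := by
  ext
  simp [Fin.val_add, Nat.add_mod]

theorem finOfNat_add (m n : ℕ) :
    Fin.ofNat (k + 1) (m + n) = Fin.ofNat (k + 1) m + Fin.ofNat (k + 1) n := by
  ext
  simp [Fin.val_add, Nat.add_mod]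

theorem finOfNat_val (i : Fin (k + 1)) : Fin.ofNat (k + 1) i = i := by
  ext
  simp

theorem finMk_add_finOfNat {i : ℕ} (hi : i < k + 1) (j : ℕ) :
    (⟨i, hi⟩ : Fin (k + 1)) + Fin.ofNat (k + 1) j = Fin.ofNat (k + 1) (i + j) := by
  rw [finOfNat_add, ← finOfNat_val ⟨i, hi⟩]

theorem rotate_ofFn (v : Fin (k + 1) → V) (j : ℕ) :
    (List.ofFn v).rotate j = List.ofFn fun i => v (i + Fin.ofNat (k + 1) j) := by
  refine List.ext_getElem (by simp) fun i h1 h2 => ?_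
  rw [List.getElem_rotate, List.getElem_ofFn, List.getElem_ofFn]
  congr 1
  ext
  simp [Fin.val_add, Nat.add_mod]

theorem reverse_ofFn (v : Fin (k + 1) → V) :
    (List.ofFn v).reverse = List.ofFn fun i => v i.rev := by
  refine List.ext_getElem (by simp) fun i h1 h2 => ?_
  rw [List.getElem_reverse, List.getElem_ofFn, List.getElem_ofFn]
  congr 1
  ext
  simp [Fin.val_rev]

theorem rev_add_one_add_one (i : Fin (k + 1)) : (i + 1).rev + 1 = i.rev := by
  have h : ∀ j : Fin (k + 1), j.rev = Fin.last k - j := fun j => (Fin.last_sub j).symm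
  rw [h, h]
  abel

theorem isClosedPath_ofFn_iff (v : Fin (k + 1) → V) :
    IsClosedPath G (List.ofFn v) ↔ IsCyclicPath G v := by
  constructor
  · rintro ⟨hlen, h⟩ i
    rw [List.length_ofFn] at hlen
    obtain ⟨h1, h2⟩ := h i
    have hl : ((List.ofFn v).rotate i).length = k + 1 := by simp
    have e1 := h1 0 (by omega)
    have e2 := h2 0 (by omega)
    simp only [rotate_ofFn, List.getElem_ofFn, finMk_add_finOfNat] at e1 e2
    rw [zero_add, zero_add, add_comm 1, finOfNat_succ, finOfNat_val] at e1
    rw [zero_add, zero_add, add_comm 2, finOfNat_succ, finOfNat_succ, finOfNat_val] at e2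
    exact ⟨e1, e2⟩
  · intro h
    refine ⟨?_, fun j => ⟨fun i hi => ?_, fun i hi => ?_⟩⟩
    · rw [List.length_ofFn]
      by_contra hlt
      -- One or two steps are excluded by the cyclic conditions themselves: for `k = 0` an edge
      -- would join a vertex to itself, for `k = 1` two steps return to the start.
      have : k = 0 ∨ k = 1 := by omega
      rcases this with rfl | rfl
      · exact (h 0).1.ne rfl
      · exact (h 0).2 rfl
    · simp only [rotate_ofFn, List.getElem_ofFn, finMk_add_finOfNat]
      rw [add_right_comm, finOfNat_succ]
      exact (h _).1
    · simp only [rotate_ofFn, List.getElem_ofFn, finMk_add_finOfNat]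
      rw [add_right_comm, finOfNat_succ, finOfNat_succ]
      exact (h _).2

theorem loopEdges_ofFn (v : Fin (k + 1) → V) :
    loopEdges (List.ofFn v) = List.ofFn fun i => s(v i, v (i + 1)) := by
  refine List.ext_getElem (by simp [loopEdges]) fun i h1 h2 => ?_
  simp only [loopEdges, rotate_ofFn, List.getElem_zipWith, List.getElem_ofFn]
  rfl

theorem windingAngle_ofFn (v : Fin (k + 1) → V) :
    windingAngle p (List.ofFn v) = ∑ i, turningAngle p (v i) (v (i + 1)) (v (i + 1 + 1)) := by
  rw [windingAngle, ← List.sum_ofFn]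
  congr 1
  have := List.zipWith_zipWith_left (fun (g : V → ℝ) c => g c) (turningAngle p) (List.ofFn v)
    ((List.ofFn v).rotate 1) ((List.ofFn v).rotate 2)
  refine this.symm.trans ?_
  refine List.ext_getElem (by simp) fun i h1 h2 => ?_
  simp only [rotate_ofFn, List.getElem_zipWith, List.getElem_ofFn]
  congr 2
  rw [add_assoc]
  congr 1
  rw [finOfNat_succ, finOfNat_succ]
  simp

end CyclicSequences

/-! ### Kac–Ward traces as sums over closed paths, and the symmetries of path weights. -/

section Traces

open scoped Classical

open Finset Function Complex

variable {V : Type*} [Fintype V] {G : SimpleGraph V} {p : V → ℂ} {k : ℕ}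
  {R : Type*} [CommRing R] [Algebra ℂ R]

/-- The weight of a closed path: its phase times the product of the edge weights. -/
def pathWeight (p : V → ℂ) (y : Sym2 V → R) (l : List V) : R :=
  algebraMap ℂ R (exp (I / 2 * windingAngle p l)) * ((loopEdges l).map y).prod

theorem pathWeight_ofFn (y : Sym2 V → R) (v : Fin (k + 1) → V) :
    pathWeight p y (List.ofFn v) =
      ∏ i, (algebraMap ℂ R (exp (I / 2 * turningAngle p (v i) (v (i + 1)) (v (i + 1 + 1)))) *
        y s(v i, v (i + 1))) := by
  rw [pathWeight, windingAngle_ofFn, loopEdges_ofFn, List.map_ofFn, List.prod_ofFn, ofReal_sum,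
    mul_sum, exp_sum, map_prod, prod_mul_distrib]
  rfl

/-- Only cyclic sequences of composable, non-backtracking darts contribute, and such a sequence is
determined by the origins of its darts. -/
theorem trace_kacWardMatrix_pow_eq_sum (y : Sym2 V → R) (k : ℕ) :
    (kacWardMatrix G p y ^ (k + 1)).trace =
      ∑ v : Fin (k + 1) → V with IsCyclicPath G v, pathWeight p y (List.ofFn v) := by
  rw [trace_pow_eq_sum]
  have h1 : ∑ g : Fin (k + 1) → G.Dart, ∏ i, kacWardMatrix G p y (g i) (g (i + 1)) =
      ∑ g : Fin (k + 1) → G.Dart with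
        ∀ i, (g i).snd = (g (i + 1)).fst ∧ (g (i + 1)).snd ≠ (g i).fst,
        ∏ i, kacWardMatrix G p y (g i) (g (i + 1)) := by
    symm
    refine sum_subset (subset_univ _) fun g _ hg => ?_
    simp only [mem_filter, mem_univ, true_and, not_forall] at hg
    obtain ⟨i, hi⟩ := hg
    exact prod_eq_zero (mem_univ i) (if_neg hi)
  rw [h1]
  refine sum_bij (fun g _ i => (g i).fst) ?_ ?_ ?_ ?_
  · intro g hg
    have hg := (mem_filter.1 hg).2
    refine mem_filter.2 ⟨mem_univ _, fun i => ⟨?_, ?_⟩⟩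
    · simp only [← (hg i).1]; exact (g i).adj
    · simp only [← (hg (i + 1)).1]; exact (hg i).2
  · intro g hg g' hg' heq
    have hg := (mem_filter.1 hg).2
    have hg' := (mem_filter.1 hg').2
    funext i
    refine SimpleGraph.Dart.ext _ _ (Prod.ext (congrFun heq i) ?_)
    rw [(hg i).1, (hg' i).1]
    exact congrFun heq (i + 1)
  · intro v hv
    have hv := (mem_filter.1 hv).2
    exact ⟨fun i => ⟨(v i, v (i + 1)), (hv i).1⟩, mem_filter.2 ⟨mem_univ _, fun i => ⟨rfl, (hv i).2⟩⟩, rfl⟩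
  · intro g hg
    have hg := (mem_filter.1 hg).2
    rw [pathWeight_ofFn]
    refine prod_congr rfl fun i _ => ?_
    rw [kacWardMatrix, if_pos (hg i), ← (hg i).1, ← (hg (i + 1)).1]
    rfl

/-- The ratios of consecutive edge vectors multiply to 1 around the cycle. Consequently the
half-angle phase is a sign. -/
theorem exp_winding_eq_one (hp : IsStraightDrawing G p) {v : Fin (k + 1) → V}
    (hv : IsCyclicPath G v) : exp (I * windingAngle p (List.ofFn v)) = 1 := by
  have hd : ∀ i, p (v (i + 1)) - p (v i) ≠ 0 := fun i =>
    sub_ne_zero.2 fun h => (hv i).1.ne' (hp.injective h)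
  have hprod : ∏ i, (p (v (i + 1 + 1)) - p (v (i + 1))) / (p (v (i + 1)) - p (v i)) = 1 := by
    rw [prod_div_distrib]
    have h := Equiv.prod_comp (Equiv.addRight (1 : Fin (k + 1))) (fun i => p (v (i + 1)) - p (v i))
    simp only [Equiv.coe_addRight] at h
    rw [h]
    exact div_self (prod_ne_zero_iff.2 fun i _ => hd i)
  have h1 : ((∏ i, ‖(p (v (i + 1 + 1)) - p (v (i + 1))) / (p (v (i + 1)) - p (v i))‖ : ℝ) : ℂ) *
      exp (I * windingAngle p (List.ofFn v)) = 1 := by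
    rw [windingAngle_ofFn, ofReal_sum, mul_sum, exp_sum, ofReal_prod, ← prod_mul_distrib, ← hprod]
    refine prod_congr rfl fun i _ => ?_
    rw [mul_comm I, turningAngle, norm_mul_exp_arg_mul_I]
  have h2 : ∏ i, ‖(p (v (i + 1 + 1)) - p (v (i + 1))) / (p (v (i + 1)) - p (v i))‖ = 1 := by
    rw [← norm_prod, hprod, norm_one]
  rwa [h2, ofReal_one, one_mul] at h1

/-- `arg` of an inverse changes sign except at π. A turn by π would put both edges at `v` on one
ray, which forces backtracking. -/
theorem turningAngle_reverse (hp : IsStraightDrawing G p) {u v w : V} (huv : G.Adj u v)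
    (hvw : G.Adj v w) (huw : w ≠ u) : turningAngle p w v u = -turningAngle p u v w := by
  have h1 : (p u - p v) / (p v - p w) = ((p w - p v) / (p v - p u))⁻¹ := by
    rw [inv_div, ← neg_sub, ← neg_sub (p w), neg_div_neg_eq]
  rw [turningAngle, h1, arg_inv, if_neg, turningAngle]
  intro hπ
  rw [arg_eq_pi_iff] at hπ
  set q := (p w - p v) / (p v - p u) with hq
  have hne : p v - p u ≠ 0 := sub_ne_zero.2 fun h => huv.ne' (hp.injective h)
  have h2 : p w - p v = (-q.re) • (p u - p v) := by
    have h3 : (q.re : ℂ) = q := Complex.ext rfl hπ.2.symm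
    have h4 : p w - p v = q * (p v - p u) := by rw [hq, div_mul_cancel₀ _ hne]
    rw [real_smul, ofReal_neg, h3, h4]; ring
  exact huw (hp.eq_of_sameRay huv.symm hvw (by linarith [hπ.1]) h2).symm

/-- Reversal negates the winding angle and so inverts the phase, which is ±1. -/
theorem pathWeight_reverse (hp : IsStraightDrawing G p) (y : Sym2 V → R) {v : Fin (k + 1) → V}
    (hv : IsCyclicPath G v) :
    pathWeight p y (List.ofFn v).reverse = pathWeight p y (List.ofFn v) := by
  rw [reverse_ofFn, pathWeight, pathWeight]
  congr 1
  · congr 1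
    have h1 : windingAngle p (List.ofFn fun i => v i.rev) = -windingAngle p (List.ofFn v) := by
      rw [windingAngle_ofFn, windingAngle_ofFn, ← sum_neg_distrib]
      rw [← (((Equiv.addRight (1 : Fin (k + 1))).trans (Equiv.addRight (1 : Fin (k + 1)))).trans
        Fin.revPerm).sum_comp (fun i => -turningAngle p (v i) (v (i + 1)) (v (i + 1 + 1)))]
      refine sum_congr rfl fun i _ => ?_
      simp only [Equiv.trans_apply, Equiv.coe_addRight, Fin.revPerm_apply, rev_add_one_add_one]
      have := hv (i + 1 + 1).rev
      rw [rev_add_one_add_one, rev_add_one_add_one] at this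
      have h2 := hv (i + 1).rev
      rw [rev_add_one_add_one] at h2
      exact turningAngle_reverse hp this.1 h2.1 this.2
    have h2 := exp_winding_eq_one hp hv
    rw [h1, ofReal_neg]
    have h3 : exp (I / 2 * windingAngle p (List.ofFn v)) *
        exp (I / 2 * windingAngle p (List.ofFn v)) = 1 := by
      rw [← exp_add, ← h2]; congr 1; ring
    rw [mul_neg, exp_neg]
    exact inv_eq_of_mul_eq_one_left h3
  · rw [loopEdges_ofFn, loopEdges_ofFn, List.map_ofFn, List.map_ofFn, List.prod_ofFn, List.prod_ofFn]
    rw [← Equiv.prod_comp ((Equiv.addRight (1 : Fin (k + 1))).trans Fin.revPerm)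
      (y ∘ fun i => s(v i, v (i + 1)))]
    refine prod_congr rfl fun i _ => ?_
    simp only [comp_apply, Equiv.trans_apply, Equiv.coe_addRight, Fin.revPerm_apply,
      rev_add_one_add_one]
    rw [Sym2.eq_swap]

theorem pathWeight_rotate (y : Sym2 V → R) (v : Fin (k + 1) → V) (j : ℕ) :
    pathWeight p y ((List.ofFn v).rotate j) = pathWeight p y (List.ofFn v) := by
  rw [rotate_ofFn, pathWeight_ofFn, pathWeight_ofFn,
    ← Equiv.prod_comp (Equiv.addRight (Fin.ofNat (k + 1) j)) (fun i => algebraMap ℂ R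
      (exp (I / 2 * turningAngle p (v i) (v (i + 1)) (v (i + 1 + 1)))) * y s(v i, v (i + 1)))]
  refine prod_congr rfl fun i _ => ?_
  simp only [Equiv.coe_addRight]
  simp only [add_right_comm _ _ (1 : Fin (k + 1))]

/-- A rotated reversal is a reflection `i ↦ c - i` of the cyclic group. If `c = 2q`, invariance
gives `v (q + 1) = v (q - 1)`, a backtrack; if `c = 2q + 1`, it gives `v q = v (q + 1)`,
contradicting adjacency. -/
theorem IsCyclicPath.ne_rotate_reverse {v : Fin (k + 1) → V} (hv : IsCyclicPath G v) (j : ℕ) :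
    List.ofFn v ≠ (List.ofFn v).reverse.rotate j := by
  intro h
  rw [reverse_ofFn, rotate_ofFn] at h
  have h1 : ∀ i, v i = v (Fin.last k - (i + Fin.ofNat (k + 1) j)) := fun i => by
    rw [Fin.last_sub]
    exact congrFun (List.ofFn_injective h) i
  obtain ⟨c, hc⟩ : ∃ c, Fin.last k - Fin.ofNat (k + 1) j = c := ⟨_, rfl⟩
  have h2 : ∀ i, v i = v (c - i) := fun i => by
    rw [h1 i, ← hc]; congr 1; abel
  rcases Nat.even_or_odd' c.val with ⟨q, hq | hq⟩
  · have hc' : c = Fin.ofNat (k + 1) q + Fin.ofNat (k + 1) q := by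
      rw [← finOfNat_add, ← two_mul, ← hq, finOfNat_val]
    have h3 := h2 (Fin.ofNat (k + 1) q + 1)
    refine (hv (Fin.ofNat (k + 1) q - 1)).2 ?_
    rw [sub_add_cancel, h3, hc']
    congr 1; abel
  · have hc' : c = Fin.ofNat (k + 1) q + Fin.ofNat (k + 1) q + 1 := by
      rw [← finOfNat_add, ← two_mul, ← finOfNat_succ, ← hq, finOfNat_val]
    have h3 := h2 (Fin.ofNat (k + 1) q)
    refine (hv (Fin.ofNat (k + 1) q)).1.ne ?_
    rw [h3, hc']
    congr 1; abel

end Traces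

/-! ### Loops as representatives of closed paths up to rotation and reversal. -/

section Orbits

open scoped Classical

open Finset Function Complex

variable {V : Type*} [Fintype V] {G : SimpleGraph V} {p : V → ℂ}
  {R : Type*} [CommRing R] [Algebra ℂ R]

theorem IsClosedPath.exists_ofFn {l : List V} (hl : IsClosedPath G l) :
    ∃ (k : ℕ) (v : Fin (k + 1) → V), l = List.ofFn v ∧ IsCyclicPath G v := by
  obtain ⟨k, hk⟩ : ∃ k, l.length = k + 1 := ⟨l.length - 1, by have := hl.1; omega⟩
  have h : l = List.ofFn fun i : Fin (k + 1) => l[i]'(by omega) :=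
    List.ext_getElem (by simp [hk]) fun i h1 h2 => by
      rw [List.getElem_ofFn]; rfl
  refine ⟨k, _, h, ?_⟩
  rw [← isClosedPath_ofFn_iff, ← h]
  exact hl

theorem IsClosedPath.rotate {l : List V} (hl : IsClosedPath G l) (j : ℕ) :
    IsClosedPath G (l.rotate j) :=
  ⟨by rw [List.length_rotate]; exact hl.1, fun i => by rw [List.rotate_rotate]; exact hl.2 _⟩

theorem IsClosedPath.reverse {l : List V} (hl : IsClosedPath G l) : IsClosedPath G l.reverse := by
  obtain ⟨k, v, rfl, hv⟩ := hl.exists_ofFn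
  rw [reverse_ofFn, isClosedPath_ofFn_iff]
  intro i
  have h1 := hv (i + 1).rev
  have h2 := hv (i + 1 + 1).rev
  rw [rev_add_one_add_one] at h1
  rw [rev_add_one_add_one, rev_add_one_add_one] at h2
  exact ⟨h1.1.symm, h2.2.symm⟩

theorem IsClosedPath.pathWeight_rotate (y : Sym2 V → R) {l : List V} (hl : IsClosedPath G l)
    (j : ℕ) : pathWeight p y (l.rotate j) = pathWeight p y l := by
  obtain ⟨k, v, rfl, hv⟩ := hl.exists_ofFn
  exact SignedLoops.pathWeight_rotate y v j

theorem IsClosedPath.pathWeight_reverse (hp : IsStraightDrawing G p) (y : Sym2 V → R) {l : List V}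
    (hl : IsClosedPath G l) : pathWeight p y l.reverse = pathWeight p y l := by
  obtain ⟨k, v, rfl, hv⟩ := hl.exists_ofFn
  exact SignedLoops.pathWeight_reverse hp y hv

theorem IsClosedPath.ne_rotate_reverse {l : List V} (hl : IsClosedPath G l) (j : ℕ) :
    l ≠ l.reverse.rotate j := by
  obtain ⟨k, v, rfl, hv⟩ := hl.exists_ofFn
  exact hv.ne_rotate_reverse j

/-- Two cyclic sequences that agree up to rotation and reversal. -/
def CyclicRel (l l' : List V) : Prop := ∃ j, l' = l.rotate j ∨ l' = l.reverse.rotate j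

theorem exists_eq_rotate_of_eq_rotate {l l' : List V} {j : ℕ} (h : l' = l.rotate j) :
    ∃ i, l = l'.rotate i := by
  have : l ~r l' := ⟨j, h.symm⟩
  obtain ⟨i, hi⟩ := this.symm
  exact ⟨i, hi.symm⟩

theorem exists_reverse_rotate (l : List V) (j : ℕ) : ∃ i, (l.rotate j).reverse = l.reverse.rotate i :=
  ⟨_, List.reverse_rotate l j⟩

theorem exists_rotate_reverse (l : List V) (j : ℕ) : ∃ i, l.reverse.rotate j = (l.rotate i).reverse :=
  ⟨_, List.rotate_reverse l j⟩

theorem CyclicRel.symm {l l' : List V} (h : CyclicRel l l') : CyclicRel l' l := by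
  obtain ⟨j, h | h⟩ := h
  · obtain ⟨i, hi⟩ := exists_eq_rotate_of_eq_rotate h
    exact ⟨i, Or.inl hi⟩
  · obtain ⟨i, hi⟩ := exists_eq_rotate_of_eq_rotate h
    obtain ⟨m, hm⟩ := exists_reverse_rotate l' i
    exact ⟨m, Or.inr (by rw [← hm, ← hi, List.reverse_reverse])⟩

theorem CyclicRel.trans {l l' l'' : List V} (h : CyclicRel l l') (h' : CyclicRel l' l'') :
    CyclicRel l l'' := by
  obtain ⟨j, rfl | rfl⟩ := h <;> obtain ⟨i, rfl | rfl⟩ := h'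
  · exact ⟨j + i, Or.inl (List.rotate_rotate _ _ _)⟩
  · obtain ⟨m, hm⟩ := exists_reverse_rotate l j
    exact ⟨m + i, Or.inr (by rw [hm, List.rotate_rotate])⟩
  · exact ⟨j + i, Or.inr (List.rotate_rotate _ _ _)⟩
  · obtain ⟨m, hm⟩ := exists_reverse_rotate l.reverse j
    exact ⟨m + i, Or.inl (by rw [hm, List.reverse_reverse, List.rotate_rotate])⟩

theorem isLoop_iff {l : List V} :
    IsLoop G p l ↔ IsClosedPath G l ∧ ∀ l', CyclicRel l l' → LexLE p l l' := by
  refine and_congr_right fun _ => ⟨?_, ?_⟩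
  · rintro h l' ⟨j, rfl | rfl⟩
    · exact (h j).1
    · exact (h j).2
  · intro h j
    exact ⟨h _ ⟨j, Or.inl rfl⟩, h _ ⟨j, Or.inr rfl⟩⟩

theorem coord_injective (hp : Injective p) : Injective (coord p) := by
  intro u v h
  have h' := toLex.injective h
  rw [Prod.mk.injEq] at h'
  exact hp (Complex.ext h'.1 h'.2)

theorem LexLE.antisymm (hp : Injective p) {l l' : List V} (h : LexLE p l l') (h' : LexLE p l' l) :
    l = l' :=
  (List.map_injective_iff.2 (coord_injective hp)) (le_antisymm h h')

theorem CyclicRel.length_eq {l l' : List V} (h : CyclicRel l l') : l'.length = l.length := by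
  obtain ⟨j, rfl | rfl⟩ := h <;> simp

theorem CyclicRel.isClosedPath {l l' : List V} (h : CyclicRel l l') (hl : IsClosedPath G l) :
    IsClosedPath G l' := by
  obtain ⟨j, rfl | rfl⟩ := h
  · exact hl.rotate j
  · exact hl.reverse.rotate j

theorem CyclicRel.refl (l : List V) : CyclicRel l l := ⟨0, Or.inl (List.rotate_zero l).symm⟩

/-- The closed paths of `n` steps. -/
def closedPaths (G : SimpleGraph V) (n : ℕ) : Finset (List V) :=
  {l ∈ (List.finite_length_eq V n).toFinset | IsClosedPath G l}

/-- The loops of `n` steps. -/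
def loopsOfLength (G : SimpleGraph V) (p : V → ℂ) (n : ℕ) : Finset (List V) :=
  {l ∈ (List.finite_length_eq V n).toFinset | IsLoop G p l}

theorem mem_closedPaths {n : ℕ} {l : List V} :
    l ∈ closedPaths G n ↔ l.length = n ∧ IsClosedPath G l := by
  simp [closedPaths]

theorem mem_loopsOfLength {n : ℕ} {l : List V} :
    l ∈ loopsOfLength G p n ↔ l.length = n ∧ IsLoop G p l := by
  simp [loopsOfLength]

theorem IsClosedPath.exists_isLoop {l : List V} (hl : IsClosedPath G l) :
    ∃ l', CyclicRel l l' ∧ IsLoop G p l' := by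
  let S : Finset (List V) := {l' ∈ closedPaths G l.length | CyclicRel l l'}
  have hS : S.Nonempty := ⟨l, mem_filter.2 ⟨mem_closedPaths.2 ⟨rfl, hl⟩, CyclicRel.refl l⟩⟩
  obtain ⟨l', hl', hmin⟩ := S.exists_min_image (fun l' => l'.map (coord p)) hS
  obtain ⟨h1, h2⟩ := mem_filter.1 hl'
  refine ⟨l', h2, isLoop_iff.2 ⟨(mem_closedPaths.1 h1).2, fun l'' h3 => ?_⟩⟩
  have h4 := h2.trans h3
  exact hmin l'' (mem_filter.2 ⟨mem_closedPaths.2 ⟨h4.length_eq, h4.isClosedPath hl⟩, h4⟩)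

theorem trace_kacWardMatrix_pow_eq_sum_closedPaths (y : Sym2 V → R) (k : ℕ) :
    (kacWardMatrix G p y ^ (k + 1)).trace = ∑ l ∈ closedPaths G (k + 1), pathWeight p y l := by
  rw [trace_kacWardMatrix_pow_eq_sum]
  refine sum_bij (fun v _ => List.ofFn v) ?_ (fun v _ v' _ h => List.ofFn_injective h) ?_
    (fun _ _ => rfl)
  · intro v hv
    exact mem_closedPaths.2 ⟨by simp, (isClosedPath_ofFn_iff v).2 (mem_filter.1 hv).2⟩
  · intro l hl
    obtain ⟨h1, h2⟩ := mem_closedPaths.1 hl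
    obtain ⟨k', v, rfl, hv⟩ := h2.exists_ofFn
    rw [List.length_ofFn] at h1
    obtain rfl : k' = k := by omega
    exact ⟨v, mem_filter.2 ⟨mem_univ _, hv⟩, rfl⟩

/-- The smallest period of a cyclic sequence. -/
def period (l : List V) : ℕ := minimalPeriod (fun l' : List V => l'.rotate 1) l

theorem iterate_rotate_one (l : List V) (j : ℕ) :
    (fun l' : List V => l'.rotate 1)^[j] l = l.rotate j := by
  induction j with
  | zero => simp
  | succ j ih => rw [iterate_succ_apply', ih, List.rotate_rotate]

theorem period_dvd_length (l : List V) : period l ∣ l.length := by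
  refine IsPeriodicPt.minimalPeriod_dvd ?_
  rw [IsPeriodicPt, IsFixedPt, iterate_rotate_one, List.rotate_length]

theorem period_pos {l : List V} (hl : l ≠ []) : 0 < period l :=
  Nat.pos_of_dvd_of_pos (period_dvd_length l) (List.length_pos_iff.2 hl)

theorem exists_lt_period_rotate_eq {l : List V} (hl : l ≠ []) (j : ℕ) :
    ∃ i < period l, l.rotate j = l.rotate i := by
  refine ⟨j % period l, Nat.mod_lt _ (period_pos hl), ?_⟩
  rw [← iterate_rotate_one, ← iterate_rotate_one, period, iterate_mod_minimalPeriod_eq]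

theorem rotate_injOn_lt_period {l : List V} {i j : ℕ} (hi : i < period l) (hj : j < period l)
    (h : l.rotate i = l.rotate j) : i = j := by
  rw [← iterate_rotate_one, ← iterate_rotate_one] at h
  exact iterate_injOn_Iio_minimalPeriod hi hj h

/-- The closed path obtained from a loop by a rotation, and possibly a reversal. -/
def orbitMap (q : (_ : List V) × ℕ × Bool) : List V :=
  if q.2.2 then (q.1.rotate q.2.1).reverse else q.1.rotate q.2.1

theorem cyclicRel_orbitMap (q : (_ : List V) × ℕ × Bool) : CyclicRel q.1 (orbitMap q) := by
  obtain ⟨l, j, b⟩ := q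
  cases b
  · exact ⟨j, Or.inl rfl⟩
  · obtain ⟨i, hi⟩ := exists_reverse_rotate l j
    exact ⟨i, Or.inr hi⟩

/-- Every class contains exactly one loop, its lexicographic minimum. It has `period l` distinct
rotations and as many reversed ones, disjoint by `ne_rotate_reverse`, all of the same weight. -/
theorem sum_closedPaths_eq (hp : IsStraightDrawing G p) (y : Sym2 V → R) (n : ℕ) :
    ∑ l ∈ closedPaths G n, pathWeight p y l =
      ∑ l ∈ loopsOfLength G p n, (2 * period l) * pathWeight p y l := by
  have h1 : ∀ l ∈ loopsOfLength G p n, (2 * period l : R) * pathWeight p y l =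
      ∑ q ∈ range (period l) ×ˢ (univ : Finset Bool), pathWeight p y (orbitMap ⟨l, q⟩) := by
    intro l hl
    have hc := (isLoop_iff.1 (mem_loopsOfLength.1 hl).2).1
    have h2 : ∀ q ∈ range (period l) ×ˢ (univ : Finset Bool),
        pathWeight p y (orbitMap ⟨l, q⟩) = pathWeight p y l := by
      rintro ⟨j, b⟩ -
      cases b
      · exact hc.pathWeight_rotate y j
      · exact ((hc.rotate j).pathWeight_reverse hp y).trans (hc.pathWeight_rotate y j)
    rw [sum_congr rfl h2, sum_const, card_product, card_range, card_univ, Fintype.card_bool,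
      nsmul_eq_mul]
    push_cast
    ring
  rw [sum_congr rfl h1, sum_sigma']
  symm
  refine sum_bij (fun q _ => orbitMap q) ?_ ?_ ?_ (fun _ _ => rfl)
  · intro q hq
    obtain ⟨h2, h3⟩ := mem_sigma.1 hq
    obtain ⟨h4, h5⟩ := mem_loopsOfLength.1 h2
    exact mem_closedPaths.2 ⟨(cyclicRel_orbitMap q).length_eq.trans h4,
      (cyclicRel_orbitMap q).isClosedPath h5.1⟩
  · rintro ⟨l, j, b⟩ hq ⟨l', j', b'⟩ hq' heq
    obtain ⟨h2, h3⟩ := mem_sigma.1 hq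
    obtain ⟨h2', h3'⟩ := mem_sigma.1 hq'
    obtain ⟨-, h5⟩ := mem_loopsOfLength.1 h2
    obtain ⟨-, h5'⟩ := mem_loopsOfLength.1 h2'
    have hrel : CyclicRel l l' := by
      have := cyclicRel_orbitMap ⟨l, j, b⟩
      rw [heq] at this
      exact this.trans (cyclicRel_orbitMap ⟨l', j', b'⟩).symm
    obtain rfl : l = l' := LexLE.antisymm hp.injective ((isLoop_iff.1 h5).2 _ hrel)
      ((isLoop_iff.1 h5').2 _ hrel.symm)
    have hj := mem_range.1 (mem_product.1 h3).1
    have hj' := mem_range.1 (mem_product.1 h3').1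
    simp only at hj hj'
    have key : ∀ i i', l.rotate i ≠ (l.rotate i').reverse := by
      intro i i' h
      obtain ⟨m, hm⟩ := exists_reverse_rotate l i'
      obtain ⟨m', hm'⟩ := exists_eq_rotate_of_eq_rotate (rfl : l.rotate i = l.rotate i)
      refine h5.1.ne_rotate_reverse (m + m') ?_
      rw [← List.rotate_rotate, ← hm, ← h, ← hm']
    simp only [orbitMap] at heq
    cases b <;> cases b' <;> simp only [if_true, Bool.false_eq_true, if_false] at heq
    · rw [rotate_injOn_lt_period hj hj' heq]
    · exact absurd heq (key _ _)
    · exact absurd heq.symm (key _ _)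
    · rw [rotate_injOn_lt_period hj hj' (List.reverse_injective heq)]
  · intro l hl
    obtain ⟨h2, h3⟩ := mem_closedPaths.1 hl
    obtain ⟨l', hrel, hl'⟩ := h3.exists_isLoop (p := p)
    have hne : l' ≠ [] := by
      have := hl'.1.1
      rintro rfl; simp at this
    have hmem : l' ∈ loopsOfLength G p n := mem_loopsOfLength.2 ⟨hrel.length_eq.trans h2, hl'⟩
    obtain ⟨j, h | h⟩ := hrel.symm
    · obtain ⟨i, hi, h4⟩ := exists_lt_period_rotate_eq hne j
      exact ⟨⟨l', i, false⟩, by simp [hmem, hi], by rw [h, h4]; rfl⟩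
    · obtain ⟨m, hm⟩ := exists_rotate_reverse l' j
      obtain ⟨i, hi, h4⟩ := exists_lt_period_rotate_eq hne m
      exact ⟨⟨l', i, true⟩, by simp [hmem, hi], by rw [h, hm, h4]; rfl⟩

end Orbits

/-! ### The exponential formula relating loops and even subgraphs. -/

section Configurations

open scoped Classical Nat

open Finset Function Complex

variable {V : Type*} [Fintype V] {G : SimpleGraph V} {p : V → ℂ}
  {R : Type*} [CommRing R] [Algebra ℂ R]

/-- The scalar factor of the weight of a loop. -/
def loopCoeff (p : V → ℂ) (l : List V) : ℂ := loopSign p l / (multiplicity l : ℂ)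

/-- The weight of a loop, with edge weights in an algebra. -/
def algLoopWeight (p : V → ℂ) (y : Sym2 V → R) (l : List V) : R :=
  algebraMap ℂ R (loopCoeff p l) * ((loopEdges l).map y).prod

/-- The total weight of the loops of `n` steps. -/
def loopSum (G : SimpleGraph V) (p : V → ℂ) (y : Sym2 V → R) (n : ℕ) : R :=
  ∑ l ∈ loopsOfLength G p n, algLoopWeight p y l

/-- Length is multiplicity times period, so the denominator in the loop weight turns the orbit size
of a loop into its number of steps. -/
theorem length_mul_loopCoeff {l : List V} (hl : l ≠ []) :
    (l.length : ℂ) * loopCoeff p l = -(period l * exp (I / 2 * windingAngle p l)) := by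
  have h1 : (l.length : ℂ) = multiplicity l * period l := by
    rw [multiplicity, ← period, ← Nat.cast_mul, Nat.div_mul_cancel (period_dvd_length l)]
  have h2 : (multiplicity l : ℂ) ≠ 0 := by
    intro h
    rw [h, zero_mul, Nat.cast_eq_zero] at h1
    exact hl (List.length_eq_zero_iff.1 h1)
  rw [h1, loopCoeff, loopSign]
  field_simp

theorem trace_kacWardMatrix_pow_eq_loopSum (hp : IsStraightDrawing G p) (y : Sym2 V → R) (k : ℕ) :
    (kacWardMatrix G p y ^ (k + 1)).trace = -(2 * ((k + 1 : ℕ) : R)) * loopSum G p y (k + 1) := by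
  rw [trace_kacWardMatrix_pow_eq_sum_closedPaths, sum_closedPaths_eq hp, loopSum, mul_sum]
  refine sum_congr rfl fun l hl => ?_
  obtain ⟨h1, -⟩ := mem_loopsOfLength.1 hl
  have hne : l ≠ [] := by rintro rfl; simp at h1
  have h2 := congrArg (algebraMap ℂ R) (length_mul_loopCoeff (p := p) hne)
  rw [h1, map_mul, map_natCast, map_neg, map_mul, map_natCast] at h2
  rw [algLoopWeight, pathWeight]
  linear_combination (2 * ((loopEdges l).map y).prod) * h2

/-- The Newton identities divided by -2: the coefficients of Z' = L'Z. -/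
theorem succ_mul_evenGenFunDeg (hp : IsStraightDrawing G p) [IsDomain R] [CharZero R]
    (y : Sym2 V → R) (n : ℕ) :
    ((n + 1 : ℕ) : R) * evenGenFunDeg G p y (n + 1) = ∑ j ∈ range (n + 1),
      (((j + 1 : ℕ) : R) * loopSum G p y (j + 1)) * evenGenFunDeg G p y (n - j) := by
  have h := evenGenFunDeg_newton hp y (n + 1)
  have h2 : (-2 : R) ≠ 0 := by simp
  apply mul_left_cancel₀ h2
  rw [mul_sum]
  calc _ = -(2 * ((n + 1 : ℕ) : R)) * evenGenFunDeg G p y (n + 1) := by ring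
    _ = _ := h
    _ = _ := by
      refine sum_congr rfl fun j _ => ?_
      rw [trace_kacWardMatrix_pow_eq_loopSum hp, Nat.add_sub_add_right]
      ring

theorem evenGenFunDeg_zero (y : Sym2 V → R) : evenGenFunDeg G p y 0 = 1 := by
  unfold evenGenFunDeg
  have : ({F | ((∀ e ∈ F, e ∈ G.edgeSet) ∧ IsEvenEdgeSet F) ∧ #F = 0} :
      Finset (Finset (Sym2 V))) = {∅} := by
    ext F
    simp only [mem_filter, mem_univ, true_and, mem_singleton, card_eq_zero]
    constructor
    · exact fun h => h.2
    · rintro rfl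
      simp [IsEvenEdgeSet]
  rw [this, sum_singleton, crossingNumber, powersetCard_eq_empty.2 (by simp)]
  simp

/-- The generating series of loops by number of steps. -/
def loopSeries (G : SimpleGraph V) (p : V → ℂ) (y : Sym2 V → R) : PowerSeries R :=
  PowerSeries.mk (loopSum G p y)

theorem loopSum_zero (y : Sym2 V → R) : loopSum G p y 0 = 0 := by
  refine sum_eq_zero fun l hl => ?_
  obtain ⟨h1, h2⟩ := mem_loopsOfLength.1 hl
  have := h2.1.1
  omega

theorem coeff_loopSeries_pow_eq_zero (y : Sym2 V → R) {n s : ℕ} (h : n < s) :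
    PowerSeries.coeff n (loopSeries G p y ^ s) = 0 := by
  have h1 : PowerSeries.X ∣ loopSeries G p y := by
    rw [PowerSeries.X_dvd_iff, ← PowerSeries.coeff_zero_eq_constantCoeff_apply, loopSeries,
      PowerSeries.coeff_mk, loopSum_zero]
  exact PowerSeries.X_pow_dvd_iff.1 (pow_dvd_pow_of_dvd h1 s) n h

/-- The coefficients of the exponential of the loop series. -/
def expLoopSum (G : SimpleGraph V) (p : V → ℂ) (y : Sym2 V → R) (n : ℕ) : R :=
  ∑ s ∈ range (n + 1),
    algebraMap ℂ R (1 / (s ! : ℂ)) * PowerSeries.coeff n (loopSeries G p y ^ s)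

theorem expLoopSum_eq (y : Sym2 V → R) {n N : ℕ} (h : n ≤ N) :
    expLoopSum G p y n = ∑ s ∈ range (N + 1),
      algebraMap ℂ R (1 / (s ! : ℂ)) * PowerSeries.coeff n (loopSeries G p y ^ s) := by
  refine sum_subset (range_mono (by omega)) fun s _ hs => ?_
  rw [coeff_loopSeries_pow_eq_zero y (by simpa using hs), mul_zero]

/-- This is (exp L)' = L' exp L, obtained termwise from the derivative of L^(s+1). -/
theorem succ_mul_expLoopSum (y : Sym2 V → R) (n : ℕ) :
    ((n + 1 : ℕ) : R) * expLoopSum G p y (n + 1) = ∑ j ∈ range (n + 1),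
      (((j + 1 : ℕ) : R) * loopSum G p y (j + 1)) * expLoopSum G p y (n - j) := by
  have hder : ∀ s, ((n + 1 : ℕ) : R) * PowerSeries.coeff (n + 1) (loopSeries G p y ^ (s + 1)) =
      ((s + 1 : ℕ) : R) * ∑ j ∈ range (n + 1), (((j + 1 : ℕ) : R) * loopSum G p y (j + 1)) *
        PowerSeries.coeff (n - j) (loopSeries G p y ^ s) := by
    intro s
    have h1 := PowerSeries.coeff_derivative (loopSeries G p y ^ (s + 1)) n
    rw [Derivation.leibniz_pow, Nat.add_sub_cancel, smul_eq_mul, mul_comm (_ ^ s), map_nsmul,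
      nsmul_eq_mul, PowerSeries.coeff_mul, Nat.sum_antidiagonal_eq_sum_range_succ_mk] at h1
    rw [mul_comm, Nat.cast_succ, ← h1]
    congr 1
    refine sum_congr rfl fun j _ => ?_
    rw [PowerSeries.coeff_derivative, loopSeries, PowerSeries.coeff_mk, Nat.cast_succ,
      mul_comm (loopSum G p y (j + 1))]
  rw [expLoopSum, sum_range_succ', mul_add, mul_sum]
  have h0 : PowerSeries.coeff (n + 1) (loopSeries G p y ^ 0) = 0 := by
    rw [pow_zero, PowerSeries.coeff_one, if_neg (by omega)]
  rw [h0, mul_zero, mul_zero, add_zero]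
  have h2 : ∀ j ∈ range (n + 1), (((j + 1 : ℕ) : R) * loopSum G p y (j + 1)) *
      expLoopSum G p y (n - j) = ∑ s ∈ range (n + 1), (((j + 1 : ℕ) : R) * loopSum G p y (j + 1)) *
        (algebraMap ℂ R (1 / (s ! : ℂ)) * PowerSeries.coeff (n - j) (loopSeries G p y ^ s)) := by
    intro j _
    rw [expLoopSum_eq y (Nat.sub_le n j), mul_sum]
  rw [sum_congr rfl h2, sum_comm]
  refine sum_congr rfl fun s _ => ?_
  have h3 : algebraMap ℂ R (1 / ((s + 1)! : ℂ)) * ((s + 1 : ℕ) : R) = algebraMap ℂ R (1 / (s ! : ℂ)) := by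
    rw [← map_natCast (algebraMap ℂ R) (s + 1), ← map_mul]
    congr 1
    rw [Nat.factorial_succ]
    have : (s ! : ℂ) ≠ 0 := by exact_mod_cast s.factorial_ne_zero
    push_cast
    have : (s + 1 : ℂ) ≠ 0 := by exact_mod_cast s.succ_ne_zero
    field_simp
  calc _ = algebraMap ℂ R (1 / ((s + 1)! : ℂ)) *
        (((n + 1 : ℕ) : R) * PowerSeries.coeff (n + 1) (loopSeries G p y ^ (s + 1))) := by ring
    _ = _ := by
      rw [hder, ← mul_assoc, h3, mul_sum]
      exact sum_congr rfl fun j _ => by ring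

/-- Both sequences start at 1 and satisfy the same recursion. -/
theorem expLoopSum_eq_evenGenFunDeg (hp : IsStraightDrawing G p) [IsDomain R] [CharZero R]
    (y : Sym2 V → R) (n : ℕ) : expLoopSum G p y n = evenGenFunDeg G p y n := by
  induction n using Nat.strong_induction_on with
  | _ n ih =>
    cases n with
    | zero => simp [expLoopSum, evenGenFunDeg_zero]
    | succ n =>
      have h : ((n + 1 : ℕ) : R) ≠ 0 := Nat.cast_ne_zero.2 n.succ_ne_zero
      apply mul_left_cancel₀ h
      rw [succ_mul_expLoopSum, succ_mul_evenGenFunDeg hp]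
      exact sum_congr rfl fun j _ => by rw [ih (n - j) (by omega)]

/-- The configurations of `s` loops with a total of `n` steps. -/
def configFinset (G : SimpleGraph V) (p : V → ℂ) : ℕ → ℕ → Finset (List (List V))
  | 0, n => if n = 0 then {[]} else ∅
  | s + 1, n => (antidiagonal n).biUnion fun ij =>
      (loopsOfLength G p ij.1 ×ˢ configFinset G p s ij.2).image fun q => q.1 :: q.2

theorem mem_configFinset {s n : ℕ} {c : List (List V)} : c ∈ configFinset G p s n ↔
    c.length = s ∧ (∀ l ∈ c, IsLoop G p l) ∧ (c.map List.length).sum = n := by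
  induction s generalizing n c with
  | zero =>
    rw [configFinset, List.length_eq_zero_iff]
    split_ifs with h
    · subst h
      rw [mem_singleton]
      constructor
      · rintro rfl; simp
      · exact fun h => h.1
    · simp only [notMem_empty, false_iff]
      rintro ⟨rfl, -, h'⟩
      exact h h'.symm
  | succ s ih =>
    simp only [configFinset, mem_biUnion, HasAntidiagonal.mem_antidiagonal, mem_image, mem_product, Prod.exists, ih,
      mem_loopsOfLength]
    constructor
    · rintro ⟨i, j, rfl, l, c', ⟨⟨rfl, h1⟩, rfl, h2, rfl⟩, rfl⟩
      simpa [h1] using h2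
    · rintro ⟨h1, h2, rfl⟩
      cases c with
      | nil => simp at h1
      | cons l c =>
        simp only [List.mem_cons, forall_eq_or_imp] at h2
        exact ⟨l.length, (c.map List.length).sum, by simp, l, c,
          ⟨⟨rfl, h2.1⟩, by simpa using h1, h2.2, rfl⟩, rfl⟩

theorem coeff_loopSeries_pow (y : Sym2 V → R) (s n : ℕ) :
    PowerSeries.coeff n (loopSeries G p y ^ s) =
      ∑ c ∈ configFinset G p s n, (c.map (algLoopWeight p y)).prod := by
  induction s generalizing n with
  | zero =>
    rw [pow_zero, PowerSeries.coeff_one, configFinset]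
    split_ifs <;> simp
  | succ s ih =>
    rw [pow_succ', PowerSeries.coeff_mul, configFinset, sum_biUnion]
    · refine sum_congr rfl fun ij _ => ?_
      rw [sum_image (by rintro ⟨l, c⟩ _ ⟨l', c'⟩ _ h; simpa using h), sum_product, ih, loopSeries,
        PowerSeries.coeff_mk, loopSum, sum_mul]
      refine sum_congr rfl fun l _ => ?_
      simp [mul_sum]
    · intro ij hij ij' hij' hne
      refine disjoint_left.2 fun c hc hc' => hne ?_
      obtain ⟨⟨l, c⟩, h1, rfl⟩ := mem_image.1 hc
      obtain ⟨⟨l', c'⟩, h2, h3⟩ := mem_image.1 hc'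
      simp only [List.cons.injEq] at h3
      obtain ⟨rfl, rfl⟩ := h3
      have e1 := (mem_loopsOfLength.1 (mem_product.1 h1).1).1
      have e2 := (mem_loopsOfLength.1 (mem_product.1 h2).1).1
      have e3 := HasAntidiagonal.mem_antidiagonal.1 hij
      have e4 := HasAntidiagonal.mem_antidiagonal.1 hij'
      simp only at e1 e2
      ext <;> omega

end Configurations

/-! ### Comparing coefficients: cancellation for each edge multiset. -/

section EdgeMultisets

open scoped Classical Nat

open Finset Function Complex

variable {V : Type*} [Fintype V] {G : SimpleGraph V} {p : V → ℂ} {EA : Set (Sym2 V)}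

/-- The edges traversed by the loops of a configuration, with multiplicity. -/
def configEdges (c : List (List V)) : Multiset (Sym2 V) := ((c.map loopEdges).flatten : List (Sym2 V))

theorem configEdges_cons (l : List V) (c : List (List V)) :
    configEdges (l :: c) = (loopEdges l : Multiset (Sym2 V)) + configEdges c := by
  simp [configEdges]

theorem length_loopEdges (l : List V) : (loopEdges l).length = l.length := by
  simp [loopEdges]

theorem card_configEdges (c : List (List V)) :
    Multiset.card (configEdges c) = (c.map List.length).sum := by
  induction c with
  | nil => rfl
  | cons l c ih => simp [configEdges_cons, ih, length_loopEdges]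

theorem countP_configEdges (EA : Set (Sym2 V)) (c : List (List V)) :
    (configEdges c).countP (· ∉ EA) = (c.map (loopLength EA)).sum := by
  induction c with
  | nil => rfl
  | cons l c ih => simp [configEdges_cons, ih, loopLength]

theorem length_le_card_configEdges {c : List (List V)} (hc : ∀ l ∈ c, IsLoop G p l) :
    c.length ≤ Multiset.card (configEdges c) := by
  rw [card_configEdges]
  have := List.length_le_sum_of_one_le (c.map List.length) fun n hn => by
    obtain ⟨l, hl, rfl⟩ := List.mem_map.1 hn
    have := (hc l hl).1.1
    omega
  simpa using this

theorem isEdgeDisjointConfig_iff {c : List (List V)} :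
    IsEdgeDisjointConfig c ↔ (configEdges c).Nodup := by
  rw [configEdges, Multiset.coe_nodup, List.nodup_flatten, List.pairwise_map, IsEdgeDisjointConfig]
  simp

theorem prod_map_X_eq_monomial (m : Multiset (Sym2 V)) :
    (m.map (MvPolynomial.X (R := ℂ))).prod = MvPolynomial.monomial (Multiset.toFinsupp m) 1 := by
  induction m using Multiset.induction with
  | empty => simp
  | cons e m ih =>
    rw [Multiset.map_cons, Multiset.prod_cons, ih, ← Multiset.singleton_add, map_add,
      Multiset.toFinsupp_singleton, MvPolynomial.X, MvPolynomial.monomial_mul, one_mul]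

theorem prod_algLoopWeight_X (c : List (List V)) :
    (c.map (algLoopWeight p (MvPolynomial.X (R := ℂ)))).prod =
      MvPolynomial.monomial (Multiset.toFinsupp (configEdges c)) (c.map (loopCoeff p)).prod := by
  induction c with
  | nil => simp [configEdges]
  | cons l c ih =>
    have h := prod_map_X_eq_monomial (loopEdges l : Multiset (Sym2 V))
    rw [Multiset.map_coe, Multiset.prod_coe] at h
    rw [List.map_cons, List.prod_cons, ih, algLoopWeight, h, configEdges_cons, map_add,
      MvPolynomial.algebraMap_eq, MvPolynomial.C_mul_monomial, MvPolynomial.monomial_mul, mul_one,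
      List.map_cons, List.prod_cons]

/-- The loop configurations traversing a given multiset of edges. -/
def configFiber (G : SimpleGraph V) (p : V → ℂ) (μ : Multiset (Sym2 V)) : Finset (List (List V)) :=
  ((range (Multiset.card μ + 1)).biUnion fun s => configFinset G p s (Multiset.card μ)).filter
    (configEdges · = μ)

theorem mem_configFiber {μ : Multiset (Sym2 V)} {c : List (List V)} :
    c ∈ configFiber G p μ ↔ (∀ l ∈ c, IsLoop G p l) ∧ configEdges c = μ := by
  simp only [configFiber, mem_filter, mem_biUnion, mem_range, mem_configFinset]
  constructor
  · rintro ⟨⟨s, -, -, h, -⟩, h'⟩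
    exact ⟨h, h'⟩
  · rintro ⟨h, rfl⟩
    have := length_le_card_configEdges h
    exact ⟨⟨c.length, by omega, rfl, h, (card_configEdges c).symm⟩, rfl⟩

/-- The even sets of edges of `G`. -/
def evenEdgeSets (G : SimpleGraph V) : Finset (Finset (Sym2 V)) :=
  {F | (∀ e ∈ F, e ∈ G.edgeSet) ∧ IsEvenEdgeSet F}

/-- The coefficient of the monomial of `μ` in Z = exp(L), with independent variables as edge
weights. The right side has at most one term, and none when `μ` repeats an edge. -/
theorem sum_configFiber (hp : IsStraightDrawing G p) (μ : Multiset (Sym2 V)) :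
    ∑ c ∈ configFiber G p μ, 1 / (c.length ! : ℂ) * (c.map (loopCoeff p)).prod =
      ∑ F ∈ evenEdgeSets G with F.val = μ, (-1) ^ crossingNumber p F := by
  have h := congrArg (MvPolynomial.coeff (Multiset.toFinsupp μ)) (expLoopSum_eq_evenGenFunDeg hp
    (MvPolynomial.X (R := ℂ) (σ := Sym2 V)) (Multiset.card μ))
  have hl : MvPolynomial.coeff (Multiset.toFinsupp μ)
      (expLoopSum G p (MvPolynomial.X (R := ℂ) (σ := Sym2 V)) (Multiset.card μ)) =
      ∑ c ∈ configFiber G p μ, 1 / (c.length ! : ℂ) * (c.map (loopCoeff p)).prod := by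
    rw [configFiber, sum_filter, sum_biUnion, expLoopSum, MvPolynomial.coeff_sum]
    · refine sum_congr rfl fun s _ => ?_
      rw [coeff_loopSeries_pow, MvPolynomial.algebraMap_eq, MvPolynomial.coeff_C_mul,
        MvPolynomial.coeff_sum, mul_sum]
      refine sum_congr rfl fun c hc => ?_
      rw [prod_algLoopWeight_X, MvPolynomial.coeff_monomial, (mem_configFinset.1 hc).1]
      simp only [EmbeddingLike.apply_eq_iff_eq]
      split_ifs <;> simp
    · intro s _ s' _ hne
      refine disjoint_left.2 fun c hc hc' => hne ?_
      rw [← (mem_configFinset.1 hc).1, (mem_configFinset.1 hc').1]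
  have hr : MvPolynomial.coeff (Multiset.toFinsupp μ)
      (evenGenFunDeg G p (MvPolynomial.X (R := ℂ) (σ := Sym2 V)) (Multiset.card μ)) =
      ∑ F ∈ evenEdgeSets G with F.val = μ, (-1) ^ crossingNumber p F := by
    rw [evenGenFunDeg, MvPolynomial.coeff_sum, sum_filter, evenEdgeSets, filter_filter, sum_filter]
    refine sum_congr rfl fun F _ => ?_
    have h1 : MvPolynomial.coeff (Multiset.toFinsupp μ)
        ((-1) ^ crossingNumber p F * ∏ e ∈ F, MvPolynomial.X (R := ℂ) e) =
        if F.val = μ then (-1) ^ crossingNumber p F else 0 := by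
      have h2 : ((-1) ^ crossingNumber p F : MvPolynomial (Sym2 V) ℂ) =
        MvPolynomial.C ((-1) ^ crossingNumber p F) := by simp
      rw [h2, MvPolynomial.coeff_C_mul, Finset.prod, prod_map_X_eq_monomial,
        MvPolynomial.coeff_monomial]
      simp only [EmbeddingLike.apply_eq_iff_eq]
      split_ifs <;> simp
    rw [h1]
    by_cases h2 : F.val = μ
    · have h3 : #F = Multiset.card μ := by rw [← h2]; rfl
      simp [h2, h3]
    · simp [h2]
  rw [← hl, h, hr]

theorem sum_configFiber_val (hp : IsStraightDrawing G p) {F : Finset (Sym2 V)}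
    (hF : F ∈ evenEdgeSets G) :
    ∑ c ∈ configFiber G p F.val, 1 / (c.length ! : ℂ) * (c.map (loopCoeff p)).prod =
      (-1) ^ crossingNumber p F := by
  rw [sum_configFiber hp, show ({F' ∈ evenEdgeSets G | F'.val = F.val}) = {F} from ?_, sum_singleton]
  ext F'
  simp only [mem_filter, mem_singleton, val_inj]
  exact ⟨fun h => h.2, fun h => ⟨h ▸ hF, h⟩⟩

/-- Existence of a loop decomposition without constructing one: the weights in the fiber sum to ±1,
so the fiber is not empty. -/
theorem configFiber_val_nonempty (hp : IsStraightDrawing G p) {F : Finset (Sym2 V)}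
    (hF : F ∈ evenEdgeSets G) : (configFiber G p F.val).Nonempty := by
  by_contra h
  have h1 := sum_configFiber_val hp hF
  rw [not_nonempty_iff_eq_empty.1 h, sum_empty] at h1
  exact pow_ne_zero _ (neg_ne_zero.2 one_ne_zero) h1.symm

theorem prod_loopWeight (x : Sym2 V → ℂ) (c : List (List V)) :
    (c.map (loopWeight p x)).prod = (c.map (loopCoeff p)).prod * ((configEdges c).map x).prod := by
  induction c with
  | nil => simp [configEdges]
  | cons l c ih =>
    rw [List.map_cons, List.prod_cons, ih, configEdges_cons, Multiset.map_add, Multiset.prod_add,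
      List.map_cons, List.prod_cons, Multiset.map_coe, Multiset.prod_coe, loopWeight, loopCoeff]
    ring

theorem configSum_eq_sum (x : Sym2 V → ℂ) (S : Finset (List (List V))) (hS : [] ∉ S) :
    configSum p x S = ∑ c ∈ S, 1 / (c.length ! : ℂ) * (c.map (loopWeight p x)).prod := by
  have h1 : ∀ s : ℕ, ∑ᶠ c ∈ {c ∈ (S : Set (List (List V))) | c.length = s + 1},
      1 / ((s + 1)! : ℂ) * (c.map (loopWeight p x)).prod =
      -- The truncated subtraction would put `[]` together with the one-loop configurations; `hS`
      -- excludes it.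
      ∑ c ∈ S with c.length - 1 = s, 1 / (c.length ! : ℂ) * (c.map (loopWeight p x)).prod := by
    intro s
    have h2 : {c ∈ (S : Set (List (List V))) | c.length = s + 1} =
        ((S.filter fun c => c.length - 1 = s : Finset _) : Set (List (List V))) := by
      ext c
      simp only [Set.mem_ofPred_eq, mem_coe, coe_filter]
      refine and_congr_right fun hc => ?_
      have : c.length ≠ 0 := fun h => hS (List.length_eq_zero_iff.1 h ▸ hc)
      omega
    rw [h2, finsum_mem_coe_finset]
    refine sum_congr rfl fun c hc => ?_
    have h3 := (h2 ▸ mem_coe.2 hc : c ∈ {c ∈ (S : Set (List (List V))) | c.length = s + 1}).2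
    rw [h3]
  rw [configSum, tsum_congr h1, tsum_eq_sum (s := S.image fun c => c.length - 1)]
  · exact sum_fiberwise_of_maps_to (fun c hc => mem_image_of_mem _ hc) _
  · intro s hs
    rw [sum_eq_zero]
    intro c hc
    rw [mem_filter] at hc
    exact (hs (mem_image.2 ⟨c, hc.1, hc.2⟩)).elim

/-- The weight of a family of configurations that is saturated for the edge multiset only involves
the even edge sets. -/
theorem configSum_eq_sum_evenEdgeSets (hp : IsStraightDrawing G p) (x : Sym2 V → ℂ)
    {S : Set (List (List V))} (hfin : S.Finite) (P : Multiset (Sym2 V) → Prop) (hP : ¬ P 0)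
    (hS : ∀ c, c ∈ S ↔ (∀ l ∈ c, IsLoop G p l) ∧ P (configEdges c)) :
    configSum p x S =
      ∑ F ∈ evenEdgeSets G with P F.val, (-1) ^ crossingNumber p F * ∏ e ∈ F, x e := by
  obtain ⟨S, rfl⟩ := hfin.exists_finset_coe
  simp only [mem_coe] at hS
  have hnil : [] ∉ S := fun h => hP ((hS []).1 h).2
  rw [configSum_eq_sum x S hnil]
  have h1 : ∀ F ∈ {F ∈ evenEdgeSets G | P F.val}, F.val ∈ S.image configEdges := by
    intro F hF
    obtain ⟨hF, hPF⟩ := mem_filter.1 hF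
    obtain ⟨c, hc⟩ := configFiber_val_nonempty hp hF
    obtain ⟨hc, hcF⟩ := mem_configFiber.1 hc
    exact mem_image.2 ⟨c, (hS c).2 ⟨hc, hcF ▸ hPF⟩, hcF⟩
  rw [← sum_fiberwise_of_maps_to (g := configEdges) (t := S.image configEdges)
    (fun c hc => mem_image_of_mem _ hc), ← sum_fiberwise_of_maps_to h1]
  refine sum_congr rfl fun μ hμ => ?_
  obtain ⟨c₀, hc₀, rfl⟩ := mem_image.1 hμ
  have hP₀ := ((hS c₀).1 hc₀).2
  have h2 : S.filter (configEdges · = configEdges c₀) = configFiber G p (configEdges c₀) := by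
    ext c
    rw [mem_filter, mem_configFiber, hS]
    constructor
    · exact fun h => ⟨h.1.1, h.2⟩
    · exact fun h => ⟨⟨h.1, h.2 ▸ hP₀⟩, h.2⟩
  have h3 : ({F ∈ {F ∈ evenEdgeSets G | P F.val} | F.val = configEdges c₀}) =
      {F ∈ evenEdgeSets G | F.val = configEdges c₀} := by
    ext F
    simp only [mem_filter]
    constructor
    · exact fun h => ⟨h.1.1, h.2⟩
    · exact fun h => ⟨⟨h.1, h.2 ▸ hP₀⟩, h.2⟩
  rw [h2, h3]
  calc _ = (∑ c ∈ configFiber G p (configEdges c₀),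
        1 / (c.length ! : ℂ) * (c.map (loopCoeff p)).prod) * ((configEdges c₀).map x).prod := by
        rw [sum_mul]
        refine sum_congr rfl fun c hc => ?_
        rw [prod_loopWeight, (mem_configFiber.1 hc).2, mul_assoc]
    _ = _ := by
        rw [sum_configFiber hp, sum_mul]
        refine sum_congr rfl fun F hF => ?_
        rw [← (mem_filter.1 hF).2]
        rfl

end EdgeMultisets

/-! ### Finiteness from the acyclicity of the additional edges, and summation over lengths. -/

section Acyclicity

open scoped Classical

open Finset Function

variable {V : Type*} [Fintype V] {G : SimpleGraph V} {p : V → ℂ} {EA : Set (Sym2 V)}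

theorem exists_walk_of_forall_adj {H : SimpleGraph V} (u : ℕ → V) (n : ℕ)
    (h : ∀ i < n, H.Adj (u i) (u (i + 1))) : ∃ w : H.Walk (u 0) (u n),
      w.length = n ∧ w.edges = (List.range n).map fun i => s(u i, u (i + 1)) := by
  induction n with
  | zero => exact ⟨SimpleGraph.Walk.nil, rfl, rfl⟩
  | succ n ih =>
    obtain ⟨w, h1, h2⟩ := ih fun i hi => h i (by omega)
    refine ⟨w.concat (h n (by omega)), by simp [h1], ?_⟩
    rw [SimpleGraph.Walk.edges_concat, h2, List.range_succ]
    simp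

/-- In an acyclic graph, a non-backtracking walk is shorter than the number of vertices. -/
theorem lt_card_of_isAcyclic {H : SimpleGraph V} (hH : H.IsAcyclic) (u : ℕ → V) (n : ℕ)
    (h : ∀ i < n, H.Adj (u i) (u (i + 1))) (h' : ∀ i, u (i + 1 + 1) ≠ u i) :
    n < Fintype.card V := by
  obtain ⟨w, h1, h2⟩ := exists_walk_of_forall_adj u n h
  rw [← h1]
  refine SimpleGraph.Walk.IsPath.length_lt ((hH.isPath_iff_isChain w).2 ?_)
  rw [h2, List.isChain_map, List.isChain_range]
  intro i hi he
  rcases Sym2.eq_iff.1 he with ⟨h3, -⟩ | ⟨h3, -⟩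
  · exact (h i (by omega)).ne h3
  · exact h' i h3.symm

/-- Otherwise `Fintype.card V` consecutive steps would form a non-backtracking walk in a forest, too
long to be a path. -/
theorem IsCyclicPath.exists_notMem (hacyc : (SimpleGraph.fromEdgeSet EA).IsAcyclic) {k : ℕ}
    {v : Fin (k + 1) → V} (hv : IsCyclicPath G v) (a : ℕ) :
    ∃ i < Fintype.card V, s(v (Fin.ofNat (k + 1) (a + i)), v (Fin.ofNat (k + 1) (a + i) + 1)) ∉ EA := by
  by_contra! h
  refine lt_irrefl _ (lt_card_of_isAcyclic hacyc (fun i => v (Fin.ofNat (k + 1) (a + i)))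
    (Fintype.card V) (fun i hi => ?_) fun i => ?_)
  · rw [← add_assoc, finOfNat_succ, SimpleGraph.fromEdgeSet_adj]
    exact ⟨h i hi, (hv _).1.ne⟩
  · simp only [← add_assoc, finOfNat_succ]
    exact (hv _).2

theorem loopLength_ofFn {k : ℕ} (v : Fin (k + 1) → V) :
    loopLength EA (List.ofFn v) = #{i | s(v i, v (i + 1)) ∉ EA} := by
  rw [loopLength, loopEdges_ofFn, List.ofFn_eq_map, List.countP_map, List.countP_eq_length_filter]
  rfl

theorem IsClosedPath.one_le_loopLength (hacyc : (SimpleGraph.fromEdgeSet EA).IsAcyclic)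
    {l : List V} (hl : IsClosedPath G l) : 1 ≤ loopLength EA l := by
  obtain ⟨k, v, rfl, hv⟩ := hl.exists_ofFn
  obtain ⟨i, -, hi⟩ := hv.exists_notMem hacyc 0
  rw [loopLength_ofFn, Nat.one_le_iff_ne_zero, Ne, card_eq_zero, ← Ne, ← nonempty_iff_ne_empty]
  exact ⟨_, mem_filter.2 ⟨mem_univ _, hi⟩⟩

theorem IsClosedPath.length_le (hacyc : (SimpleGraph.fromEdgeSet EA).IsAcyclic) {l : List V}
    (hl : IsClosedPath G l) : l.length ≤ (loopLength EA l + 1) * Fintype.card V := by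
  obtain ⟨k, v, rfl, hv⟩ := hl.exists_ofFn
  have hN : 0 < Fintype.card V := Fintype.card_pos_iff.2 ⟨v 0⟩
  set N := Fintype.card V
  choose f hf1 hf2 using hv.exists_notMem hacyc
  replace hf1 : ∀ a, f a < N := hf1
  have h1 : (k + 1) / N ≤ loopLength EA (List.ofFn v) := by
    rw [loopLength_ofFn]
    conv_lhs => rw [← card_range ((k + 1) / N)]
    -- The steps are cut into disjoint windows of `N`, and one non-additional step is chosen in
    -- each. Dividing its index by `N` recovers the window.
    refine card_le_card_of_injOn (fun j => Fin.ofNat (k + 1) (N * j + f (N * j)))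
      (fun j _ => by simpa using hf2 (N * j)) fun j hj j' hj' he => ?_
    have hlt : ∀ j ∈ range ((k + 1) / N), N * j + f (N * j) < k + 1 := by
      intro j hj
      have h2 := Nat.mul_le_mul_left N (Nat.succ_le_of_lt (mem_range.1 hj))
      have h3 := Nat.mul_div_le (k + 1) N
      have h4 := hf1 (N * j)
      rw [Nat.mul_succ] at h2
      omega
    have h5 := congrArg Fin.val he
    simp only [Fin.val_ofNat] at h5
    rw [Nat.mod_eq_of_lt (hlt j hj), Nat.mod_eq_of_lt (hlt j' hj')] at h5
    have h6 := congrArg (· / N) h5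
    simpa only [Nat.mul_add_div hN, Nat.div_eq_of_lt (hf1 (N * j)),
      Nat.div_eq_of_lt (hf1 (N * j')), add_zero] using h6
  rw [List.length_ofFn]
  exact (Nat.lt_mul_of_div_lt (Nat.lt_succ_of_le h1) hN).le

/-- Each loop has length at least one, so there are at most `r` loops, and each has a bounded number
of steps. -/
theorem finite_configs (hacyc : (SimpleGraph.fromEdgeSet EA).IsAcyclic) (r : ℕ) :
    (configs G p EA r).Finite := by
  set B := (r + 1) * Fintype.card V
  refine ((range (r + 1)).biUnion fun s => (range (r * B + 1)).biUnion fun n =>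
    configFinset G p s n).finite_toSet.subset ?_
  rintro c ⟨hc, hr⟩
  have h1 : c.length ≤ r := by
    have := List.length_le_sum_of_one_le (c.map (loopLength EA)) fun n hn => by
      obtain ⟨l, hl, rfl⟩ := List.mem_map.1 hn
      exact (hc l hl).1.one_le_loopLength hacyc
    rwa [hr, List.length_map] at this
  have h2 : (c.map List.length).sum ≤ c.length * B := by
    have := List.sum_le_card_nsmul (c.map List.length) B fun n hn => by
      obtain ⟨l, hl, rfl⟩ := List.mem_map.1 hn
      refine ((hc l hl).1.length_le hacyc).trans (Nat.mul_le_mul_right _ (Nat.succ_le_succ ?_))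
      rw [← hr]
      exact List.le_sum_of_mem (List.mem_map_of_mem hl)
    simpa using this
  have h3 := h2.trans (Nat.mul_le_mul_right B h1)
  simp only [coe_biUnion, Set.mem_iUnion, mem_coe, mem_range, mem_configFinset]
  exact ⟨c.length, by omega, _, by omega, rfl, hc, rfl⟩

/-- Both the length and edge-disjointness are conditions on the edge multiset, so the sum reduces to
even edge sets `F` with `F.val` not duplicate-free; there are none. -/
theorem configSum_sdiff_eq_zero (hp : IsStraightDrawing G p)
    (hacyc : (SimpleGraph.fromEdgeSet EA).IsAcyclic) (x : Sym2 V → ℂ) (r : ℕ) :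
    configSum p x (configs G p EA r \ edgeDisjointConfigs G p EA r) = 0 := by
  rw [configSum_eq_sum_evenEdgeSets hp x ((finite_configs hacyc r).subset Set.sdiff_subset)
    (fun μ => μ.countP (· ∉ EA) = r ∧ ¬ μ.Nodup) (by simp)]
  · refine sum_eq_zero fun F hF => ?_
    simp only [mem_filter] at hF
    exact (hF.2.2 F.nodup).elim
  · intro c
    rw [countP_configEdges, ← isEdgeDisjointConfig_iff]
    simp only [configs, edgeDisjointConfigs, Set.mem_sdiff, Set.mem_ofPred_eq]
    tauto

theorem configSum_configs (hp : IsStraightDrawing G p)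
    (hacyc : (SimpleGraph.fromEdgeSet EA).IsAcyclic) (x : Sym2 V → ℂ) {r : ℕ} (hr : 0 < r) :
    configSum p x (configs G p EA r) = ∑ F ∈ evenEdgeSets G with F.val.countP (· ∉ EA) = r,
      (-1) ^ crossingNumber p F * ∏ e ∈ F, x e := by
  refine (configSum_eq_sum_evenEdgeSets hp x (finite_configs hacyc r)
    (fun μ => μ.countP (· ∉ EA) = r) (by simpa using hr.ne) ?_).trans
    (sum_congr (by ext; simp only [mem_filter]) fun _ _ => rfl)
  intro c
  rw [countP_configEdges]
  rfl

/-- A nonempty even set is traversed by some configuration with at least one loop, and every loop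
leaves the additional edges. This identifies the constant term 1. -/
theorem filter_evenEdgeSets_countP_eq_zero (hp : IsStraightDrawing G p)
    (hacyc : (SimpleGraph.fromEdgeSet EA).IsAcyclic) :
    ({F ∈ evenEdgeSets G | F.val.countP (· ∉ EA) = 0}) = {∅} := by
  ext F
  rw [mem_filter, mem_singleton]
  constructor
  · rintro ⟨hF, h0⟩
    obtain ⟨c, hc⟩ := configFiber_val_nonempty hp hF
    obtain ⟨hc, hcF⟩ := mem_configFiber.1 hc
    rw [← hcF, countP_configEdges] at h0
    cases c with
    | nil => exact val_eq_zero.1 hcF.symm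
    | cons l c =>
      have := (hc l (by simp)).1.one_le_loopLength hacyc
      simp only [List.map_cons, List.sum_cons] at h0
      omega
  · rintro rfl
    exact ⟨mem_filter.2 ⟨mem_univ _, by simp [IsEvenEdgeSet]⟩, by simp⟩

theorem hasSum_configSum (hp : IsStraightDrawing G p)
    (hacyc : (SimpleGraph.fromEdgeSet EA).IsAcyclic) (x : Sym2 V → ℂ) :
    HasSum (fun r : ℕ => configSum p x (configs G p EA (r + 1))) (evenGenFun G p x - 1) := by
  set S : Finset (Finset (Sym2 V)) := {F ∈ evenEdgeSets G | ¬ F.val.countP (· ∉ EA) = 0}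
  set g : Finset (Sym2 V) → ℂ := fun F => (-1) ^ crossingNumber p F * ∏ e ∈ F, x e
  -- The shift by one matches the index `r + 1`; on `S` the count is nonzero, so no truncation
  -- occurs.
  set f : Finset (Sym2 V) → ℕ := fun F => F.val.countP (· ∉ EA) - 1
  have h1 : ∀ r : ℕ, configSum p x (configs G p EA (r + 1)) = ∑ F ∈ S with f F = r, g F := by
    intro r
    rw [configSum_configs hp hacyc x r.succ_pos]
    refine sum_congr ?_ fun _ _ => rfl
    ext F
    simp only [S, f, mem_filter, and_assoc]
    refine and_congr_right fun _ => ?_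
    omega
  have h2 : evenGenFun G p x - 1 = ∑ F ∈ S, g F := by
    have h3 : evenGenFun G p x = ∑ F ∈ evenEdgeSets G, g F := rfl
    rw [h3, ← sum_filter_add_sum_filter_not (evenEdgeSets G)
      (fun F => F.val.countP (· ∉ EA) = 0), filter_evenEdgeSets_countP_eq_zero hp hacyc,
      sum_singleton]
    have h4 : g ∅ = 1 := by
      simp only [g]
      rw [crossingNumber, powersetCard_eq_empty.2 (by simp)]
      simp
    rw [h4, add_sub_cancel_left]
  rw [funext h1, h2, ← sum_fiberwise_of_maps_to (t := S.image f) fun F hF => mem_image_of_mem f hF]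
  refine hasSum_sum_of_ne_finset_zero fun r hr => ?_
  refine sum_eq_zero fun F hF => ?_
  obtain ⟨hFS, rfl⟩ := mem_filter.1 hF
  exact (hr (mem_image_of_mem f hFS)).elim

end Acyclicity

end

end SignedLoops

theorem mainTheorem11 {V : Type*} [Fintype V] (G : SimpleGraph V) (p : V → ℂ)
    (hp : SignedLoops.IsStraightDrawing G p)
    (EA : Set (Sym2 V)) (hEA : EA ⊆ G.edgeSet)
    (hacyc : (SimpleGraph.fromEdgeSet EA).IsAcyclic)
    (x : Sym2 V → ℂ) :
    (∀ r : ℕ, 0 < r →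
      (SignedLoops.configs G p EA r).Finite ∧
      SignedLoops.configSum p x
        (SignedLoops.configs G p EA r \ SignedLoops.edgeDisjointConfigs G p EA r) = 0) ∧
    Summable (fun r : ℕ => SignedLoops.configSum p x (SignedLoops.configs G p EA (r + 1))) ∧
    SignedLoops.evenGenFun G p x =
      1 + ∑' r : ℕ, SignedLoops.configSum p x (SignedLoops.configs G p EA (r + 1)) := by
  have h := SignedLoops.hasSum_configSum hp hacyc x
  refine ⟨fun r _ => ⟨SignedLoops.finite_configs hacyc r,
    SignedLoops.configSum_sdiff_eq_zero hp hacyc x r⟩, h.summable, ?_⟩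
  rw [h.tsum_eq]
  ring
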